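/- **Setting.** Let $G$ be a finite simple graph, $M$ a matching of $G$, $\epsilon\in(0,1]$ with $1/\epsilon$ a power of $2$, and $h\in\{\frac12,\frac14,\dots,\frac{\epsilon^2}{64}\}$. A vertex is free if no edge of $M$ is incident to it. Each edge is represented by two opposite arcs. A blossom is a pair $(B,E_B)$: either trivial, $(\{v\},\emptyset)$, or formed from an odd number $k+1\ge 3$ of vertex-disjoint blossoms $A_0,\dots,A_k$ joined in a cycle by edges $e_i$ between $A_i$ and $A_{i+1}$ (indices mod $k+1$) with $e_1,e_3,\dots,e_{k-1}\in M$; then $B=\bigcup A_i$ and $E_B=\bigcup E_{A_i}\cup\{e_0,\dots,e_k\}$. For a laminar set $\Omega$ of blossoms, $\Omega(v)$ is its inclusion-maximal (root) blossom containing $v$ (or $\{v\}$ if there is none), and $H/\Omega$ is the simple graph obtained from $H$ by contracting the root blossoms. An alternating tree is a rooted tree whose root is free and all of whose root-to-leaf paths are alternating and of even length; its inner vertices are the non-root vertices at odd depth, the others are outer. **Structures and labels.** Each free vertex $\alpha$ that is not removed holds $S_\alpha=(G_\alpha,\Omega_\alpha,w'_\alpha)$, where $G_\alpha$ consists of vertices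 and arcs; put $T'_\alpha=G_\alpha/\Omega_\alpha$. $S_\alpha$ is a *structure* if * $G_\alpha$ is a subgraph of $G$ minus the removed vertices; * $\Omega_\alpha$ is a regular set of blossoms of $G_\alpha$: it is laminar, contains all trivial blossoms of $G_\alpha$, and each non-trivial blossom in it is formed by a cycle of blossoms of $\Omega_\alpha$; moreover $T'_\alpha$ is an alternating tree with respect to the contracted matching, with root $\Omega_\alpha(\alpha)$, whose inner vertices are trivial blossoms; * $w'_\alpha$ (the working vertex) is $\emptyset$ or an outer vertex of $T'_\alpha$; * (disjointness) $G_\alpha$ and $G_\beta$ are vertex-disjoint for every other non-removed free vertex $\beta$; * (tree representation) if $(u,v)$ is an arc of $G_\alpha$ with $\Omega_\alpha(u)\ne\Omega_\alpha(v)$, then $\Omega_\alpha(u)$ is the parent of $\Omega_\alpha(v)$ in $T'_\alpha$; * (unique arc) whenever $x$ is the parent of $y$ in $T'_\alpha$, there is exactly one arc $(u,v)$ of $G_\alpha$ with $\Omega_\alpha(u)=x$ and $\Omega_\alpha(v)=y$. Each matched arc $a$ has a label $\ell(a)$; a matched arc of $T'_\alpha$ carries the label of the matched arc of $G$ it comes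 from. $\Omega$ denotes the union of all $\Omega_\alpha$ and of all trivial blossoms of non-removed vertices. **The procedure Alg-Phase.** Initially $\ell\equiv 3/\epsilon+1$, nothing is removed, $G_\alpha$ is the single vertex $\alpha$, $\Omega_\alpha=\{\{\alpha\}\}$ and $w'_\alpha=\{\alpha\}$. Then $72/(h\epsilon)$ pass-bundles are executed, each as follows. 1. Mark each $S_\alpha$ "on hold" iff it has at least $6/h+1$ vertices, and "not modified". 2. *Extend-Active-Path.* For each arc $g=(u,v)$ of $G$, in arbitrary order: ignore $g$ if $u$ or $v$ is removed, $\Omega(u)=\Omega(v)$, $g$ is matched, $\Omega(u)$ is not the working vertex of some $S_\alpha$, or that $S_\alpha$ is on hold or modified. If $\Omega(v)$ is an outer vertex of $S_\alpha$, perform Contract$(g)$; if it is an outer vertex of another structure, perform Augment$(g)$. Otherwise let $a=(v,t)$ be the matched arc with tail $v$ and let $d$ be the label of the matched arc of $G/\Omega$ with head $\Omega(u)$ ($d=0$ if there is none); if $d+1<\ell(a)$, perform Overtake$(g,a,d+1)$. 3. *Contract-and-Augment.* While some arc $g=(u,v)$ of $G$ has both ends in one $G_\alpha$, with $\Omega(u)=w'_\alpha$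 and $\Omega(v)\neq\Omega(u)$ outer, perform Contract$(g)$. Then, for each arc $(u,v)$ of $G$ in arbitrary order, if $\Omega(u),\Omega(v)$ are outer vertices of different structures, perform Augment. 4. *Backtrack-Stuck-Structures.* For each active $S_\alpha$ ($w'_\alpha\ne\emptyset$) neither on hold nor modified, replace $w'_\alpha$ by its grandparent in $T'_\alpha$, or by $\emptyset$ if $w'_\alpha$ is the root. The basic operations mark the structures involved as modified. * Augment$(g)$ records an augmenting path through $g$ between the two roots and removes all vertices of both structures. * Contract$(g)$, $g=(u,v)$, adds $g$ to $G_\alpha$ and the blossom $B$ of $T'_\alpha\cup\{(\Omega(u),\Omega(v))\}$ to $\Omega_\alpha$, sets $w'_\alpha=B$, and sets the labels of all matched arcs inside $B$ to $0$. * Overtake$(g,a,k)$, $g=(u,v)$, $a=(v,t)$, sets $\ell(a)=k$. If $a$ is in no structure, $g$ and $a$ are added to $G_\alpha$, $\{v\}$ and $\{t\}$ to $\Omega_\alpha$, and $w'_\alpha=\{t\}$. If $a$ is in $S_\beta$, let $(p,v)$ be the unmatched arc of $G_\beta$ from the parent of $\Omega(v)$; it is deleted from $G_\beta$ and $g$ is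 added to $G_\alpha$. If $\beta=\alpha$, then $w'_\alpha$ becomes $\Omega(t)$. If $\beta\ne\alpha$, the vertices, arcs and blossoms of the subtree of $\Omega(v)$ are moved from $S_\beta$ to $S_\alpha$; if $w'_\beta$ was in the subtree of $\Omega(t)$, then $w'_\alpha$ becomes $w'_\beta$ and $w'_\beta$ becomes $\Omega(p)$, and otherwise $w'_\alpha$ becomes $\Omega(t)$. **Lemma.** At every moment of every execution of Alg-Phase (after the initialization and after each basic operation), for each free vertex $\alpha$ that is not removed, $S_\alpha$ is a structure, and for every alternating path of $T'_\alpha$ starting at the root whose successive matched arcs are $a'_1,\dots,a'_k$ one has $\ell(a'_1)<\ell(a'_2)<\dots<\ell(a'_k)$. -/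

import Mathlib

open Classical

noncomputable section

namespace AlgPhase

/-! ### Blossoms and contractions -/

/-- A blossom is identified with a vertex set `B` and an edge set `E_B`. -/
@[ext]
structure Blossom (V : Type*) where
  verts : Set V
  edges : Set (Sym2 V)

/-- The trivial blossom `{v}`, with empty edge set. -/
def Blossom.triv {V : Type*} (v : V) : Blossom V := ⟨{v}, ∅⟩

/-- `b` is the blossom defined by the odd cycle `A 0, …, A k` of vertex-disjoint blossoms,
joined by the edges `e 0, …, e k` of `H` (with `e i` between `A i` and `A (i + 1)`, indices modulo
`k + 1`), where `e 1, e 3, …, e (k - 1)` are matched. -/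
structure IsBlossomCycle {V : Type*} (H : SimpleGraph V) (M : Set (Sym2 V)) (k : ℕ)
    (A : Fin (k + 1) → Blossom V) (e : Fin (k + 1) → V × V) (b : Blossom V) : Prop where
  even : Even k
  two_le : 2 ≤ k
  disjoint : ∀ i j, i ≠ j → Disjoint (A i).verts (A j).verts
  adj : ∀ i, H.Adj (e i).1 (e i).2
  fst_mem : ∀ i, (e i).1 ∈ (A i).verts
  snd_mem : ∀ i, (e i).2 ∈ (A (i + 1)).verts
  matched : ∀ i : Fin (k + 1), Odd (i : ℕ) → s((e i).1, (e i).2) ∈ M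
  verts_eq : b.verts = ⋃ i, (A i).verts
  edges_eq : b.edges = (⋃ i, (A i).edges) ∪ Set.range (fun i => s((e i).1, (e i).2))

/-- Blossoms, with respect to the matching `M`, of the graph with vertex set `X` and edges `H`. -/
inductive IsBlossom {V : Type*} (X : Set V) (H : SimpleGraph V) (M : Set (Sym2 V)) :
    Blossom V → Prop
  | triv (v : V) : v ∈ X → IsBlossom X H M (Blossom.triv v)
  | cycle (k : ℕ) (A : Fin (k + 1) → Blossom V) (e : Fin (k + 1) → V × V) (b : Blossom V) :
      (∀ i, IsBlossom X H M (A i)) → IsBlossomCycle H M k A e b → IsBlossom X H M b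

/-- A root blossom of `Ω` is one that is not contained in any other blossom of `Ω`. -/
def IsRootBlossom {V : Type*} (Ω : Set (Blossom V)) (b : Blossom V) : Prop :=
  b ∈ Ω ∧ ∀ c ∈ Ω, b.verts ⊆ c.verts → c = b

/-- `Ω(v)`: the root blossom of `Ω` containing `v`. A vertex that lies in no blossom of `Ω` is not
contracted, and is identified with its trivial blossom. -/
def rootAt {V : Type*} (Ω : Set (Blossom V)) (v : V) : Blossom V :=
  if h : ∃ b, IsRootBlossom Ω b ∧ v ∈ b.verts then h.choose else Blossom.triv v

/-- The edges of the contracted graph `H / Ω`. -/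
def contractGraph {V : Type*} (H : SimpleGraph V) (Ω : Set (Blossom V)) :
    SimpleGraph (Blossom V) where
  Adj x y := x ≠ y ∧ ∃ u v, H.Adj u v ∧ rootAt Ω u = x ∧ rootAt Ω v = y
  symm := ⟨by
    rintro x y ⟨h, u, v, huv, hu, hv⟩
    exact ⟨h.symm, v, u, huv.symm, hv, hu⟩⟩
  loopless := ⟨fun _ h => h.1 rfl⟩

/-- The contracted matching `M / Ω` on `H / Ω`. -/
def contractMatching {V : Type*} (H : SimpleGraph V) (M : Set (Sym2 V)) (Ω : Set (Blossom V)) :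
    Set (Sym2 (Blossom V)) :=
  {f | ∃ u v, H.Adj u v ∧ s(u, v) ∈ M ∧ rootAt Ω u ≠ rootAt Ω v ∧
    f = s(rootAt Ω u, rootAt Ω v)}

/-! ### Alternating paths and alternating trees -/

/-- The edges of the walk are alternately in `N` and not in `N`. -/
def IsAlternating {W : Type*} {T : SimpleGraph W} (N : Set (Sym2 W)) {x y : W}
    (p : T.Walk x y) : Prop :=
  p.edges.IsChain (fun e f => e ∈ N ↔ f ∉ N)

/-- In the tree `T` rooted at `r`, the vertex `x` is the parent of `y`. -/
def IsParent {W : Type*} (T : SimpleGraph W) (r x y : W) : Prop :=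
  T.Adj x y ∧ T.dist r y = T.dist r x + 1

/-- In the tree `T` rooted at `r`, the vertex `x` is an ancestor of `y` or equal to `y`; that is,
`y` is in the subtree of `x`. -/
def IsAncestor {W : Type*} (T : SimpleGraph W) (r x y : W) : Prop :=
  ∃ p : T.Walk r y, p.IsPath ∧ x ∈ p.support

/-- Inner vertices of the tree with vertex set `X`, edges `T` and root `r`: non-root vertices at odd
distance from the root. -/
def IsInner {W : Type*} (X : Set W) (T : SimpleGraph W) (r x : W) : Prop :=
  x ∈ X ∧ x ≠ r ∧ Odd (T.dist r x)

/-- Outer vertices: all vertices that are not inner. -/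
def IsOuter {W : Type*} (X : Set W) (T : SimpleGraph W) (r x : W) : Prop :=
  x ∈ X ∧ ¬ IsInner X T r x

/-- The graph with vertex set `X` and edges `T` is an alternating tree with root `r`, with respect to
the matching `N`: it is a tree, `r` is free, and every root-to-leaf path is an even-length
alternating path. -/
structure IsAlternatingTree {W : Type*} (X : Set W) (T : SimpleGraph W) (N : Set (Sym2 W))
    (r : W) : Prop where
  root_mem : r ∈ X
  mem_of_adj : ∀ x y, T.Adj x y → x ∈ X ∧ y ∈ X
  isTree : (T.induce X).IsTree
  root_free : ∀ f ∈ N, r ∉ f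
  leaf : ∀ x ∈ X, (∀ y, ¬ IsParent T r x y) → ∀ p : T.Walk r x, p.IsPath →
    Even p.length ∧ IsAlternating N p

/-- `Ω` is a regular set of blossoms of the graph with vertex set `X` and edges `H`, with respect to
the matching `M` and the free vertex `α`. -/
structure IsRegular {V : Type*} (X : Set V) (H : SimpleGraph V) (M : Set (Sym2 V)) (α : V)
    (Ω : Set (Blossom V)) : Prop where
  isBlossom : ∀ b ∈ Ω, IsBlossom X H M b
  laminar : ∀ b ∈ Ω, ∀ c ∈ Ω, b ≠ c →
    b.verts ⊂ c.verts ∨ c.verts ⊂ b.verts ∨ Disjoint b.verts c.verts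
  triv_mem : ∀ v ∈ X, Blossom.triv v ∈ Ω
  closed : ∀ b ∈ Ω, (∃ v, b = Blossom.triv v) ∨
    ∃ (k : ℕ) (A : Fin (k + 1) → Blossom V) (e : Fin (k + 1) → V × V),
      IsBlossomCycle H M k A e b ∧ ∀ i, A i ∈ Ω
  altTree : IsAlternatingTree (rootAt Ω '' X) (contractGraph H Ω) (contractMatching H M Ω)
    (rootAt Ω α)
  inner_triv : ∀ x, IsInner (rootAt Ω '' X) (contractGraph H Ω) (rootAt Ω α) x →
    ∃ v, x = Blossom.triv v

/-! ### Structures of free vertices -/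

/-- The data `(G_α, Ω_α, w'_α)` of the structure of a free vertex. The subgraph `G_α` is given by its
vertices and its (directed) arcs; `work = none` stands for `w'_α = ∅`. -/
structure FreeStruct (V : Type*) where
  verts : Set V
  arcs : Set (V × V)
  blossoms : Set (Blossom V)
  work : Option (Blossom V)

namespace FreeStruct

variable {V : Type*}

/-- The undirected graph underlying `G_α`. -/
def graph (S : FreeStruct V) : SimpleGraph V := SimpleGraph.fromRel (fun u v => (u, v) ∈ S.arcs)

/-- `Ω_α(v)`. -/
def bl (S : FreeStruct V) (v : V) : Blossom V := rootAt S.blossoms v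

/-- The vertex set of `T'_α = G_α / Ω_α`. -/
def treeVerts (S : FreeStruct V) : Set (Blossom V) := S.bl '' S.verts

/-- The edges of `T'_α = G_α / Ω_α`; the root is `Ω_α(α)`. -/
def tree (S : FreeStruct V) : SimpleGraph (Blossom V) := contractGraph S.graph S.blossoms

/-- `x` is the parent of `y` in `T'_α`. -/
def Parent (S : FreeStruct V) (α : V) (x y : Blossom V) : Prop := IsParent S.tree (S.bl α) x y

/-- `y` is in the subtree of `x` in `T'_α`. -/
def InSubtree (S : FreeStruct V) (α : V) (x y : Blossom V) : Prop :=
  IsAncestor S.tree (S.bl α) x y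

/-- `x` is an outer vertex of `T'_α`. -/
def Outer (S : FreeStruct V) (α : V) (x : Blossom V) : Prop :=
  IsOuter S.treeVerts S.tree (S.bl α) x

/-- The parent of `x` in `T'_α`, where `x` is not the root. -/
def parentOf (S : FreeStruct V) (α : V) (x : Blossom V) : Blossom V :=
  @Classical.epsilon _ ⟨x⟩ (fun y => S.Parent α y x)

/-- The tail `p` of the unmatched arc `(p, v)` of `G_α` from the parent of `Ω(v)` to `Ω(v)`. -/
def parentTail {G : SimpleGraph V} (M : G.Subgraph) (S : FreeStruct V) (α v : V) : V :=
  @Classical.epsilon _ ⟨v⟩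
    (fun p => (p, v) ∈ S.arcs ∧ ¬ M.Adj p v ∧ S.Parent α (S.bl p) (S.bl v))

end FreeStruct

/-- The label `ℓ(a')` of a matched arc `a' = (x, y)` of a contracted graph: the label of the matched
arc `(u, v)` of `G` with `Ω(u) = x` and `Ω(v) = y`. -/
def arcLabel {V : Type*} {G : SimpleGraph V} (M : G.Subgraph) (ℓ : V × V → ℕ)
    (Ω : Set (Blossom V)) (x y : Blossom V) : ℕ :=
  if h : ∃ a : V × V, M.Adj a.1 a.2 ∧ rootAt Ω a.1 = x ∧ rootAt Ω a.2 = y then ℓ h.choose else 0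

/-- Along every alternating path of `T'_α` that starts at the root, the labels of the matched arcs
increase strictly. -/
def LabelsIncrease {V : Type*} {G : SimpleGraph V} (M : G.Subgraph) (ℓ : V × V → ℕ) (α : V)
    (S : FreeStruct V) : Prop :=
  ∀ (b : Blossom V) (p : S.tree.Walk (S.bl α) b), p.IsPath →
    IsAlternating (contractMatching S.graph M.edgeSet S.blossoms) p →
    ((p.darts.filter
        (fun d => decide (d.edge ∈ contractMatching S.graph M.edgeSet S.blossoms))).map
      (fun d => arcLabel M ℓ S.blossoms d.fst d.snd)).IsChain (· < ·)

/-! ### The state of the algorithm and its basic operations -/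

/-- The variables of a phase: the structures `S_α`, the labels of the matched arcs, the set of
removed vertices, the marks "on hold" and "modified", and the set `𝒫` of recorded paths (given as
vertex sequences). Only the structures of free vertices that are not removed, and only the labels of
matched arcs, are meaningful. -/
structure State (V : Type*) where
  S : V → FreeStruct V
  label : V × V → ℕ
  removed : Set V
  onHold : Set V
  modified : Set V
  paths : Set (List V)

namespace State

variable {V : Type*} {G : SimpleGraph V}

/-- `α` is a free vertex that is not removed. -/
def Live (M : G.Subgraph) (st : State V) (α : V) : Prop := α ∉ M.verts ∧ α ∉ st.removed

/-- The global set `Ω` of blossoms. -/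
def blossoms (M : G.Subgraph) (st : State V) : Set (Blossom V) :=
  {b | ∃ α, st.Live M α ∧ b ∈ (st.S α).blossoms} ∪ {b | ∃ v, v ∉ st.removed ∧ b = Blossom.triv v}

/-- `Ω(v)`, for the global set `Ω`. -/
def bl (M : G.Subgraph) (st : State V) (v : V) : Blossom V := rootAt (st.blossoms M) v

/-- `distance(u)`: the label of the matched arc of `G / Ω` whose head is `Ω(u)`, and `0` if `Ω(u)` is
a free vertex of `G / Ω`. -/
def distance (M : G.Subgraph) (st : State V) (u : V) : ℕ :=
  if h : ∃ a : V × V, M.Adj a.1 a.2 ∧ st.bl M a.1 ≠ st.bl M u ∧ st.bl M a.2 = st.bl M u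
  then st.label h.choose else 0

/-- The structure of each free vertex `α` is initialized to the single vertex `α`, with working vertex
`{α}`; all labels are `ℓ_max + 1`, with `ℓ_max = 3 / ε` (an integer). -/
def initial (V : Type*) (ε : ℝ) : State V where
  S α := { verts := {α}, arcs := ∅, blossoms := {Blossom.triv α}, work := some (Blossom.triv α) }
  label _ := ⌊3 / ε⌋₊ + 1
  removed := ∅
  onHold := ∅
  modified := ∅
  paths := ∅

/-- The marking loop at the beginning of a pass-bundle, with `limit_h = 6 / h + 1`. -/
def mark (st : State V) (h : ℝ) : State V :=
  { st with
    onHold := {α | 6 / h + 1 ≤ ((st.S α).verts.ncard : ℝ)}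
    modified := ∅ }

/-- Replace the structure of `α` by `S'`. -/
def setStruct (st : State V) (α : V) (S' : FreeStruct V) : State V :=
  { st with S := fun γ => if γ = α then S' else st.S γ }

/-- Set the label of the arc `a` to `k`. -/
def setLabel (st : State V) (a : V × V) (k : ℕ) : State V :=
  { st with label := fun c => if c = a then k else st.label c }

/-- Mark the structures of the vertices in `A` as modified. -/
def setModified (st : State V) (A : Set V) : State V :=
  { st with modified := st.modified ∪ A }

/-- `P` is an augmenting path found through the arc `(u, v)`: an even-length alternating path of `G_α`
from `α` to `u`, followed by `(u, v)` and by the reverse of an even-length alternating path of `G_β`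
from `β` to `v`. -/
def IsRecordedPath (M : G.Subgraph) (st : State V) (α β u v : V) (P : List V) : Prop :=
  ∃ (p : (st.S α).graph.Walk α u) (q : (st.S β).graph.Walk β v),
    p.IsPath ∧ Even p.length ∧ IsAlternating M.edgeSet p ∧
    q.IsPath ∧ Even q.length ∧ IsAlternating M.edgeSet q ∧
    P = p.support ++ q.support.reverse

/-- `Augment` on the arc `g = (u, v)`, where `Ω(u)` and `Ω(v)` are in the structures of `α` and `β`:
an augmenting path through `g` is recorded, and both structures are removed. -/
def augment (M : G.Subgraph) (st : State V) (α β u v : V) : State V :=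
  { st with
    paths := insert (Classical.epsilon (st.IsRecordedPath M α β u v)) st.paths
    removed := st.removed ∪ (st.S α).verts ∪ (st.S β).verts
    modified := st.modified ∪ {α, β} }

/-- The root blossoms on the cycle of `T'_α ∪ {(Ω(u), Ω(v))}`, that is, the vertices of the path from
`Ω(u)` to `Ω(v)` in the tree `T'_α`. -/
def cycleVerts (st : State V) (α u v : V) : Set (Blossom V) :=
  {c | ∃ p : (st.S α).tree.Walk ((st.S α).bl u) ((st.S α).bl v), p.IsPath ∧ c ∈ p.support}

/-- The blossom `B` of `T'_α ∪ {(Ω(u), Ω(v))}`: its vertices are those of the root blossoms on the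
cycle, its edges are those of these root blossoms, the edges of `G_α` that join two of them, and
`{u, v}`. -/
def newBlossom (st : State V) (α u v : V) : Blossom V where
  verts := {x | ∃ c ∈ st.cycleVerts α u v, x ∈ c.verts}
  edges := {f | ∃ c ∈ st.cycleVerts α u v, f ∈ c.edges} ∪
    {f | ∃ x y, (x, y) ∈ (st.S α).arcs ∧ (st.S α).bl x ≠ (st.S α).bl y ∧
      (st.S α).bl x ∈ st.cycleVerts α u v ∧ (st.S α).bl y ∈ st.cycleVerts α u v ∧
      f = s(x, y)} ∪ {s(u, v)}

/-- `Contract` on the arc `g = (u, v)`, where `Ω(u)` and `Ω(v)` are in the structure of `α`. -/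
def contract (M : G.Subgraph) (st : State V) (α u v : V) : State V :=
  { st with
    S := fun γ => if γ = α then
        { verts := (st.S α).verts
          arcs := insert (u, v) (st.S α).arcs
          blossoms := insert (st.newBlossom α u v) (st.S α).blossoms
          work := some (st.newBlossom α u v) }
      else st.S γ
    label := fun a => if M.Adj a.1 a.2 ∧ a.1 ∈ (st.newBlossom α u v).verts ∧
        a.2 ∈ (st.newBlossom α u v).verts then 0 else st.label a
    modified := st.modified ∪ {α} }

/-- `Overtake`, the case in which the matched arc `a = (v, t)` is in no structure. -/
def overtakeNew (st : State V) (α u v t : V) (k : ℕ) : State V :=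
  ((st.setStruct α
    { verts := (st.S α).verts ∪ {v, t}
      arcs := (st.S α).arcs ∪ {(u, v), (v, t)}
      blossoms := (st.S α).blossoms ∪ {Blossom.triv v, Blossom.triv t}
      work := some (Blossom.triv t) }).setLabel (v, t) k).setModified {α}

/-- `Overtake`, the case in which `a = (v, t)` is in the structure of `α` itself. -/
def overtakeSelf (M : G.Subgraph) (st : State V) (α u v t : V) (k : ℕ) : State V :=
  ((st.setStruct α
    { verts := (st.S α).verts
      arcs := ((st.S α).arcs \ {((st.S α).parentTail M α v, v)}) ∪ {(u, v)}
      blossoms := (st.S α).blossoms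
      work := some ((st.S α).bl t) }).setLabel (v, t) k).setModified {α}

/-- The vertices moved by `Overtake` from the structure of `β`. -/
def movedVerts (st : State V) (β v : V) : Set V :=
  {x | x ∈ (st.S β).verts ∧ (st.S β).InSubtree β ((st.S β).bl v) ((st.S β).bl x)}

/-- The arcs moved by `Overtake` from the structure of `β`. -/
def movedArcs (st : State V) (β v : V) : Set (V × V) :=
  {a | a ∈ (st.S β).arcs ∧ a.1 ∈ st.movedVerts β v ∧ a.2 ∈ st.movedVerts β v}

/-- The blossoms moved by `Overtake` from the structure of `β`. -/
def movedBlossoms (st : State V) (β v : V) : Set (Blossom V) :=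
  {b | b ∈ (st.S β).blossoms ∧ b.verts ⊆ st.movedVerts β v}

/-- The working vertex of the structure of `β` is in the subtree of `Ω(t)`. -/
def WorkBelow (st : State V) (β t : V) : Prop :=
  ∃ w, (st.S β).work = some w ∧ (st.S β).InSubtree β ((st.S β).bl t) w

/-- `Overtake`, the case in which `a = (v, t)` is in the structure of `β ≠ α`. -/
def overtakeOther (M : G.Subgraph) (st : State V) (α β u v t : V) (k : ℕ) : State V :=
  ((((st.setStruct β
    { verts := (st.S β).verts \ st.movedVerts β v
      arcs := ((st.S β).arcs \ {((st.S β).parentTail M β v, v)}) \ st.movedArcs β v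
      blossoms := (st.S β).blossoms \ st.movedBlossoms β v
      work := if st.WorkBelow β t then some ((st.S β).bl ((st.S β).parentTail M β v))
        else (st.S β).work }).setStruct α
    { verts := (st.S α).verts ∪ st.movedVerts β v
      arcs := (st.S α).arcs ∪ {(u, v)} ∪ st.movedArcs β v
      blossoms := (st.S α).blossoms ∪ st.movedBlossoms β v
      work := if st.WorkBelow β t then (st.S β).work else some ((st.S β).bl t) }).setLabel
    (v, t) k).setModified {α, β})

/-- `Overtake(g, a, k)` with `g = (u, v)` and `a = (v, t)`, where `Ω(u)` is the working vertex of the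
structure of `α`. -/
inductive Overtake (M : G.Subgraph) (st : State V) (α u v t : V) (k : ℕ) : State V → Prop
  | new : (∀ β, st.Live M β → (v, t) ∉ (st.S β).arcs) →
      Overtake M st α u v t k (st.overtakeNew α u v t k)
  | self : (v, t) ∈ (st.S α).arcs →
      Overtake M st α u v t k (st.overtakeSelf M α u v t k)
  | other (β : V) : st.Live M β → β ≠ α → (v, t) ∈ (st.S β).arcs →
      Overtake M st α u v t k (st.overtakeOther M α β u v t k)

/-- Backtrack the structure of `α`, if it is neither on hold nor modified: the working vertex moves to
the parent of its parent; if it is the root, it becomes `∅`. -/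
def backtrack (M : G.Subgraph) (st : State V) (α : V) : State V :=
  if st.Live M α ∧ α ∉ st.onHold ∧ α ∉ st.modified then
    st.setStruct α { st.S α with
      work := match (st.S α).work with
        | none => none
        | some w => if w = (st.S α).bl α then none
            else some ((st.S α).parentOf α ((st.S α).parentOf α w)) }
  else st

end State

/-! ### The procedures of a phase -/

variable {V : Type*} {G : SimpleGraph V}

/-- The arc `g = (u, v)` is not ignored by `Extend-Active-Path`, and `α` is the free vertex whose
structure has the working vertex `Ω(u)`. -/
structure Eligible (M : G.Subgraph) (st : State V) (α u v : V) : Prop where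
  fst_not_removed : u ∉ st.removed
  snd_not_removed : v ∉ st.removed
  non_blossom : st.bl M u ≠ st.bl M v
  live : st.Live M α
  work : (st.S α).work = some (st.bl M u)
  unmatched : ¬ M.Adj u v
  not_modified : α ∉ st.modified
  not_onHold : α ∉ st.onHold

/-- `Ω(v)` is an outer vertex of the structure of the free vertex `β`. -/
def OuterIn (M : G.Subgraph) (st : State V) (β v : V) : Prop :=
  v ∉ st.removed ∧ st.Live M β ∧ (st.S β).Outer β (st.bl M v)

/-- How `Extend-Active-Path` treats the arc `(u, v)` of the stream. -/
inductive ExtendArc (M : G.Subgraph) (st : State V) (u v : V) : State V → Prop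
  | skip : (∀ α, ¬ Eligible M st α u v) → ExtendArc M st u v st
  | contract (α : V) : Eligible M st α u v → OuterIn M st α v →
      ExtendArc M st u v (st.contract M α u v)
  | augment (α β : V) : Eligible M st α u v → β ≠ α → OuterIn M st β v →
      ExtendArc M st u v (st.augment M α β u v)
  | overtake (α t : V) (st' : State V) : Eligible M st α u v → (∀ β, ¬ OuterIn M st β v) →
      M.Adj v t → st.distance M u + 1 < st.label (v, t) →
      st.Overtake M α u v t (st.distance M u + 1) st' → ExtendArc M st u v st'
  | noOvertake (α : V) : Eligible M st α u v → (∀ β, ¬ OuterIn M st β v) →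
      (∀ t, M.Adj v t → ¬ st.distance M u + 1 < st.label (v, t)) → ExtendArc M st u v st

/-- The first step of `Contract-and-Augment` may invoke `Contract` on the arc `(u, v)` of `G`, which
connects two vertices of `G_α`. -/
structure Contractible (M : G.Subgraph) (st : State V) (α u v : V) : Prop where
  adj : G.Adj u v
  live : st.Live M α
  fst_mem : u ∈ (st.S α).verts
  snd_mem : v ∈ (st.S α).verts
  work : (st.S α).work = some (st.bl M u)
  non_blossom : st.bl M v ≠ st.bl M u
  outer : (st.S α).Outer α (st.bl M v)

/-- How the second step of `Contract-and-Augment` treats the arc `(u, v)` of the stream. -/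
inductive AugmentArc (M : G.Subgraph) (st : State V) (u v : V) : State V → Prop
  | skip : (∀ α β, α ≠ β → OuterIn M st α u → ¬ OuterIn M st β v) → AugmentArc M st u v st
  | augment (α β : V) : α ≠ β → OuterIn M st α u → OuterIn M st β v →
      AugmentArc M st u v (st.augment M α β u v)

/-- A stream presents every arc of `G` exactly once, in arbitrary order. -/
def IsStream (G : SimpleGraph V) (s : List (V × V)) : Prop :=
  s.Nodup ∧ ∀ a : V × V, a ∈ s ↔ G.Adj a.1 a.2

/-- The position in the program. The number `τ` counts the pass-bundles completed so far, and `rest`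
is what remains to be processed in the current loop. -/
inductive Position (V : Type*) where
  | bundle (τ : ℕ)
  | extend (τ : ℕ) (rest : List (V × V))
  | contract (τ : ℕ)
  | augment (τ : ℕ) (rest : List (V × V))
  | backtrack (τ : ℕ) (rest : List V)

/-- The steps of `Alg-Phase` on the graph `G` and the matching `M`, with parameter `ε` and scale `h`.
There are `τ_max(h) = 72 / (h ε)` pass-bundles. -/
inductive Step (M : G.Subgraph) (ε h : ℝ) : Position V × State V → Position V × State V → Prop
  | mark (τ : ℕ) (st : State V) (s : List (V × V)) : (τ : ℝ) < 72 / (h * ε) → IsStream G s →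
      Step M ε h (.bundle τ, st) (.extend τ s, st.mark h)
  | extend (τ : ℕ) (st st' : State V) (u v : V) (s : List (V × V)) : ExtendArc M st u v st' →
      Step M ε h (.extend τ ((u, v) :: s), st) (.extend τ s, st')
  | extendEnd (τ : ℕ) (st : State V) :
      Step M ε h (.extend τ [], st) (.contract τ, st)
  | contract (τ : ℕ) (st : State V) (α u v : V) : Contractible M st α u v →
      Step M ε h (.contract τ, st) (.contract τ, st.contract M α u v)
  | contractEnd (τ : ℕ) (st : State V) (s : List (V × V)) :
      (∀ α u v, ¬ Contractible M st α u v) → IsStream G s →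
      Step M ε h (.contract τ, st) (.augment τ s, st)
  | augment (τ : ℕ) (st st' : State V) (u v : V) (s : List (V × V)) : AugmentArc M st u v st' →
      Step M ε h (.augment τ ((u, v) :: s), st) (.augment τ s, st')
  | augmentEnd (τ : ℕ) (st : State V) (l : List V) : l.Nodup → (∀ α, α ∈ l ↔ st.Live M α) →
      Step M ε h (.augment τ [], st) (.backtrack τ l, st)
  | backtrack (τ : ℕ) (st : State V) (α : V) (l : List V) :
      Step M ε h (.backtrack τ (α :: l), st) (.backtrack τ l, st.backtrack M α)
  | backtrackEnd (τ : ℕ) (st : State V) :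
      Step M ε h (.backtrack τ [], st) (.bundle (τ + 1), st)

/-- The state `st` occurs, at the program position `pos`, in some execution of `Alg-Phase`. -/
def Occurs (M : G.Subgraph) (ε h : ℝ) (pos : Position V) (st : State V) : Prop :=
  Relation.ReflTransGen (Step M ε h) (.bundle 0, State.initial V ε) (pos, st)

/-- In the state `st`, the tuple `S_α = (G_α, Ω_α, w'_α)` is a structure of the free vertex `α`.
Removed vertices do not belong to the graph. -/
structure IsStructure (M : G.Subgraph) (st : State V) (α : V) : Prop where
  verts_not_removed : Disjoint (st.S α).verts st.removed
  arcs_sub : ∀ u v, (u, v) ∈ (st.S α).arcs →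
    G.Adj u v ∧ u ∈ (st.S α).verts ∧ v ∈ (st.S α).verts
  regular : IsRegular (st.S α).verts (st.S α).graph M.edgeSet α (st.S α).blossoms
  work_outer : ∀ w, (st.S α).work = some w → (st.S α).Outer α w
  disjointness : ∀ β, st.Live M β → β ≠ α → Disjoint (st.S α).verts (st.S β).verts
  tree_representation : ∀ u v, (u, v) ∈ (st.S α).arcs → (st.S α).bl u ≠ (st.S α).bl v →
    (st.S α).Parent α ((st.S α).bl u) ((st.S α).bl v)
  unique_arc : ∀ x y, (st.S α).Parent α x y →
    ∃! a : V × V, a ∈ (st.S α).arcs ∧ (st.S α).bl a.1 = x ∧ (st.S α).bl a.2 = y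

end AlgPhase

end

namespace AlgPhase

/-! ### Rooted trees given by a parent relation -/

/-! The global notions in a structure (contracted tree, distances, ancestors, alternating
root-to-leaf paths) are replaced by local conditions, which each basic operation preserves for local
reasons. A structure is described by the set `I` of its inner vertices and a map `p`. An inner `v`
is a trivial root blossom, entered by the arc `(p v, v)` from an outer vertex and left by the
matched arc `(v, mate M v)`; no other arc joins different root blossoms. Distinct inner vertices
have their mates in distinct root blossoms, none of which is the root, and every vertex is inner,
lies in the root blossom, or lies in the blossom of a mate. Finally, if `mate M v` and `p w` share a
root blossom, then the label of the matched arc at `v` is smaller than the label at `w`. This is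
`Layout`, built on `Forest`.

The labels do double duty. Climbing from an inner vertex to the preceding one lowers a natural
number, so the climb stops, and it can only stop at the root blossom. Thus the local conditions
already force a tree (`Layout.inner_induction`, `Layout.isRooted`), and `IsRooted` turns its parent
relation into statements on distances, paths, ancestors and acyclicity. In particular Overtake
inside one structure creates no cycle: if `u` were below `v`, the label `d` at `u` would be at least
that of `a`, whereas `d + 1 < ℓ(a)`. In local form only the inequality at the new link has to be
checked; lowering the label of `a` does no harm below it.

Overtake is composed of four moves on forests: `Forest.unlink`, `Forest.restrict`, `Forest.union`
and `Forest.link`. Forests are needed because a detached subtree has an inner top without parent and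
contains no root.

For Contract, the tree path from Ω(u) to Ω(v) ascends to the lowest common ancestor and then
descends. An inner vertex has only one child, so this ancestor is outer; hence the path has even
length and closes with the new edge to the odd cycle of a blossom (`IsValley.isBlossomCycle`).
Contracting it keeps the description (`IsLobe.contract_layout`): a matched arc entering the blossom
does so at its top, and the label inequalities along the old path compare it with every arc leaving
the blossom. The labels set to 0 belong to arcs that are no longer in the tree.

Augment deletes whole structures, and their vertex sets are closed under the matching. `Inv`
collects these facts, and `Step.inv` propagates them through an execution. -/

/-- `T` is the rooted tree on the vertex set `X` with root `r` whose parent relation is `P`. -/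
structure IsRooted {W : Type*} (X : Set W) (T : SimpleGraph W) (r : W) (P : W → W → Prop) :
    Prop where
  adj : ∀ x y, T.Adj x y ↔ P x y ∨ P y x
  mem : ∀ x y, P x y → x ∈ X ∧ y ∈ X
  uniq : ∀ x x' y, P x y → P x' y → x = x'
  root : ∀ x, ¬ P x r
  root_mem : r ∈ X
  reach : ∀ y ∈ X, Relation.ReflTransGen P r y

namespace IsRooted

variable {W : Type*} {X : Set W} {T : SimpleGraph W} {r : W} {P : W → W → Prop}

/-- Parents are unique, so a cycle through a vertex also passes through its parent; climbing in this
way leads to a cycle through the root, which has no parent. -/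
theorem not_cycle (h : IsRooted X T r P) {y : W} (hy : y ∈ X) : ¬ Relation.TransGen P y y := by
  have := h.reach y hy
  clear hy
  induction this with
  | refl =>
    intro hc
    obtain ⟨b, -, hb⟩ := Relation.TransGen.tail'_iff.1 hc
    exact h.root _ hb
  | tail _ hxy ih =>
    intro hc
    obtain ⟨b, hyb, hb⟩ := Relation.TransGen.tail'_iff.1 hc
    obtain rfl := h.uniq _ _ _ hb hxy
    exact ih (Relation.TransGen.head' hxy hyb)

theorem not_symm (h : IsRooted X T r P) {x y : W} (hxy : P x y) : ¬ P y x := fun hyx =>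
  h.not_cycle (h.mem _ _ hxy).1 (Relation.TransGen.head hxy (.single hyx))

theorem reach_mem (h : IsRooted X T r P) {x y : W} (hx : x ∈ X)
    (hxy : Relation.ReflTransGen P x y) : y ∈ X := by
  induction hxy with
  | refl => exact hx
  | tail _ h1 _ => exact (h.mem _ _ h1).2

/-- A path whose first step leads to a child descends all the way. -/
theorem down_of_first (h : IsRooted X T r P) {a b c : W} (hab : P a b) (q : T.Walk b c)
    (hq : q.IsPath) (ha : a ∉ q.support) : ∀ d ∈ q.darts, P d.fst d.snd := by
  induction q generalizing a with
  | nil => simp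
  | cons hadj q ih =>
    rename_i u v w
    have hp : P u v := by
      rcases (h.adj _ _).1 hadj with h1 | h1
      · exact h1
      · exact absurd (h.uniq _ _ _ hab h1) (by rintro rfl; simp at ha)
    intro d hd
    simp only [SimpleGraph.Walk.darts_cons, List.mem_cons] at hd
    rw [SimpleGraph.Walk.cons_isPath_iff] at hq
    rcases hd with rfl | hd
    · exact hp
    · exact ih hp hq.1 hq.2 d hd

theorem down_of_root (h : IsRooted X T r P) {c : W} (q : T.Walk r c) (hq : q.IsPath) :
    ∀ d ∈ q.darts, P d.fst d.snd := by
  cases q with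
  | nil => simp
  | cons hadj q =>
    rename_i v
    have hp : P r v := ((h.adj _ _).1 hadj).resolve_right (h.root _)
    rw [SimpleGraph.Walk.cons_isPath_iff] at hq
    intro d hd
    simp only [SimpleGraph.Walk.darts_cons, List.mem_cons] at hd
    rcases hd with rfl | hd
    · exact hp
    · exact h.down_of_first hp q hq.1 hq.2 d hd

theorem reach_of_down {a b : W} (q : T.Walk a b) (hq : ∀ d ∈ q.darts, P d.fst d.snd) :
    Relation.ReflTransGen P a b := by
  induction q with
  | nil => exact .refl
  | cons hadj q ih =>
    simp only [SimpleGraph.Walk.darts_cons, List.mem_cons, forall_eq_or_imp] at hq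
    exact .head hq.1 (ih hq.2)

theorem reachable (h : IsRooted X T r P) {a b : W} (hab : Relation.ReflTransGen P a b) :
    T.Reachable a b := by
  induction hab with
  | refl => exact .rfl
  | tail _ h1 ih => exact ih.trans ((h.adj _ _).2 (.inl h1)).reachable

/-- A shortest path to `y` descends all the way, so its last step comes from the unique parent `x`.
Dropping that step bounds the distance of `x`. -/
theorem dist_child (h : IsRooted X T r P) {x y : W} (hxy : P x y) :
    T.dist r y = T.dist r x + 1 := by
  have hadj := (h.adj x y).2 (.inl hxy)
  obtain ⟨q, hl⟩ := (h.reachable (h.reach x (h.mem _ _ hxy).1)).exists_walk_length_eq_dist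
  · have h1 := SimpleGraph.dist_le (q.concat hadj)
    simp only [SimpleGraph.Walk.length_concat] at h1
    obtain ⟨p, hp, hpl⟩ := (h.reachable (h.reach y (h.mem _ _ hxy).2)).exists_path_of_dist
    have hd := h.down_of_root p hp
    have hn : ¬ p.Nil := by
      intro hn
      have := hn.eq
      subst this
      exact h.root _ hxy
    have h3 : p.penultimate = x := by
      have := hd (p.lastDart hn) (by simp)
      exact h.uniq _ _ _ this hxy
    subst h3
    have h2 := SimpleGraph.dist_le p.dropLast
    have := SimpleGraph.Walk.length_dropLast_add_one hn
    omega

theorem isParent_iff (h : IsRooted X T r P) {x y : W} : IsParent T r x y ↔ P x y := by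
  constructor
  · rintro ⟨h1, h2⟩
    rcases (h.adj _ _).1 h1 with h1 | h1
    · exact h1
    · have := h.dist_child h1
      omega
  · exact fun h1 => ⟨(h.adj _ _).2 (.inl h1), h.dist_child h1⟩

theorem isAncestor_iff (h : IsRooted X T r P) {x y : W} (hx : x ∈ X) :
    IsAncestor T r x y ↔ Relation.ReflTransGen P x y := by
  constructor
  · rintro ⟨p, hp, hxp⟩
    apply reach_of_down (p.dropUntil x hxp)
    intro d hd
    exact h.down_of_root p hp d (p.darts_dropUntil_subset_darts hxp hd)
  · intro hxy
    obtain ⟨p, hp⟩ := (h.reachable (h.reach y (h.reach_mem hx hxy))).exists_isPath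
    refine ⟨p, hp, ?_⟩
    have hd := h.down_of_root p hp
    clear hp
    -- The chain is read from its end: the penultimate vertex of a descending path is the parent of
    -- its last vertex, so the path retraces the chain up to `x`.
    induction hxy with
    | refl => simp
    | tail hxz hzy ih =>
      rename_i z y
      have hn : ¬ p.Nil := by
        intro hn
        have := hn.eq
        subst this
        exact h.root _ hzy
      have h3 : p.penultimate = z := by
        have := hd (p.lastDart hn) (by simp)
        exact h.uniq _ _ _ this hzy
      subst h3
      have := ih p.dropLast (fun d hd' => hd d (by
        rw [← p.concat_dropLast (p.adj_penultimate hn), SimpleGraph.Walk.darts_concat]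
        simp only [List.concat_eq_append, List.mem_append]
        exact .inl hd'))
      rw [← p.concat_dropLast (p.adj_penultimate hn), SimpleGraph.Walk.support_concat]
      simp only [List.mem_append]
      exact .inl this

/-- Every edge is a bridge: a walk from outside the subtree of `y` to inside can enter only through
the edge from the parent of `y`. -/
theorem isAcyclic (h : IsRooted X T r P) : T.IsAcyclic := by
  rw [SimpleGraph.isAcyclic_iff_forall_adj_isBridge]
  have key : ∀ x y, P x y → T.IsBridge s(x, y) := by
    intro x y hxy
    rw [SimpleGraph.isBridge_iff_forall_walk_mem_edges]
    have : ∀ a b (p : T.Walk a b), ¬ Relation.ReflTransGen P y a → Relation.ReflTransGen P y b →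
        s(x, y) ∈ p.edges := by
      intro a b p
      induction p with
      | nil => exact fun h1 h2 => absurd h2 h1
      | cons hadj p ih =>
        rename_i a c b
        intro h1 h2
        simp only [SimpleGraph.Walk.edges_cons, List.mem_cons]
        by_cases hc : Relation.ReflTransGen P y c
        · left
          rcases (h.adj _ _).1 hadj with h3 | h3
          · rcases Relation.ReflTransGen.cases_tail hc with rfl | ⟨z, hz, hzc⟩
            · rw [h.uniq _ _ _ hxy h3]
            · exact absurd (h.uniq _ _ _ hzc h3 ▸ hz) h1
          · exact absurd (hc.tail h3) h1
        · exact .inr (ih hc h2)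
    intro p
    exact this _ _ p
      (fun hc => h.not_cycle (h.mem _ _ hxy).1 (Relation.TransGen.head' hxy hc)) .refl
  intro x y hxy
  rcases (h.adj _ _).1 hxy with h1 | h1
  · exact key _ _ h1
  · rw [Sym2.eq_swap]
    exact key _ _ h1

theorem isTree (h : IsRooted X T r P) : (T.induce X).IsTree := by
  refine ⟨?_, h.isAcyclic.induce X⟩
  have key : ∀ y, Relation.ReflTransGen P r y → ∀ hy : y ∈ X,
      (T.induce X).Reachable ⟨r, h.root_mem⟩ ⟨y, hy⟩ := by
    intro y hy
    induction hy with
    | refl => exact fun _ => .rfl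
    | tail _ hxy ih =>
      intro hy
      refine (ih (h.mem _ _ hxy).1).trans (SimpleGraph.Adj.reachable ?_)
      exact (h.adj _ _).2 (.inl hxy)
  have : Nonempty X := ⟨⟨r, h.root_mem⟩⟩
  refine ⟨fun a b => ?_⟩
  exact (key a (h.reach a a.2) a.2).symm.trans (key b (h.reach b b.2) b.2)

/-- Every path of a rooted tree first ascends and then descends. -/
theorem exists_valley (h : IsRooted X T r P) {a b : W} (q : T.Walk a b) (hq : q.IsPath) :
    ∃ c ≤ q.length, (∀ j < c, P (q.getVert (j + 1)) (q.getVert j)) ∧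
      ∀ j, c ≤ j → j < q.length → P (q.getVert j) (q.getVert (j + 1)) := by
  induction q with
  | nil => exact ⟨0, by simp⟩
  | cons hadj q ih =>
    rename_i u v w
    have hq' := (SimpleGraph.Walk.cons_isPath_iff _ _).1 hq
    rcases (h.adj _ _).1 hadj with h1 | h1
    · refine ⟨0, Nat.zero_le _, by simp, ?_⟩
      intro j _ hj
      rcases j with _ | j
      · simpa using h1
      · have hd := h.down_of_first h1 q hq'.1 hq'.2
        simp only [SimpleGraph.Walk.length_cons, Nat.add_lt_add_iff_right] at hj
        have : j < q.darts.length := by simpa using hj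
        have := hd q.darts[j] (List.getElem_mem _)
        rw [SimpleGraph.Walk.darts_getElem_eq_getVert] at this
        simpa using this
    · obtain ⟨c, hc, h2, h3⟩ := ih hq'.1
      refine ⟨c + 1, by simpa using hc, ?_, ?_⟩
      · intro j hj
        rcases j with _ | j
        · simpa using h1
        · simpa using h2 j (by omega)
      · intro j hj hj'
        rcases j with _ | j
        · omega
        · simpa using h3 j (by omega) (by simpa using hj')

end IsRooted

/-! ### Root blossoms -/

section Blossoms

variable {V : Type*}

theorem mem_rootAt (Ω : Set (Blossom V)) (v : V) : v ∈ (rootAt Ω v).verts := by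
  unfold rootAt
  split_ifs with h
  · exact h.choose_spec.2
  · exact rfl

/-- A blossom that contains a blossom around `v` is itself around `v`, so maximality is decided
among the blossoms containing `v`. -/
theorem rootAt_congr {Ω Ω' : Set (Blossom V)} {v : V}
    (h : ∀ b : Blossom V, v ∈ b.verts → (b ∈ Ω ↔ b ∈ Ω')) : rootAt Ω v = rootAt Ω' v := by
  have : (fun b => IsRootBlossom Ω b ∧ v ∈ b.verts) =
      fun b => IsRootBlossom Ω' b ∧ v ∈ b.verts := by
    funext b
    apply propext
    refine and_congr_left fun hv => and_congr (h b hv) (forall_congr' fun c => ?_)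
    constructor
    · exact fun hc hcΩ hbc => hc ((h c (hbc hv)).2 hcΩ) hbc
    · exact fun hc hcΩ hbc => hc ((h c (hbc hv)).1 hcΩ) hbc
  unfold rootAt
  rw [this]

theorem IsBlossom.verts_subset {X : Set V} {H : SimpleGraph V} {N : Set (Sym2 V)} {b : Blossom V}
    (hb : IsBlossom X H N b) : b.verts ⊆ X := by
  induction hb with
  | triv v hv => simpa [Blossom.triv] using hv
  | cycle k A e b _ hc ih =>
    rw [hc.verts_eq]
    exact Set.iUnion_subset ih

theorem IsBlossom.nonempty {X : Set V} {H : SimpleGraph V} {N : Set (Sym2 V)} {b : Blossom V}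
    (hb : IsBlossom X H N b) : b.verts.Nonempty := by
  induction hb with
  | triv v hv => exact ⟨v, rfl⟩
  | cycle k A e b _ hc ih =>
    rw [hc.verts_eq]
    obtain ⟨x, hx⟩ := ih 0
    exact ⟨x, Set.mem_iUnion.2 ⟨0, hx⟩⟩

theorem IsBlossomCycle.subset {H : SimpleGraph V} {N : Set (Sym2 V)} {k : ℕ}
    {A : Fin (k + 1) → Blossom V} {e : Fin (k + 1) → V × V} {b : Blossom V}
    (h : IsBlossomCycle H N k A e b) (i : Fin (k + 1)) : (A i).verts ⊆ b.verts := by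
  rw [h.verts_eq]
  exact Set.subset_iUnion (fun i => (A i).verts) i

theorem IsBlossomCycle.mono {H H' : SimpleGraph V} {N : Set (Sym2 V)} {k : ℕ}
    {A : Fin (k + 1) → Blossom V} {e : Fin (k + 1) → V × V} {b : Blossom V}
    (h : IsBlossomCycle H N k A e b)
    (hH : ∀ u v, u ∈ b.verts → v ∈ b.verts → H.Adj u v → H'.Adj u v) :
    IsBlossomCycle H' N k A e b :=
  { h with
    adj := fun i => hH _ _ (h.subset i (h.fst_mem i)) (h.subset _ (h.snd_mem i)) (h.adj i) }

/-- A blossom uses only edges between its own vertices. This is why arcs joining different root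
blossoms can be deleted without damage. -/
theorem IsBlossom.mono {X X' : Set V} {H H' : SimpleGraph V} {N : Set (Sym2 V)} {b : Blossom V}
    (hb : IsBlossom X H N b) (hX : b.verts ⊆ X')
    (hH : ∀ u v, u ∈ b.verts → v ∈ b.verts → H.Adj u v → H'.Adj u v) :
    IsBlossom X' H' N b := by
  induction hb with
  | triv v hv => exact .triv v (hX rfl)
  | cycle k A e b _ hc ih =>
    refine .cycle k A e b (fun i => ih i ((hc.subset i).trans hX) ?_) (hc.mono hH)
    exact fun u v hu hv => hH u v (hc.subset i hu) (hc.subset i hv)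

/-- `Ω` is a laminar set of blossoms of the graph with vertex set `X` and edges `H` that contains
the trivial blossoms and is closed under passing to the blossoms of a defining cycle. -/
structure IsFamily (X : Set V) (H : SimpleGraph V) (N : Set (Sym2 V)) (Ω : Set (Blossom V)) :
    Prop where
  isBlossom : ∀ b ∈ Ω, IsBlossom X H N b
  laminar : ∀ b ∈ Ω, ∀ c ∈ Ω, b ≠ c →
    b.verts ⊂ c.verts ∨ c.verts ⊂ b.verts ∨ Disjoint b.verts c.verts
  triv_mem : ∀ v ∈ X, Blossom.triv v ∈ Ω
  closed : ∀ b ∈ Ω, (∃ v, b = Blossom.triv v) ∨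
    ∃ (k : ℕ) (A : Fin (k + 1) → Blossom V) (e : Fin (k + 1) → V × V),
      IsBlossomCycle H N k A e b ∧ ∀ i, A i ∈ Ω

namespace IsFamily

variable {X : Set V} {H : SimpleGraph V} {N : Set (Sym2 V)} {Ω : Set (Blossom V)}

theorem root_unique (h : IsFamily X H N Ω) {b c : Blossom V} {v : V} (hb : IsRootBlossom Ω b)
    (hc : IsRootBlossom Ω c) (hvb : v ∈ b.verts) (hvc : v ∈ c.verts) : b = c := by
  by_contra hne
  rcases h.laminar b hb.1 c hc.1 hne with h1 | h1 | h1
  · exact hne (hb.2 c hc.1 h1.subset).symm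
  · exact hne (hc.2 b hb.1 h1.subset)
  · exact Set.disjoint_left.1 h1 hvb hvc

theorem rootAt_eq (h : IsFamily X H N Ω) {b : Blossom V} {v : V} (hb : IsRootBlossom Ω b)
    (hv : v ∈ b.verts) : rootAt Ω v = b := by
  have hex : ∃ b, IsRootBlossom Ω b ∧ v ∈ b.verts := ⟨b, hb, hv⟩
  unfold rootAt
  rw [dif_pos hex]
  exact h.root_unique hex.choose_spec.1 hb hex.choose_spec.2 hv

theorem isRoot_rootAt [Finite V] (h : IsFamily X H N Ω) {v : V} (hv : v ∈ X) :
    IsRootBlossom Ω (rootAt Ω v) := by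
  -- Maximality is taken among vertex sets, of which there are finitely many. Edge sets do not
  -- matter, since strict laminarity makes blossoms with equal vertex sets equal.
  have hfin : {s | ∃ b ∈ Ω, b.verts = s ∧ v ∈ s}.Finite := Set.toFinite _
  obtain ⟨s, ⟨b, hb, rfl, hvb⟩, hmax⟩ :=
    hfin.exists_maximal ⟨_, Blossom.triv v, h.triv_mem v hv, rfl, rfl⟩
  have hroot : IsRootBlossom Ω b := by
    refine ⟨hb, fun c hc hbc => ?_⟩
    have h2 : c.verts ⊆ b.verts := hmax ⟨c, hc, rfl, hbc hvb⟩ hbc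
    by_contra hne
    rcases h.laminar c hc b hb hne with h3 | h3 | h3
    · exact h3.2 hbc
    · exact h3.2 h2
    · exact Set.disjoint_left.1 h3 (hbc hvb) hvb
  rwa [h.rootAt_eq hroot hvb]

theorem rootAt_mem [Finite V] (h : IsFamily X H N Ω) {v : V} (hv : v ∈ X) : rootAt Ω v ∈ Ω :=
  (h.isRoot_rootAt hv).1

theorem rootAt_subset [Finite V] (h : IsFamily X H N Ω) {v : V} (hv : v ∈ X) :
    (rootAt Ω v).verts ⊆ X :=
  (h.isBlossom _ (h.rootAt_mem hv)).verts_subset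

theorem rootAt_eq_of_mem [Finite V] (h : IsFamily X H N Ω) {v x : V} (hv : v ∈ X)
    (hx : x ∈ (rootAt Ω v).verts) : rootAt Ω x = rootAt Ω v :=
  h.rootAt_eq (h.isRoot_rootAt hv) hx

theorem subset_rootAt [Finite V] (h : IsFamily X H N Ω) {b : Blossom V} {v : V} (hb : b ∈ Ω)
    (hv : v ∈ b.verts) : b.verts ⊆ (rootAt Ω v).verts := by
  have hvX := (h.isBlossom b hb).verts_subset hv
  by_cases hne : b = rootAt Ω v
  · rw [← hne]
  · rcases h.laminar b hb _ (h.rootAt_mem hvX) hne with h1 | h1 | h1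
    · exact h1.subset
    · exact absurd ((h.isRoot_rootAt hvX).2 b hb h1.subset) hne
    · exact absurd (mem_rootAt Ω v) (Set.disjoint_left.1 h1 hv)

theorem rootAt_const [Finite V] (h : IsFamily X H N Ω) {b : Blossom V} {v w : V} (hb : b ∈ Ω)
    (hv : v ∈ b.verts) (hw : w ∈ b.verts) : rootAt Ω v = rootAt Ω w :=
  h.rootAt_eq_of_mem ((h.isBlossom b hb).verts_subset hw) (h.subset_rootAt hb hw hv)

end IsFamily

end Blossoms

end AlgPhase

namespace AlgPhase

/-! ### Local descriptions of forests of alternating trees, and the moves on them -/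

section Forests

variable {V : Type*} {G : SimpleGraph V}

/-- The partner of `v` in the matching `M`. -/
noncomputable def mate (M : G.Subgraph) (v : V) : V := @Classical.epsilon _ ⟨v⟩ (M.Adj v)

theorem mate_eq {M : G.Subgraph} (hM : M.IsMatching) {v w : V} (h : M.Adj v w) :
    mate M v = w :=
  hM.eq_of_adj_left (Classical.epsilon_spec (p := M.Adj v) ⟨w, h⟩) h

/-- The undirected graph underlying a set of arcs. -/
def arcGraph (A : Set (V × V)) : SimpleGraph V := SimpleGraph.fromRel (fun u v => (u, v) ∈ A)

theorem arcGraph_mono {A A' : Set (V × V)} {u v : V}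
    (h1 : (u, v) ∈ A → (u, v) ∈ A') (h2 : (v, u) ∈ A → (v, u) ∈ A')
    (h : (arcGraph A).Adj u v) : (arcGraph A').Adj u v := by
  simp only [arcGraph, SimpleGraph.fromRel_adj] at h ⊢
  exact ⟨h.1, h.2.imp h1 h2⟩

theorem IsFamily.mono_graph {X : Set V} {H H' : SimpleGraph V} {N : Set (Sym2 V)}
    {Ω : Set (Blossom V)} (h : IsFamily X H N Ω)
    (hH : ∀ b ∈ Ω, ∀ x ∈ b.verts, ∀ y ∈ b.verts, H.Adj x y → H'.Adj x y) :
    IsFamily X H' N Ω where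
  isBlossom b hb := (h.isBlossom b hb).mono (h.isBlossom b hb).verts_subset
    (fun u v hu hv => hH b hb u hu v hv)
  laminar := h.laminar
  triv_mem := h.triv_mem
  closed b hb := (h.closed b hb).imp id fun ⟨k, A, e, hc, hA⟩ =>
    ⟨k, A, e, hc.mono (fun u v hu hv => hH b hb u hu v hv), hA⟩

theorem rootAt_eq_triv {Ω : Set (Blossom V)} {x : V}
    (h : ∀ b ∈ Ω, x ∈ b.verts → b = Blossom.triv x) : rootAt Ω x = Blossom.triv x := by
  unfold rootAt
  split_ifs with hex
  · exact h _ hex.choose_spec.1.1 hex.choose_spec.2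
  · rfl

/-- A local description of a forest of alternating trees: `I` is the set of inner vertices, `J` the
set of those inner vertices `v` that have a parent, reached by the arc `(p v, v)`, and `O` is a set
of vertices whose root blossoms have no parent. The labels of the matched arcs increase along the
trees. -/
structure Forest (M : G.Subgraph) (ℓ : V × V → ℕ) (X : Set V) (A : Set (V × V))
    (Ω : Set (Blossom V)) (I J O : Set V) (p : V → V) : Prop where
  arcs_sub : ∀ u v, (u, v) ∈ A → G.Adj u v ∧ u ∈ X ∧ v ∈ X
  family : IsFamily X (arcGraph A) M.edgeSet Ω
  inner_triv : ∀ v ∈ I, rootAt Ω v = Blossom.triv v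
  inner_adj : ∀ v ∈ I, M.Adj v (mate M v)
  mate_arc : ∀ v ∈ I, (v, mate M v) ∈ A
  mate_outer : ∀ v ∈ I, mate M v ∉ I
  sub : J ⊆ I
  par_arc : ∀ v ∈ J, (p v, v) ∈ A
  par_outer : ∀ v ∈ J, p v ∉ I
  cross : ∀ u v, (u, v) ∈ A → rootAt Ω u ≠ rootAt Ω v →
    (v ∈ J ∧ u = p v) ∨ (u ∈ I ∧ v = mate M u)
  mate_not_root : ∀ v ∈ I, ∀ x ∈ O, rootAt Ω (mate M v) ≠ rootAt Ω x
  roots : O ⊆ X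
  mate_inj : ∀ v ∈ I, ∀ w ∈ I, rootAt Ω (mate M v) = rootAt Ω (mate M w) → v = w
  cover : ∀ x ∈ X, x ∈ I ∨ x ∈ O ∨ ∃ v ∈ I, rootAt Ω (mate M v) = rootAt Ω x
  label : ∀ v ∈ I, ∀ w ∈ J, rootAt Ω (mate M v) = rootAt Ω (p w) →
    ℓ (v, mate M v) < ℓ (w, mate M w)
  mate_mem : ∀ x ∈ X, ∀ t, M.Adj x t →
    t ∈ X ∧ (rootAt Ω x = rootAt Ω t ∨ x ∈ I ∨ t ∈ I)

namespace Forest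

variable {M : G.Subgraph} {ℓ : V × V → ℕ} {X : Set V} {A : Set (V × V)}
  {Ω : Set (Blossom V)} {I J O : Set V} {p : V → V}

theorem inner_mem (F : Forest M ℓ X A Ω I J O p) {v : V} (hv : v ∈ I) : v ∈ X :=
  (F.arcs_sub _ _ (F.mate_arc v hv)).2.1

theorem mate_mem' (F : Forest M ℓ X A Ω I J O p) {v : V} (hv : v ∈ I) : mate M v ∈ X :=
  (F.arcs_sub _ _ (F.mate_arc v hv)).2.2

theorem par_mem (F : Forest M ℓ X A Ω I J O p) {v : V} (hv : v ∈ J) : p v ∈ X :=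
  (F.arcs_sub _ _ (F.par_arc v hv)).2.1

theorem outer_ne (F : Forest M ℓ X A Ω I J O p) {v x : V} (hv : v ∈ I) (hx : x ∉ I) :
    rootAt Ω x ≠ rootAt Ω v := by
  intro h
  rw [F.inner_triv v hv] at h
  have : x ∈ (rootAt Ω x).verts := mem_rootAt Ω x
  rw [h] at this
  obtain rfl : x = v := this
  exact hx hv

theorem inner_eq (F : Forest M ℓ X A Ω I J O p) {v x : V} (hv : v ∈ I)
    (h : rootAt Ω x = rootAt Ω v) : x = v := by
  rw [F.inner_triv v hv] at h
  have : x ∈ (rootAt Ω x).verts := mem_rootAt Ω x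
  rwa [h] at this

theorem congr (F : Forest M ℓ X A Ω I J O p) {ℓ' : V × V → ℕ} {p' : V → V}
    (hℓ : ∀ v ∈ I, ℓ' (v, mate M v) = ℓ (v, mate M v)) (hp : ∀ v ∈ J, p' v = p v) :
    Forest M ℓ' X A Ω I J O p' :=
  { F with
    par_arc := fun v hv => by rw [hp v hv]; exact F.par_arc v hv
    par_outer := fun v hv => by rw [hp v hv]; exact F.par_outer v hv
    cross := fun u v h1 h2 => (F.cross u v h1 h2).imp
      (fun h => ⟨h.1, by rw [hp v h.1]; exact h.2⟩) id
    label := fun v hv w hw h => by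
      rw [hℓ v hv, hℓ w (F.sub hw)]
      exact F.label v hv w hw (by rw [← hp w hw]; exact h) }

/-- The deleted arc joins different root blossoms, so no blossom loses an edge; `v` becomes an inner
vertex without parent. -/
theorem unlink [Finite V] (F : Forest M ℓ X A Ω I J O p) (v : V) (hv : v ∈ J) :
    Forest M ℓ X (A \ {(p v, v)}) Ω I (J \ {v}) O p :=
  { F with
    arcs_sub := fun x y h => F.arcs_sub x y h.1
    family := F.family.mono_graph (by
      intro b hb x hx y hy
      have hxy := F.family.rootAt_const hb hx hy
      have hne := F.outer_ne (F.sub hv) (F.par_outer v hv)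
      refine arcGraph_mono (fun h => ⟨h, ?_⟩) (fun h => ⟨h, ?_⟩)
      · rintro h
        simp only [Set.mem_singleton_iff, Prod.mk.injEq] at h
        rw [h.1, h.2] at hxy
        exact hne hxy
      · rintro h
        simp only [Set.mem_singleton_iff, Prod.mk.injEq] at h
        rw [h.1, h.2] at hxy
        exact hne hxy.symm)
    mate_arc := fun w hw => by
      refine ⟨F.mate_arc w hw, fun h => ?_⟩
      simp only [Set.mem_singleton_iff, Prod.mk.injEq] at h
      exact F.par_outer v hv (h.1 ▸ hw)
    sub := fun w hw => F.sub hw.1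
    par_arc := fun w hw => by
      refine ⟨F.par_arc w hw.1, fun h => ?_⟩
      simp only [Set.mem_singleton_iff, Prod.mk.injEq] at h
      exact hw.2 h.2
    par_outer := fun w hw => F.par_outer w hw.1
    cross := fun x y h hne => by
      rcases F.cross x y h.1 hne with h1 | h1
      · refine .inl ⟨⟨h1.1, ?_⟩, h1.2⟩
        rintro rfl
        exact h.2 (by simp [h1.2])
      · exact .inr h1
    label := fun w hw w' hw' => F.label w hw w' hw'.1 }

/-- The position of `u` relative to `v` does not matter: the label inequality `hlt` at the new link
replaces any check that `u` is not below `v`. The label of `v` may drop, because elsewhere it occurs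
only on the smaller side of an inequality. -/
theorem link [Finite V] (F : Forest M ℓ X A Ω I J O p) {ℓ' : V × V → ℕ} {p' : V → V} {u v : V}
    (hv : v ∈ I) (hvJ : v ∉ J) (hu : u ∈ X) (huI : u ∉ I) (huv : G.Adj u v)
    (hℓ : ∀ w ∈ I, w ≠ v → ℓ' (w, mate M w) = ℓ (w, mate M w))
    (hle : ℓ' (v, mate M v) ≤ ℓ (v, mate M v))
    (hlt : ∀ q ∈ I, rootAt Ω (mate M q) = rootAt Ω u → ℓ (q, mate M q) < ℓ' (v, mate M v))
    (hpv : p' v = u) (hp : ∀ w ∈ J, p' w = p w) :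
    Forest M ℓ' X (insert (u, v) A) Ω I (insert v J) O p' :=
  { F with
    arcs_sub := fun x y h => by
      rcases h with h | h
      · simp only [Prod.mk.injEq] at h
        rw [h.1, h.2]
        exact ⟨huv, hu, F.inner_mem hv⟩
      · exact F.arcs_sub x y h
    family := F.family.mono_graph fun b hb x hx y hy => arcGraph_mono .inr .inr
    mate_arc := fun w hw => .inr (F.mate_arc w hw)
    sub := Set.insert_subset hv F.sub
    par_arc := fun w hw => by
      rcases hw with rfl | hw
      · rw [hpv]; exact .inl rfl
      · rw [hp w hw]; exact .inr (F.par_arc w hw)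
    par_outer := fun w hw => by
      rcases hw with rfl | hw
      · rwa [hpv]
      · rw [hp w hw]; exact F.par_outer w hw
    cross := fun x y h hne => by
      rcases h with h | h
      · simp only [Prod.mk.injEq] at h
        exact .inl ⟨.inl h.2, by rw [h.1, h.2, hpv]⟩
      · exact (F.cross x y h hne).imp (fun h1 => ⟨.inr h1.1, by rw [hp y h1.1]; exact h1.2⟩) id
    label := fun w hw w' hw' h => by
      have hle' : ℓ' (w, mate M w) ≤ ℓ (w, mate M w) := by
        by_cases hwv : w = v
        · rw [hwv]; exact hle
        · rw [hℓ w hw hwv]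
      rcases hw' with rfl | hw'
      · rw [hpv] at h
        exact hle'.trans_lt (hlt w hw h)
      · rw [hp w' hw'] at h
        rw [hℓ w' (F.sub hw') (by rintro rfl; exact hvJ hw')]
        exact hle'.trans_lt (F.label w hw w' hw' h) }

theorem rootAt_restrict [Finite V] (F : Forest M ℓ X A Ω I J O p) {E : Set V}
    (hsat : ∀ x ∈ X, ∀ y ∈ X, rootAt Ω x = rootAt Ω y → x ∈ E → y ∈ E) {x : V} (hx : x ∈ E) :
    rootAt {b | b ∈ Ω ∧ b.verts ⊆ E} x = rootAt Ω x := by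
  refine rootAt_congr fun b hb => ⟨fun h => h.1, fun h => ⟨h, fun y hy => ?_⟩⟩
  have hs := (F.family.isBlossom b h).verts_subset
  exact hsat x (hs hb) y (hs hy) (F.family.rootAt_const h hb hy) hx

/-- The set `E` is a union of root blossoms that no tree arc crosses, so every local condition
survives on it. The same lemma serves a subtree and its complement. -/
theorem restrict [Finite V] (hM : M.IsMatching) (F : Forest M ℓ X A Ω I J O p) {E : Set V}
    (hsat : ∀ x ∈ X, ∀ y ∈ X, rootAt Ω x = rootAt Ω y → x ∈ E → y ∈ E)
    (hJ : ∀ v ∈ J, (v ∈ E ↔ p v ∈ E)) (hI : ∀ v ∈ I, (v ∈ E ↔ mate M v ∈ E)) :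
    Forest M ℓ (X ∩ E) {a | a ∈ A ∧ a.1 ∈ E ∧ a.2 ∈ E} {b | b ∈ Ω ∧ b.verts ⊆ E} (I ∩ E)
      (J ∩ E) (O ∩ E) p where
  arcs_sub u v h := ⟨(F.arcs_sub u v h.1).1, ⟨(F.arcs_sub u v h.1).2.1, h.2.1⟩,
    ⟨(F.arcs_sub u v h.1).2.2, h.2.2⟩⟩
  family :=
    { isBlossom := fun b hb => (F.family.isBlossom b hb.1).mono
        (Set.subset_inter (F.family.isBlossom b hb.1).verts_subset hb.2)
        fun x y hx hy => arcGraph_mono (fun h => ⟨h, hb.2 hx, hb.2 hy⟩)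
          (fun h => ⟨h, hb.2 hy, hb.2 hx⟩)
      laminar := fun b hb c hc => F.family.laminar b hb.1 c hc.1
      triv_mem := fun v hv => ⟨F.family.triv_mem v hv.1, by
        simpa [Blossom.triv] using hv.2⟩
      closed := fun b hb => (F.family.closed b hb.1).imp id fun ⟨k, C, e, hc, hC⟩ =>
        ⟨k, C, e, hc.mono fun x y hx hy => arcGraph_mono (fun h => ⟨h, hb.2 hx, hb.2 hy⟩)
          (fun h => ⟨h, hb.2 hy, hb.2 hx⟩), fun i => ⟨hC i, (hc.subset i).trans hb.2⟩⟩ }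
  inner_triv v hv := by
    rw [F.rootAt_restrict hsat hv.2]; exact F.inner_triv v hv.1
  inner_adj v hv := F.inner_adj v hv.1
  mate_arc v hv := ⟨F.mate_arc v hv.1, hv.2, (hI v hv.1).1 hv.2⟩
  mate_outer v hv h := F.mate_outer v hv.1 h.1
  sub v hv := ⟨F.sub hv.1, hv.2⟩
  par_arc v hv := ⟨F.par_arc v hv.1, (hJ v hv.1).1 hv.2, hv.2⟩
  par_outer v hv h := F.par_outer v hv.1 h.1
  cross u v h hne := by
    rw [F.rootAt_restrict hsat h.2.1, F.rootAt_restrict hsat h.2.2] at hne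
    exact (F.cross u v h.1 hne).imp (fun h1 => ⟨⟨h1.1, h.2.2⟩, h1.2⟩)
      (fun h1 => ⟨⟨h1.1, h.2.1⟩, h1.2⟩)
  mate_not_root v hv x hx := by
    rw [F.rootAt_restrict hsat hx.2, F.rootAt_restrict hsat ((hI v hv.1).1 hv.2)]
    exact F.mate_not_root v hv.1 x hx.1
  roots := Set.inter_subset_inter_left _ F.roots
  mate_inj v hv w hw h := by
    rw [F.rootAt_restrict hsat ((hI v hv.1).1 hv.2),
      F.rootAt_restrict hsat ((hI w hw.1).1 hw.2)] at h
    exact F.mate_inj v hv.1 w hw.1 h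
  cover x hx := by
    rcases F.cover x hx.1 with h | h | ⟨v, hv, h⟩
    · exact .inl ⟨h, hx.2⟩
    · exact .inr (.inl ⟨h, hx.2⟩)
    · have hE : mate M v ∈ E := hsat x hx.1 _ (F.mate_mem' hv) h.symm hx.2
      refine .inr (.inr ⟨v, ⟨hv, (hI v hv).2 hE⟩, ?_⟩)
      rw [F.rootAt_restrict hsat hE, F.rootAt_restrict hsat hx.2, h]
  label v hv w hw h := by
    rw [F.rootAt_restrict hsat ((hI v hv.1).1 hv.2),
      F.rootAt_restrict hsat ((hJ w hw.1).1 hw.2)] at h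
    exact F.label v hv.1 w hw.1 h
  mate_mem x hx t ht := by
    obtain ⟨h1, h2⟩ := F.mate_mem x hx.1 t ht
    -- A matched edge either stays inside a root blossom or is the tree edge at an inner endpoint;
    -- in both cases it cannot leave `E`.
    have htE : t ∈ E := by
      rcases h2 with h2 | h2 | h2
      · exact hsat x hx.1 t h1 h2 hx.2
      · rw [← mate_eq hM ht]
        exact (hI x h2).1 hx.2
      · rw [hI t h2, mate_eq hM ht.symm]
        exact hx.2
    refine ⟨⟨h1, htE⟩, ?_⟩
    rw [F.rootAt_restrict hsat hx.2, F.rootAt_restrict hsat htE]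
    exact h2.imp id (Or.imp (fun h => ⟨h, hx.2⟩) (fun h => ⟨h, htE⟩))

theorem rootAt_union {X₁ X₂ : Set V} {H₂ : SimpleGraph V} {N : Set (Sym2 V)}
    {Ω₁ Ω₂ : Set (Blossom V)} (hd : Disjoint X₁ X₂) (h₂ : IsFamily X₂ H₂ N Ω₂) {x : V}
    (hx : x ∈ X₁) : rootAt (Ω₁ ∪ Ω₂) x = rootAt Ω₁ x :=
  rootAt_congr fun b hb => ⟨fun h => h.resolve_right fun h' =>
    Set.disjoint_left.1 hd hx ((h₂.isBlossom b h').verts_subset hb), .inl⟩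

theorem rootAt_union_ne {X₁ X₂ : Set V} {H₁ H₂ : SimpleGraph V} {N : Set (Sym2 V)}
    {Ω₁ Ω₂ : Set (Blossom V)} (hd : Disjoint X₁ X₂) (h₁ : IsFamily X₁ H₁ N Ω₁)
    (h₂ : IsFamily X₂ H₂ N Ω₂) {x y : V} (hx : x ∈ X₁) (hy : y ∈ X₂) :
    rootAt (Ω₁ ∪ Ω₂) x ≠ rootAt (Ω₁ ∪ Ω₂) y := by
  intro h
  have hxy := mem_rootAt (Ω₁ ∪ Ω₂) x
  rw [h, Set.union_comm, rootAt_union hd.symm h₁ hy] at hxy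
  unfold rootAt at hxy
  split_ifs at hxy with hex
  · exact Set.disjoint_left.1 hd hx ((h₂.isBlossom _ hex.choose_spec.1.1).verts_subset hxy)
  · obtain rfl : x = y := hxy
    exact Set.disjoint_left.1 hd hx hy

end Forest

theorem IsFamily.union {X₁ X₂ : Set V} {H₁ H₂ H : SimpleGraph V} {N : Set (Sym2 V)}
    {Ω₁ Ω₂ : Set (Blossom V)} (hd : Disjoint X₁ X₂) (h₁ : IsFamily X₁ H₁ N Ω₁)
    (h₂ : IsFamily X₂ H₂ N Ω₂) (hH₁ : ∀ x y, H₁.Adj x y → H.Adj x y)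
    (hH₂ : ∀ x y, H₂.Adj x y → H.Adj x y) : IsFamily (X₁ ∪ X₂) H N (Ω₁ ∪ Ω₂) where
  isBlossom b hb := by
    rcases hb with hb | hb
    · exact (h₁.isBlossom b hb).mono ((h₁.isBlossom b hb).verts_subset.trans
        Set.subset_union_left) fun _ _ _ _ => hH₁ _ _
    · exact (h₂.isBlossom b hb).mono ((h₂.isBlossom b hb).verts_subset.trans
        Set.subset_union_right) fun _ _ _ _ => hH₂ _ _
  laminar b hb c hc hne := by
    rcases hb with hb | hb <;> rcases hc with hc | hc
    · exact h₁.laminar b hb c hc hne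
    · exact .inr (.inr (hd.mono (h₁.isBlossom b hb).verts_subset
        (h₂.isBlossom c hc).verts_subset))
    · exact .inr (.inr (hd.symm.mono (h₂.isBlossom b hb).verts_subset
        (h₁.isBlossom c hc).verts_subset))
    · exact h₂.laminar b hb c hc hne
  triv_mem v hv := hv.imp (h₁.triv_mem v) (h₂.triv_mem v)
  closed b hb := by
    rcases hb with hb | hb
    · exact (h₁.closed b hb).imp id fun ⟨k, A, e, hc, hA⟩ =>
        ⟨k, A, e, hc.mono fun _ _ _ _ => hH₁ _ _, fun i => .inl (hA i)⟩
    · exact (h₂.closed b hb).imp id fun ⟨k, A, e, hc, hA⟩ =>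
        ⟨k, A, e, hc.mono fun _ _ _ _ => hH₂ _ _, fun i => .inr (hA i)⟩

namespace Forest

variable {M : G.Subgraph} {ℓ : V × V → ℕ} {p : V → V}

/-- Root blossoms on the two sides are different (`sep`), so no condition relates the two forests to
each other. -/
theorem union {X₁ X₂ : Set V} {A₁ A₂ : Set (V × V)} {Ω₁ Ω₂ : Set (Blossom V)}
    {I₁ I₂ J₁ J₂ O₁ O₂ : Set V} (hd : Disjoint X₁ X₂)
    (F₁ : Forest M ℓ X₁ A₁ Ω₁ I₁ J₁ O₁ p) (F₂ : Forest M ℓ X₂ A₂ Ω₂ I₂ J₂ O₂ p) :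
    Forest M ℓ (X₁ ∪ X₂) (A₁ ∪ A₂) (Ω₁ ∪ Ω₂) (I₁ ∪ I₂) (J₁ ∪ J₂) (O₁ ∪ O₂) p := by
  have r₁ : ∀ x ∈ X₁, rootAt (Ω₁ ∪ Ω₂) x = rootAt Ω₁ x := fun x hx =>
    rootAt_union hd F₂.family hx
  have r₂ : ∀ x ∈ X₂, rootAt (Ω₁ ∪ Ω₂) x = rootAt Ω₂ x := fun x hx => by
    rw [Set.union_comm]
    exact rootAt_union hd.symm F₁.family hx
  have hd' : ∀ x ∈ X₁, x ∉ X₂ := fun x hx => Set.disjoint_left.1 hd hx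
  have sep : ∀ x ∈ X₁, ∀ y ∈ X₂, rootAt (Ω₁ ∪ Ω₂) x ≠ rootAt (Ω₁ ∪ Ω₂) y :=
    fun _ hx _ hy => rootAt_union_ne hd F₁.family F₂.family hx hy
  refine
    { arcs_sub := ?_
      family := F₁.family.union hd F₂.family
        (fun x y => arcGraph_mono .inl .inl) (fun x y => arcGraph_mono .inr .inr)
      inner_triv := ?_
      inner_adj := fun v hv => hv.elim (F₁.inner_adj v) (F₂.inner_adj v)
      mate_arc := fun v hv => hv.imp (F₁.mate_arc v) (F₂.mate_arc v)
      mate_outer := ?_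
      sub := Set.union_subset_union F₁.sub F₂.sub
      par_arc := fun v hv => hv.imp (F₁.par_arc v) (F₂.par_arc v)
      par_outer := ?_
      cross := ?_
      mate_not_root := ?_
      roots := Set.union_subset_union F₁.roots F₂.roots
      mate_inj := ?_
      cover := ?_
      label := ?_
      mate_mem := ?_ }
  · rintro u v (h | h)
    · exact ⟨(F₁.arcs_sub u v h).1, (F₁.arcs_sub u v h).2.imp .inl .inl⟩
    · exact ⟨(F₂.arcs_sub u v h).1, (F₂.arcs_sub u v h).2.imp .inr .inr⟩
  · rintro v (hv | hv)
    · rw [r₁ v (F₁.inner_mem hv)]; exact F₁.inner_triv v hv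
    · rw [r₂ v (F₂.inner_mem hv)]; exact F₂.inner_triv v hv
  · rintro v (hv | hv) (h | h)
    · exact F₁.mate_outer v hv h
    · exact hd' _ (F₁.mate_mem' hv) (F₂.inner_mem h)
    · exact hd' _ (F₁.inner_mem h) (F₂.mate_mem' hv)
    · exact F₂.mate_outer v hv h
  · rintro v (hv | hv) (h | h)
    · exact F₁.par_outer v hv h
    · exact hd' _ (F₁.par_mem hv) (F₂.inner_mem h)
    · exact hd' _ (F₁.inner_mem h) (F₂.par_mem hv)
    · exact F₂.par_outer v hv h
  · rintro u v (h | h) hne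
    · have hs := (F₁.arcs_sub u v h).2
      rw [r₁ u hs.1, r₁ v hs.2] at hne
      exact (F₁.cross u v h hne).imp (fun h => ⟨.inl h.1, h.2⟩) (fun h => ⟨.inl h.1, h.2⟩)
    · have hs := (F₂.arcs_sub u v h).2
      rw [r₂ u hs.1, r₂ v hs.2] at hne
      exact (F₂.cross u v h hne).imp (fun h => ⟨.inr h.1, h.2⟩) (fun h => ⟨.inr h.1, h.2⟩)
  · rintro v (hv | hv) x (hx | hx)
    · rw [r₁ _ (F₁.mate_mem' hv), r₁ _ (F₁.roots hx)]
      exact F₁.mate_not_root v hv x hx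
    · exact sep _ (F₁.mate_mem' hv) _ (F₂.roots hx)
    · exact (sep _ (F₁.roots hx) _ (F₂.mate_mem' hv)).symm
    · rw [r₂ _ (F₂.mate_mem' hv), r₂ _ (F₂.roots hx)]
      exact F₂.mate_not_root v hv x hx
  · rintro v (hv | hv) w (hw | hw) h
    · rw [r₁ _ (F₁.mate_mem' hv), r₁ _ (F₁.mate_mem' hw)] at h
      exact F₁.mate_inj v hv w hw h
    · exact absurd h (sep _ (F₁.mate_mem' hv) _ (F₂.mate_mem' hw))
    · exact absurd h.symm (sep _ (F₁.mate_mem' hw) _ (F₂.mate_mem' hv))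
    · rw [r₂ _ (F₂.mate_mem' hv), r₂ _ (F₂.mate_mem' hw)] at h
      exact F₂.mate_inj v hv w hw h
  · rintro x (hx | hx)
    · rcases F₁.cover x hx with h | h | ⟨v, hv, h⟩
      · exact .inl (.inl h)
      · exact .inr (.inl (.inl h))
      · exact .inr (.inr ⟨v, .inl hv, by rw [r₁ _ (F₁.mate_mem' hv), r₁ x hx, h]⟩)
    · rcases F₂.cover x hx with h | h | ⟨v, hv, h⟩
      · exact .inl (.inr h)
      · exact .inr (.inl (.inr h))
      · exact .inr (.inr ⟨v, .inr hv, by rw [r₂ _ (F₂.mate_mem' hv), r₂ x hx, h]⟩)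
  · rintro v (hv | hv) w (hw | hw) h
    · rw [r₁ _ (F₁.mate_mem' hv), r₁ _ (F₁.par_mem hw)] at h
      exact F₁.label v hv w hw h
    · exact absurd h (sep _ (F₁.mate_mem' hv) _ (F₂.par_mem hw))
    · exact absurd h.symm (sep _ (F₁.par_mem hw) _ (F₂.mate_mem' hv))
    · rw [r₂ _ (F₂.mate_mem' hv), r₂ _ (F₂.par_mem hw)] at h
      exact F₂.label v hv w hw h
  · rintro x (hx | hx) t ht
    · obtain ⟨h1, h2⟩ := F₁.mate_mem x hx t ht
      rw [r₁ x hx, r₁ t h1]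
      exact ⟨.inl h1, h2.imp id (Or.imp .inl .inl)⟩
    · obtain ⟨h1, h2⟩ := F₂.mate_mem x hx t ht
      rw [r₂ x hx, r₂ t h1]
      exact ⟨.inr h1, h2.imp id (Or.imp .inr .inr)⟩

/-- The piece that Overtake attaches when the matched arc is in no structure: one inner vertex,
still without parent, and its mate. -/
theorem single (hM : M.IsMatching) {v t : V} (hvt : M.Adj v t) :
    Forest M ℓ {v, t} {(v, t)} {Blossom.triv v, Blossom.triv t} {v} ∅ ∅ p := by
  have hm := mate_eq hM hvt
  have hne : v ≠ t := hvt.ne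
  have hr : ∀ x, rootAt {Blossom.triv v, Blossom.triv t} x = Blossom.triv x := by
    intro x
    apply rootAt_eq_triv
    rintro b (rfl | rfl) hx
    · obtain rfl : x = v := hx
      rfl
    · obtain rfl : x = t := hx
      rfl
  refine
    { arcs_sub := ?_
      family := ?_
      inner_triv := fun v _ => hr v
      inner_adj := ?_
      mate_arc := ?_
      mate_outer := ?_
      sub := by simp
      par_arc := by simp
      par_outer := by simp
      cross := ?_
      mate_not_root := by simp
      roots := by simp
      mate_inj := ?_
      cover := ?_
      label := by simp
      mate_mem := ?_ }
  · intro x y h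
    simp only [Set.mem_singleton_iff, Prod.mk.injEq] at h
    obtain ⟨rfl, rfl⟩ := h
    exact ⟨hvt.adj_sub, .inl rfl, .inr rfl⟩
  · refine ⟨?_, ?_, ?_, ?_⟩
    · rintro b (rfl | rfl)
      · exact .triv _ (.inl rfl)
      · exact .triv _ (.inr rfl)
    · rintro b (rfl | rfl) c (rfl | rfl) h
      · exact absurd rfl h
      · exact .inr (.inr (by simpa [Blossom.triv] using hne))
      · exact .inr (.inr (by simpa [Blossom.triv] using hne.symm))
      · exact absurd rfl h
    · rintro x (rfl | rfl)
      · exact .inl rfl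
      · exact .inr rfl
    · rintro b (rfl | rfl)
      · exact .inl ⟨_, rfl⟩
      · exact .inl ⟨_, rfl⟩
  · rintro x rfl
    rwa [hm]
  · rintro x rfl
    rw [hm]; rfl
  · rintro x rfl
    rw [hm]; exact hne.symm
  · intro x y h _
    simp only [Set.mem_singleton_iff, Prod.mk.injEq] at h
    obtain ⟨rfl, rfl⟩ := h
    exact .inr ⟨rfl, hm.symm⟩
  · rintro x rfl y rfl _
    rfl
  · rintro x (rfl | rfl)
    · exact .inl rfl
    · exact .inr (.inr ⟨v, rfl, by rw [hm]⟩)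
  · rintro x (rfl | rfl) y hy
    · obtain rfl := hM.eq_of_adj_left hvt hy
      exact ⟨.inr rfl, .inr (.inl rfl)⟩
    · obtain rfl := hM.eq_of_adj_left hvt.symm hy
      exact ⟨.inl rfl, .inr (.inr rfl)⟩

end Forest

end Forests

end AlgPhase

namespace AlgPhase

/-! ### From the local description of a structure to its tree, alternation and labels -/

section Layouts

variable {V : Type*} {G : SimpleGraph V}

/-- The parent relation of the contracted tree described by `I` and `p`. -/
def ParentRel (M : G.Subgraph) (Ω : Set (Blossom V)) (I : Set V) (p : V → V)
    (x y : Blossom V) : Prop :=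
  (∃ v ∈ I, x = rootAt Ω (p v) ∧ y = rootAt Ω v) ∨
    ∃ v ∈ I, x = rootAt Ω v ∧ y = rootAt Ω (mate M v)

/-- A local description of the structure `S` of the free vertex `α`, with inner vertices `I` and
parent arcs `(p v, v)`, `v ∈ I`. -/
structure Layout (M : G.Subgraph) (ℓ : V × V → ℕ) (α : V) (S : FreeStruct V) (I : Set V)
    (p : V → V) : Prop where
  forest : Forest M ℓ S.verts S.arcs S.blossoms I I {x | x ∈ S.verts ∧ S.bl x = S.bl α} p
  root_mem : α ∈ S.verts
  root_free : α ∉ M.verts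
  work : ∀ w, S.work = some w → ∃ u ∈ S.verts, u ∉ I ∧ S.bl u = w

namespace Layout

variable {M : G.Subgraph} {ℓ : V × V → ℕ} {α : V} {S : FreeStruct V} {I : Set V} {p : V → V}

theorem root_notMem (L : Layout M ℓ α S I p) : α ∉ I := fun h =>
  L.root_free (M.edge_vert (L.forest.inner_adj α h))

theorem inner_ne_root (L : Layout M ℓ α S I p) {v : V} (hv : v ∈ I) : S.bl v ≠ S.bl α :=
  (L.forest.outer_ne hv L.root_notMem).symm

theorem mate_ne_root (L : Layout M ℓ α S I p) {v : V} (hv : v ∈ I) :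
    S.bl (mate M v) ≠ S.bl α :=
  L.forest.mate_not_root v hv α ⟨L.root_mem, rfl⟩

theorem par_cases (L : Layout M ℓ α S I p) {v : V} (hv : v ∈ I) :
    S.bl (p v) = S.bl α ∨ ∃ w ∈ I, S.bl (mate M w) = S.bl (p v) :=
  ((L.forest.cover _ (L.forest.par_mem hv)).resolve_left (L.forest.par_outer v hv)).imp
    And.right id

/-- Induction along the inner vertices of the tree. -/
theorem inner_induction (L : Layout M ℓ α S I p) {C : V → Prop}
    (h : ∀ v ∈ I, (∀ w ∈ I, S.bl (mate M w) = S.bl (p v) → C w) → C v) : ∀ v ∈ I, C v := by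
  have key : ∀ n, ∀ v ∈ I, ℓ (v, mate M v) = n → C v := by
    intro n
    induction n using Nat.strong_induction_on with
    | _ n ih =>
      intro v hv hn
      refine h v hv fun w hw hwv => ih _ ?_ w hw rfl
      rw [← hn]
      exact L.forest.label w hw v hv hwv
  exact fun v hv => key _ v hv rfl

/-- The only global clause is reachability from the root. It follows by induction on the labels,
each inner vertex being reached through the preceding one. -/
theorem isRooted (L : Layout M ℓ α S I p) :
    IsRooted S.treeVerts S.tree (S.bl α) (ParentRel M S.blossoms I p) := by
  have F := L.forest
  have hreach : ∀ v ∈ I,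
      Relation.ReflTransGen (ParentRel M S.blossoms I p) (S.bl α) (S.bl v) := by
    refine L.inner_induction fun v hv ih => ?_
    have hpv : ParentRel M S.blossoms I p (S.bl (p v)) (S.bl v) := .inl ⟨v, hv, rfl, rfl⟩
    rcases L.par_cases hv with h | ⟨w, hw, h⟩
    · rw [h] at hpv
      exact .single hpv
    · refine ((ih w hw h).tail (.inr ⟨w, hw, rfl, rfl⟩)).tail (c := S.bl v) ?_
      change ParentRel _ _ _ _ (S.bl (mate M w)) _
      rw [h]
      exact hpv
  refine ⟨?_, ?_, ?_, ?_, ⟨α, L.root_mem, rfl⟩, ?_⟩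
  · intro x y
    constructor
    · rintro ⟨hne, u, v, huv, rfl, rfl⟩
      have key : ∀ u v, (u, v) ∈ S.arcs → rootAt S.blossoms u ≠ rootAt S.blossoms v →
          ParentRel M S.blossoms I p (rootAt S.blossoms u) (rootAt S.blossoms v) := by
        intro u v huv hne
        rcases F.cross u v huv hne with ⟨h1, rfl⟩ | ⟨h1, rfl⟩
        · exact .inl ⟨v, h1, rfl, rfl⟩
        · exact .inr ⟨u, h1, rfl, rfl⟩
      rcases ((SimpleGraph.fromRel_adj _ _ _).1 huv).2 with h | h
      · exact .inl (key u v h hne)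
      · exact .inr (key v u h hne.symm)
    · have key : ∀ x y, ParentRel M S.blossoms I p x y → S.tree.Adj x y := by
        rintro x y (⟨v, hv, rfl, rfl⟩ | ⟨v, hv, rfl, rfl⟩)
        · have hne := F.outer_ne hv (F.par_outer v hv)
          refine ⟨hne, p v, v, (SimpleGraph.fromRel_adj _ _ _).2 ⟨?_, .inl (F.par_arc v hv)⟩,
            rfl, rfl⟩
          exact fun h => hne (by rw [h])
        · have hne := (F.outer_ne hv (F.mate_outer v hv)).symm
          refine ⟨hne, v, mate M v,
            (SimpleGraph.fromRel_adj _ _ _).2 ⟨?_, .inl (F.mate_arc v hv)⟩, rfl, rfl⟩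
          exact fun h => hne (by rw [← h])
      rintro (h | h)
      · exact key x y h
      · exact (key y x h).symm
  · rintro x y (⟨v, hv, rfl, rfl⟩ | ⟨v, hv, rfl, rfl⟩)
    · exact ⟨⟨_, F.par_mem hv, rfl⟩, ⟨_, F.inner_mem hv, rfl⟩⟩
    · exact ⟨⟨_, F.inner_mem hv, rfl⟩, ⟨_, F.mate_mem' hv, rfl⟩⟩
  · rintro x x' y (⟨v, hv, rfl, rfl⟩ | ⟨v, hv, rfl, rfl⟩) (⟨w, hw, rfl, h⟩ | ⟨w, hw, rfl, h⟩)
    · rw [F.inner_eq hw h]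
    · exact absurd h.symm (F.outer_ne hv (F.mate_outer w hw))
    · exact absurd h (F.outer_ne hw (F.mate_outer v hv))
    · rw [F.mate_inj v hv w hw h]
  · rintro x (⟨v, hv, rfl, h⟩ | ⟨v, hv, rfl, h⟩)
    · exact L.inner_ne_root hv h.symm
    · exact L.mate_ne_root hv h.symm
  · rintro _ ⟨x, hx, rfl⟩
    rcases F.cover x hx with h | h | ⟨v, hv, h⟩
    · exact hreach x h
    · rw [h.2]
    · exact (hreach v hv).tail (.inr ⟨v, hv, rfl, h.symm⟩)

theorem parent_iff (L : Layout M ℓ α S I p) {x y : Blossom V} :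
    S.Parent α x y ↔ ParentRel M S.blossoms I p x y :=
  L.isRooted.isParent_iff

theorem inSubtree_iff (L : Layout M ℓ α S I p) {x y : Blossom V} (hx : x ∈ S.treeVerts) :
    S.InSubtree α x y ↔ Relation.ReflTransGen (ParentRel M S.blossoms I p) x y :=
  L.isRooted.isAncestor_iff hx

theorem odd_dist (L : Layout M ℓ α S I p) :
    ∀ v ∈ I, Odd (S.tree.dist (S.bl α) (S.bl v)) := by
  have R := L.isRooted
  refine L.inner_induction fun v hv ih => ?_
  have h1 := R.dist_child (x := S.bl (p v)) (y := S.bl v) (.inl ⟨v, hv, rfl, rfl⟩)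
  rw [h1]
  rcases L.par_cases hv with h | ⟨w, hw, h⟩
  · rw [h, SimpleGraph.dist_self]
    exact odd_one
  · have h2 := R.dist_child (x := S.bl w) (y := S.bl (mate M w)) (.inr ⟨w, hw, rfl, rfl⟩)
    rw [← h, h2]
    exact ((ih w hw h).add_one).add_one

theorem even_dist (L : Layout M ℓ α S I p) {u : V} (hu : u ∈ S.verts) (huI : u ∉ I) :
    Even (S.tree.dist (S.bl α) (S.bl u)) := by
  rcases (L.forest.cover u hu).resolve_left huI with h | ⟨w, hw, h⟩
  · rw [h.2, SimpleGraph.dist_self]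
    exact Even.zero
  · have h2 := L.isRooted.dist_child (x := S.bl w) (y := S.bl (mate M w))
      (.inr ⟨w, hw, rfl, rfl⟩)
    change S.bl (mate M w) = S.bl u at h
    rw [← h, h2]
    exact (L.odd_dist w hw).add_one

theorem isInner_iff (L : Layout M ℓ α S I p) {x : Blossom V} :
    IsInner S.treeVerts S.tree (S.bl α) x ↔ ∃ v ∈ I, S.bl v = x := by
  constructor
  · rintro ⟨⟨u, hu, rfl⟩, -, h⟩
    by_cases huI : u ∈ I
    · exact ⟨u, huI, rfl⟩
    · exact absurd (L.even_dist hu huI) (Nat.not_even_iff_odd.2 h)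
  · rintro ⟨v, hv, rfl⟩
    exact ⟨⟨v, L.forest.inner_mem hv, rfl⟩, L.inner_ne_root hv, L.odd_dist v hv⟩

theorem outer_iff (L : Layout M ℓ α S I p) {x : Blossom V} :
    S.Outer α x ↔ ∃ u ∈ S.verts, u ∉ I ∧ S.bl u = x := by
  unfold FreeStruct.Outer IsOuter
  rw [L.isInner_iff]
  constructor
  · rintro ⟨⟨u, hu, rfl⟩, h⟩
    exact ⟨u, hu, fun h' => h ⟨u, h', rfl⟩, rfl⟩
  · rintro ⟨u, hu, huI, rfl⟩
    exact ⟨⟨u, hu, rfl⟩, fun ⟨v, hv, h⟩ => L.forest.outer_ne hv huI h.symm⟩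

/-- By `mate_mem`, a matched edge between different root blossoms has an inner endpoint, and it then
joins that endpoint to its mate. -/
theorem mem_matching_iff (hM : M.IsMatching) (L : Layout M ℓ α S I p) {f : Sym2 (Blossom V)} :
    f ∈ contractMatching S.graph M.edgeSet S.blossoms ↔
      ∃ v ∈ I, f = s(S.bl v, S.bl (mate M v)) := by
  have F := L.forest
  constructor
  · rintro ⟨u, v, huv, hm, hne, rfl⟩
    have hm : M.Adj u v := hm
    have hu : u ∈ S.verts := by
      rcases ((SimpleGraph.fromRel_adj _ _ _).1 huv).2 with h | h
      · exact (F.arcs_sub _ _ h).2.1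
      · exact (F.arcs_sub _ _ h).2.2
    rcases ((F.mate_mem u hu v hm).2).resolve_left hne with h | h
    · exact ⟨u, h, by rw [mate_eq hM hm]; rfl⟩
    · exact ⟨v, h, by rw [mate_eq hM hm.symm, Sym2.eq_swap]; rfl⟩
  · rintro ⟨v, hv, rfl⟩
    have hne := (F.outer_ne hv (F.mate_outer v hv)).symm
    refine ⟨v, mate M v, (SimpleGraph.fromRel_adj _ _ _).2 ⟨?_, .inl (F.mate_arc v hv)⟩,
      F.inner_adj v hv, hne, rfl⟩
    exact fun h => hne (by rw [← h])

theorem edge_mem_iff (hM : M.IsMatching) (L : Layout M ℓ α S I p) {x y : Blossom V}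
    (hxy : ParentRel M S.blossoms I p x y) :
    s(x, y) ∈ contractMatching S.graph M.edgeSet S.blossoms ↔ ∃ v ∈ I, x = S.bl v := by
  rw [L.mem_matching_iff hM]
  constructor
  · rintro ⟨v, hv, h⟩
    rw [Sym2.eq_iff] at h
    rcases h with ⟨rfl, -⟩ | ⟨rfl, rfl⟩
    · exact ⟨v, hv, rfl⟩
    · exact absurd (.inr ⟨v, hv, rfl, rfl⟩) (L.isRooted.not_symm hxy)
  · rintro ⟨v, hv, rfl⟩
    rcases hxy with ⟨w, hw, h, rfl⟩ | ⟨w, hw, h, rfl⟩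
    · exact absurd h.symm (L.forest.outer_ne hv (L.forest.par_outer w hw))
    · obtain rfl := L.forest.inner_eq hw h
      exact ⟨v, hv, rfl⟩

theorem child_inner_iff (L : Layout M ℓ α S I p) {x y : Blossom V}
    (hxy : ParentRel M S.blossoms I p x y) :
    (∃ v ∈ I, x = S.bl v) ↔ ¬ ∃ v ∈ I, y = S.bl v := by
  have F := L.forest
  rcases hxy with ⟨w, hw, rfl, rfl⟩ | ⟨w, hw, rfl, rfl⟩
  · constructor
    · rintro ⟨v, hv, h⟩
      exact absurd h (F.outer_ne hv (F.par_outer w hw))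
    · exact fun h => absurd ⟨w, hw, rfl⟩ h
  · constructor
    · rintro - ⟨v, hv, h⟩
      exact absurd h (F.outer_ne hv (F.mate_outer w hw))
    · exact fun _ => ⟨w, hw, rfl⟩

/-- A descending edge is matched exactly when it starts at an inner vertex, and inner and outer
vertices alternate on the way down. -/
theorem isAlternating_of_down (hM : M.IsMatching) (L : Layout M ℓ α S I p) {a b : Blossom V}
    (q : S.tree.Walk a b) (hq : ∀ d ∈ q.darts, ParentRel M S.blossoms I p d.fst d.snd) :
    IsAlternating (contractMatching S.graph M.edgeSet S.blossoms) q := by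
  unfold IsAlternating
  induction q with
  | nil => simp
  | cons hadj q ih =>
    simp only [SimpleGraph.Walk.darts_cons, List.mem_cons, forall_eq_or_imp] at hq
    have ih' := ih hq.2
    cases q with
    | nil => simp
    | cons hadj' q =>
      simp only [SimpleGraph.Walk.darts_cons, List.mem_cons, forall_eq_or_imp] at hq
      simp only [SimpleGraph.Walk.edges_cons, List.isChain_cons_cons] at ih' ⊢
      refine ⟨?_, ih'⟩
      rw [L.edge_mem_iff hM hq.1, L.edge_mem_iff hM hq.2.1, L.child_inner_iff hq.1]

theorem isRegular (hM : M.IsMatching) (L : Layout M ℓ α S I p) :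
    IsRegular S.verts S.graph M.edgeSet α S.blossoms where
  isBlossom := L.forest.family.isBlossom
  laminar := L.forest.family.laminar
  triv_mem := L.forest.family.triv_mem
  closed := L.forest.family.closed
  altTree :=
    { root_mem := ⟨α, L.root_mem, rfl⟩
      mem_of_adj := fun x y h => by
        rcases (L.isRooted.adj x y).1 h with h | h
        · exact L.isRooted.mem _ _ h
        · exact (L.isRooted.mem _ _ h).symm
      isTree := L.isRooted.isTree
      root_free := fun f hf h => by
        obtain ⟨v, hv, rfl⟩ := (L.mem_matching_iff hM).1 hf
        rcases Sym2.mem_iff.1 h with h | h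
        · exact L.inner_ne_root hv h.symm
        · exact L.mate_ne_root hv h.symm
      leaf := by
        rintro _ ⟨x, hx, rfl⟩ hleaf q hq
        -- An inner vertex always has the blossom of its mate as a child, so a leaf is outer and
        -- therefore at even distance.
        have hxI : x ∉ I := fun hxI =>
          hleaf (S.bl (mate M x)) (L.isRooted.isParent_iff.2 (.inr ⟨x, hxI, rfl, rfl⟩))
        refine ⟨?_, L.isAlternating_of_down hM q (L.isRooted.down_of_root q hq)⟩
        obtain ⟨q', hq', hl⟩ := q.reachable.exists_path_of_dist
        have := (L.isRooted.isAcyclic.subsingleton_path _ _).elim ⟨q, hq⟩ ⟨q', hq'⟩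
        obtain rfl : q = q' := congrArg Subtype.val this
        rw [hl]
        exact L.even_dist hx hxI }
  inner_triv x hx := by
    obtain ⟨v, hv, rfl⟩ := L.isInner_iff.1 hx
    exact ⟨v, L.forest.inner_triv v hv⟩

theorem tree_representation (L : Layout M ℓ α S I p) (u v : V) (huv : (u, v) ∈ S.arcs)
    (hne : S.bl u ≠ S.bl v) : S.Parent α (S.bl u) (S.bl v) := by
  rw [L.parent_iff]
  rcases L.forest.cross u v huv hne with ⟨h1, rfl⟩ | ⟨h1, rfl⟩
  · exact .inl ⟨v, h1, rfl, rfl⟩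
  · exact .inr ⟨u, h1, rfl, rfl⟩

/-- The blossom of the head determines the arc: an inner head is entered only from `p`, and an outer
one only by the matched arc of the unique inner vertex whose mate it contains. -/
theorem arc_unique (L : Layout M ℓ α S I p) {a b : V × V} (ha : a ∈ S.arcs) (hb : b ∈ S.arcs)
    (hna : S.bl a.1 ≠ S.bl a.2) (hnb : S.bl b.1 ≠ S.bl b.2) (h : S.bl a.2 = S.bl b.2) :
    a = b := by
  have F := L.forest
  obtain ⟨x, y⟩ := a
  obtain ⟨x', y'⟩ := b
  rcases F.cross x y ha hna with ⟨h1, rfl⟩ | ⟨h1, rfl⟩ <;>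
    rcases F.cross x' y' hb hnb with ⟨h2, rfl⟩ | ⟨h2, rfl⟩
  · obtain rfl := F.inner_eq h2 h
    rfl
  · exact absurd h.symm (F.outer_ne h1 (F.mate_outer _ h2))
  · exact absurd h (F.outer_ne h2 (F.mate_outer _ h1))
  · obtain rfl := F.mate_inj x h1 x' h2 h
    rfl

theorem unique_arc (L : Layout M ℓ α S I p) (x y : Blossom V) (hxy : S.Parent α x y) :
    ∃! a : V × V, a ∈ S.arcs ∧ S.bl a.1 = x ∧ S.bl a.2 = y := by
  have F := L.forest
  have hP := L.parent_iff.1 hxy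
  have hne : x ≠ y := by
    rintro rfl
    exact L.isRooted.not_symm hP hP
  obtain ⟨a, ha, rfl, rfl⟩ : ∃ a ∈ S.arcs, S.bl a.1 = x ∧ S.bl a.2 = y := by
    rcases hP with ⟨v, hv, rfl, rfl⟩ | ⟨v, hv, rfl, rfl⟩
    · exact ⟨_, F.par_arc v hv, rfl, rfl⟩
    · exact ⟨_, F.mate_arc v hv, rfl, rfl⟩
  refine ⟨a, ⟨ha, rfl, rfl⟩, fun b hb => L.arc_unique hb.1 ha ?_ hne hb.2.2⟩
  rw [hb.2.1, hb.2.2]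
  exact hne

theorem arcLabel_eq (hM : M.IsMatching) (L : Layout M ℓ α S I p) {v : V} (hv : v ∈ I) :
    arcLabel M ℓ S.blossoms (S.bl v) (S.bl (mate M v)) = ℓ (v, mate M v) := by
  have hex : ∃ a : V × V, M.Adj a.1 a.2 ∧ rootAt S.blossoms a.1 = S.bl v ∧
      rootAt S.blossoms a.2 = S.bl (mate M v) := ⟨(v, mate M v), L.forest.inner_adj v hv, rfl, rfl⟩
  unfold arcLabel
  rw [dif_pos hex]
  have h1 := L.forest.inner_eq hv hex.choose_spec.2.1
  have h2 := mate_eq hM hex.choose_spec.1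
  congr 1
  refine Prod.ext h1 ?_
  rw [← h2, h1]

theorem labelsIncrease (hM : M.IsMatching) (L : Layout M ℓ α S I p) :
    LabelsIncrease M ℓ α S := by
  have F := L.forest
  intro b q hq _
  have hdown := L.isRooted.down_of_root q hq
  clear hq
  -- The induction needs bounds depending on the start of the walk: below the mate of `v` all labels
  -- are larger than that of `v`, and below `v` itself they are at least as large. An unmatched edge
  -- turns the second bound into the first, via the label condition.
  have key : ∀ a b (q : S.tree.Walk a b),
      (∀ d ∈ q.darts, ParentRel M S.blossoms I p d.fst d.snd) →
      ((q.darts.filter (fun d => decide (d.edge ∈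
        contractMatching S.graph M.edgeSet S.blossoms))).map
        (fun d => arcLabel M ℓ S.blossoms d.fst d.snd)).Pairwise (· < ·) ∧
      (∀ v ∈ I, a = S.bl (mate M v) → ∀ n ∈ ((q.darts.filter (fun d => decide (d.edge ∈
        contractMatching S.graph M.edgeSet S.blossoms))).map
        (fun d => arcLabel M ℓ S.blossoms d.fst d.snd)), ℓ (v, mate M v) < n) ∧
      (∀ v ∈ I, a = S.bl v → ∀ n ∈ ((q.darts.filter (fun d => decide (d.edge ∈
        contractMatching S.graph M.edgeSet S.blossoms))).map
        (fun d => arcLabel M ℓ S.blossoms d.fst d.snd)), ℓ (v, mate M v) ≤ n) := by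
    intro a b q
    induction q with
    | nil => simp
    | cons hadj q ih =>
      rename_i x y z
      intro hd
      rw [SimpleGraph.Walk.darts_cons] at hd ⊢
      rw [List.forall_mem_cons] at hd
      obtain ⟨ih1, ih2, ih3⟩ := ih hd.2
      have hxy : ParentRel M S.blossoms I p x y := hd.1
      have hiff := L.edge_mem_iff hM hxy
      rcases hxy with ⟨v, hv, hx, hy⟩ | ⟨v, hv, hx, hy⟩
      · have hnot : ¬ s(x, y) ∈ contractMatching S.graph M.edgeSet S.blossoms := by
          rw [hiff]
          rintro ⟨w, hw, h⟩
          exact F.outer_ne hw (F.par_outer v hv) (hx.symm.trans h)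
        rw [List.filter_cons_of_neg (by simp only [decide_eq_true_eq]; exact hnot)]
        refine ⟨ih1, fun w hw h n hn => ?_, fun w hw h n hn => ?_⟩
        · exact (F.label w hw v hv (h.symm.trans hx)).trans_le (ih3 v hv hy n hn)
        · exact absurd (hx.symm.trans h) (F.outer_ne hw (F.par_outer v hv))
      · have hmem : s(x, y) ∈ contractMatching S.graph M.edgeSet S.blossoms :=
          hiff.2 ⟨v, hv, hx⟩
        rw [List.filter_cons_of_pos (by simp only [decide_eq_true_eq]; exact hmem), List.map_cons]
        have hl : arcLabel M ℓ S.blossoms x y = ℓ (v, mate M v) := by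
          rw [hx, hy]; exact L.arcLabel_eq hM hv
        simp only [hl]
        have ih2' := ih2 v hv hy
        refine ⟨List.pairwise_cons.2 ⟨ih2', ih1⟩, fun w hw h n hn => ?_, fun w hw h n hn => ?_⟩
        · exact absurd (h.symm.trans hx) (F.outer_ne hv (F.mate_outer w hw))
        · obtain rfl := F.inner_eq hw (hx.symm.trans h)
          rcases List.mem_cons.1 hn with rfl | hn
          · exact le_rfl
          · exact (ih2' n hn).le
  exact (key _ _ q hdown).1.isChain

/-- Otherwise `p v` would be the mate of `v`, and the label condition with both inner vertices equal
to `v` would make a label smaller than itself. -/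
theorem not_adj_par (hM : M.IsMatching) (L : Layout M ℓ α S I p) {v : V} (hv : v ∈ I) :
    ¬ M.Adj (p v) v := by
  intro h
  have := L.forest.label v hv v hv (by rw [mate_eq hM h.symm])
  exact lt_irrefl _ this

/-- The arc chosen in `parentTail` joins different root blossoms and has the inner head `v`. It
cannot be a matched tree arc, whose head is outer, so it is the parent arc. -/
theorem parentTail_eq (hM : M.IsMatching) (L : Layout M ℓ α S I p) {v : V} (hv : v ∈ I) :
    S.parentTail M α v = p v := by
  have F := L.forest
  have hspec := Classical.epsilon_spec (p := fun q => (q, v) ∈ S.arcs ∧ ¬ M.Adj q v ∧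
    S.Parent α (S.bl q) (S.bl v))
    ⟨p v, F.par_arc v hv, L.not_adj_par hM hv, L.parent_iff.2 (.inl ⟨v, hv, rfl, rfl⟩)⟩
  obtain ⟨h1, -, h3⟩ := hspec
  have hne := h3.1.ne
  rcases F.cross _ _ h1 hne with h | h
  · exact h.2
  · exact absurd hv (h.2 ▸ F.mate_outer _ h.1)

end Layout

end Layouts

end AlgPhase

namespace AlgPhase

/-! ### The cycle closed by an edge between two outer vertices -/

section Contractions

variable {V : Type*} {G : SimpleGraph V}

namespace Layout

variable {M : G.Subgraph} {ℓ : V × V → ℕ} {α : V} {S : FreeStruct V} {I : Set V} {p : V → V}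

theorem child_eq (L : Layout M ℓ α S I p) {v : V} (hv : v ∈ I) {y : Blossom V}
    (h : ParentRel M S.blossoms I p (S.bl v) y) : y = S.bl (mate M v) := by
  rcases h with ⟨w, hw, h, -⟩ | ⟨w, hw, h, rfl⟩
  · exact absurd h.symm (L.forest.outer_ne hv (L.forest.par_outer w hw))
  · rw [L.forest.inner_eq hw h]
    rfl

theorem exists_arc (L : Layout M ℓ α S I p) {x y : Blossom V}
    (h : ParentRel M S.blossoms I p x y) :
    ∃ a ∈ S.arcs, S.bl a.1 = x ∧ S.bl a.2 = y ∧ ((∃ v ∈ I, x = S.bl v) → M.Adj a.1 a.2) := by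
  have F := L.forest
  rcases h with ⟨v, hv, rfl, rfl⟩ | ⟨v, hv, rfl, rfl⟩
  · refine ⟨_, F.par_arc v hv, rfl, rfl, ?_⟩
    rintro ⟨w, hw, h⟩
    exact absurd h (F.outer_ne hw (F.par_outer v hv))
  · exact ⟨_, F.mate_arc v hv, rfl, rfl, fun _ => F.inner_adj v hv⟩

end Layout

/-- The vertices `f 0, …, f n` of the path of the contracted tree between two outer vertices; `f c`
is their lowest common ancestor. -/
structure IsValley (M : G.Subgraph) (S : FreeStruct V) (I : Set V) (p : V → V) (u v : V)
    (f : ℕ → Blossom V) (n c : ℕ) : Prop where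
  le : c ≤ n
  start : f 0 = S.bl u
  finish : f n = S.bl v
  inj : ∀ i ≤ n, ∀ j ≤ n, f i = f j → i = j
  up : ∀ j < c, ParentRel M S.blossoms I p (f (j + 1)) (f j)
  down : ∀ j, c ≤ j → j < n → ParentRel M S.blossoms I p (f j) (f (j + 1))

/-- Paths in a tree are unique, so the blossoms on one path are exactly those in `cycleVerts`, which
is defined through all paths. -/
theorem exists_isValley {M : G.Subgraph} {ℓ : V × V → ℕ} {α : V} {S : FreeStruct V} {I : Set V}
    {p : V → V} (L : Layout M ℓ α S I p) {u v : V} (hu : u ∈ S.verts) (hv : v ∈ S.verts) :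
    ∃ f n c, IsValley M S I p u v f n c ∧
      ∀ b, (∃ q : S.tree.Walk (S.bl u) (S.bl v), q.IsPath ∧ b ∈ q.support) ↔
        ∃ j ≤ n, f j = b := by
  have R := L.isRooted
  obtain ⟨q, hq⟩ := ((R.reachable (R.reach _ ⟨u, hu, rfl⟩)).symm.trans
    (R.reachable (R.reach _ ⟨v, hv, rfl⟩))).exists_isPath
  obtain ⟨c, hc, h1, h2⟩ := R.exists_valley q hq
  refine ⟨q.getVert, q.length, c, ⟨hc, by simp, by simp, ?_, h1, h2⟩, fun b => ?_⟩
  · exact fun i hi j hj h => hq.getVert_injOn hi hj h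
  · constructor
    · rintro ⟨q', hq', hb⟩
      have := (R.isAcyclic.subsingleton_path _ _).elim ⟨q, hq⟩ ⟨q', hq'⟩
      obtain rfl : q = q' := congrArg Subtype.val this
      obtain ⟨j, hj, hjl⟩ := SimpleGraph.Walk.mem_support_iff_exists_getVert.1 hb
      exact ⟨j, hjl, hj⟩
    · rintro ⟨j, hj, rfl⟩
      exact ⟨q, hq, q.getVert_mem_support j⟩

/-- A connected part `C` of the contracted tree with top `z`, the children of whose outer
vertices may lie outside. -/
structure IsLobe (M : G.Subgraph) (S : FreeStruct V) (I : Set V) (p : V → V)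
    (C : Set (Blossom V)) (z : V) : Prop where
  sub : C ⊆ S.treeVerts
  top_mem : S.bl z ∈ C
  top_verts : z ∈ S.verts
  top_outer : z ∉ I
  parent : ∀ y ∈ C, y ≠ S.bl z → ∃ x ∈ C, ParentRel M S.blossoms I p x y
  top : ∀ x, ParentRel M S.blossoms I p x (S.bl z) → x ∉ C
  child : ∀ v ∈ I, S.bl v ∈ C → S.bl (mate M v) ∈ C

namespace IsValley

variable {M : G.Subgraph} {ℓ : V × V → ℕ} {α : V} {S : FreeStruct V} {I : Set V} {p : V → V}
  {u v : V} {f : ℕ → Blossom V} {n c : ℕ}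

theorem inner_iff (hf : IsValley M S I p u v f n c) (L : Layout M ℓ α S I p)
    (huI : u ∉ I) {j : ℕ} (hj : j ≤ n) : (∃ w ∈ I, f j = S.bl w) ↔ Odd j := by
  induction j with
  | zero =>
    rw [hf.start]
    simp only [Nat.not_odd_zero, iff_false]
    rintro ⟨w, hw, h⟩
    exact L.forest.outer_ne hw huI h
  | succ j ih =>
    have ih := ih (by omega)
    rw [Nat.odd_add_one, ← ih]
    rcases Nat.lt_or_ge j c with h | h
    · exact L.child_inner_iff (hf.up j h)
    · rw [L.child_inner_iff (hf.down j h (by omega)), not_not]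

theorem even_length (hf : IsValley M S I p u v f n c) (L : Layout M ℓ α S I p)
    (huI : u ∉ I) (hvI : v ∉ I) : Even n := by
  rw [← Nat.not_odd_iff_even, ← hf.inner_iff L huI le_rfl, hf.finish]
  rintro ⟨w, hw, h⟩
  exact L.forest.outer_ne hw hvI h

/-- At odd position the lowest common ancestor would be inner. Both ends being outer, it would lie
strictly between them, and so have two different children; an inner vertex has only one. -/
theorem even_top (hf : IsValley M S I p u v f n c) (L : Layout M ℓ α S I p)
    (huI : u ∉ I) (hvI : v ∉ I) : Even c := by
  rw [← Nat.not_odd_iff_even]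
  intro hc
  obtain ⟨w, hw, h⟩ := (hf.inner_iff L huI hf.le).2 hc
  have hn := hf.even_length L huI hvI
  have h0 : 0 < c := hc.pos
  have h1 : c < n := lt_of_le_of_ne hf.le (by rintro rfl; exact (Nat.not_even_iff_odd.2 hc) hn)
  have h2 := hf.up (c - 1) (by omega)
  rw [Nat.sub_add_cancel h0, h] at h2
  have h3 := hf.down c le_rfl h1
  rw [h] at h3
  have := hf.inj _ (by omega) _ (by omega) ((L.child_eq hw h2).trans (L.child_eq hw h3).symm)
  omega

theorem isLobe (hf : IsValley M S I p u v f n c) (L : Layout M ℓ α S I p)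
    (hu : u ∈ S.verts) (huI : u ∉ I) (hvI : v ∉ I) :
    ∃ z, S.bl z = f c ∧ IsLobe M S I p {b | ∃ j ≤ n, f j = b} z := by
  have R := L.isRooted
  have hc := hf.even_top L huI hvI
  have hn := hf.even_length L huI hvI
  have hcn := hf.le
  have hmem : ∀ j ≤ n, f j ∈ S.treeVerts := by
    intro j
    induction j with
    | zero => exact fun _ => hf.start ▸ ⟨u, hu, rfl⟩
    | succ j ih =>
      intro hj
      rcases Nat.lt_or_ge j c with h | h
      · exact (R.mem _ _ (hf.up j h)).1
      · exact (R.mem _ _ (hf.down j h (by omega))).2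
  obtain ⟨z, hz, hzc⟩ := hmem c hf.le
  have hparent : ∀ j ≤ n, j ≠ c → ∃ i ≤ n, ParentRel M S.blossoms I p (f i) (f j) := by
    intro j hj hjc
    rcases Nat.lt_or_ge j c with h | h
    · exact ⟨j + 1, by omega, hf.up j h⟩
    · have := hf.down (j - 1) (by omega) (by omega)
      rw [Nat.sub_add_cancel (by omega)] at this
      exact ⟨j - 1, by omega, this⟩
  -- All vertices of the path descend from `f c`; a parent of `f c` on the path would therefore
  -- close a cycle.
  have hdesc : ∀ j ≤ n, Relation.ReflTransGen (ParentRel M S.blossoms I p) (f c) (f j) := by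
    have h1 : ∀ k ≤ c, Relation.ReflTransGen (ParentRel M S.blossoms I p) (f c) (f (c - k)) := by
      intro k
      induction k with
      | zero => exact fun _ => .refl
      | succ k ih =>
        intro hk
        refine (ih (by omega)).tail ?_
        have := hf.up (c - (k + 1)) (by omega)
        rwa [show c - (k + 1) + 1 = c - k by omega] at this
    have h2 : ∀ k, c + k ≤ n →
        Relation.ReflTransGen (ParentRel M S.blossoms I p) (f c) (f (c + k)) := by
      intro k
      induction k with
      | zero => exact fun _ => .refl
      | succ k ih => exact fun hk => (ih (by omega)).tail (hf.down (c + k) (by omega) (by omega))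
    intro j hj
    rcases Nat.lt_or_ge j c with h | h
    · have := h1 (c - j) (by omega)
      rwa [show c - (c - j) = j by omega] at this
    · have := h2 (j - c) (by omega)
      rwa [show c + (j - c) = j by omega] at this
  refine ⟨z, hzc, ?_, ⟨c, hf.le, hzc.symm⟩, hz, ?_, ?_, ?_, ?_⟩
  · rintro _ ⟨j, hj, rfl⟩
    exact hmem j hj
  · intro hzI
    exact Nat.not_odd_iff_even.2 hc ((hf.inner_iff L huI hf.le).1 ⟨z, hzI, hzc.symm⟩)
  · rintro _ ⟨j, hj, rfl⟩ hne
    obtain ⟨i, hi, h⟩ := hparent j hj (by rintro rfl; exact hne hzc.symm)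
    exact ⟨_, ⟨i, hi, rfl⟩, h⟩
  · rintro x hx ⟨j, hj, rfl⟩
    change S.bl z = f c at hzc
    rw [hzc] at hx
    exact R.not_cycle (R.mem _ _ hx).2 (Relation.TransGen.tail' (hdesc j hj) hx)
  · rintro w hw ⟨j, hj, h⟩
    -- Inner vertices sit at odd positions, hence away from the ends and the top, so the path
    -- continues downwards from them, necessarily to their only child.
    have hodd := (hf.inner_iff L huI hj).1 ⟨w, hw, h⟩
    have hjc : j ≠ c := by rintro rfl; exact Nat.not_odd_iff_even.2 hc hodd
    have hjn : j ≠ n := by rintro rfl; exact Nat.not_odd_iff_even.2 hn hodd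
    have hpos := hodd.pos
    rcases Nat.lt_or_ge j c with h1 | h1
    · have h2 := hf.up (j - 1) (by omega)
      rw [Nat.sub_add_cancel hpos, h] at h2
      exact ⟨j - 1, by omega, L.child_eq hw h2⟩
    · have h2 := hf.down j h1 (by omega)
      rw [h] at h2
      exact ⟨j + 1, by omega, L.child_eq hw h2⟩

/-- The closed walk through `f c, …, f 0, f n, …, f (c + 1)` is the cycle of a blossom. -/
theorem isBlossomCycle [Finite V] (hf : IsValley M S I p u v f n c) (L : Layout M ℓ α S I p)
    (hu : u ∈ S.verts) (huI : u ∉ I) (hvI : v ∉ I) (hne : S.bl u ≠ S.bl v)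
    {B : Blossom V} (hBv : B.verts = {x | ∃ b, (∃ j ≤ n, f j = b) ∧ x ∈ b.verts})
    (hBe : B.edges = {g | ∃ b, (∃ j ≤ n, f j = b) ∧ g ∈ b.edges} ∪
      {g | ∃ x y, (x, y) ∈ S.arcs ∧ S.bl x ≠ S.bl y ∧ (∃ j ≤ n, f j = S.bl x) ∧
        (∃ j ≤ n, f j = S.bl y) ∧ g = s(x, y)} ∪ {s(u, v)}) :
    ∃ (k : ℕ) (A : Fin (k + 1) → Blossom V) (e : Fin (k + 1) → V × V),
      IsBlossomCycle (arcGraph (insert (u, v) S.arcs)) M.edgeSet k A e B ∧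
        ∀ i, A i ∈ S.blossoms := by
  have R := L.isRooted
  have F := L.forest
  have hc := hf.even_top L huI hvI
  have hn := hf.even_length L huI hvI
  have hcn := hf.le
  obtain ⟨z, hzc, hlobe⟩ := hf.isLobe L hu huI hvI
  have htree : ∀ j ≤ n, f j ∈ S.treeVerts := fun j hj => hlobe.sub ⟨j, hj, rfl⟩
  have hroot : ∀ j ≤ n, IsRootBlossom S.blossoms (f j) := by
    intro j hj
    obtain ⟨x, hx, h⟩ := htree j hj
    rw [← h]
    exact F.family.isRoot_rootAt hx
  have hn0 : n ≠ 0 := by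
    rintro rfl
    exact hne (hf.start.symm.trans hf.finish)
  -- The cycle is numbered from its top: positions `c, c - 1, …, 0`, then `n, n - 1, …, c + 1`. The
  -- new edge `(u, v)` gets index `c`, which is even.
  let σ : ℕ → ℕ := fun i => if i ≤ c then c - i else c + (n + 1) - i
  have hσn : ∀ i ≤ n, σ i ≤ n := by
    intro i hi
    simp only [σ]
    split_ifs <;> omega
  have hσn' : ∀ i : Fin (n + 1), σ ((i + 1 : Fin (n + 1)) : ℕ) ≤ n := fun i =>
    hσn _ (Nat.lt_succ_iff.1 (i + 1).isLt)
  have hσs : ∀ j ≤ n, ∃ i ≤ n, σ i = j := by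
    intro j hj
    by_cases h : j ≤ c
    · exact ⟨c - j, by omega, by simp only [σ]; split_ifs <;> omega⟩
    · exact ⟨c + (n + 1) - j, by omega, by simp only [σ]; split_ifs <;> omega⟩
  have hstep : ∀ i : Fin (n + 1),
      ((i : ℕ) = c ∧ σ i = 0 ∧ σ ((i + 1 : Fin (n + 1)) : ℕ) = n) ∨
      ((i : ℕ) < c ∧ σ i = σ ((i + 1 : Fin (n + 1)) : ℕ) + 1 ∧ σ i = c - i) ∨
      (c < (i : ℕ) ∧ σ i = σ ((i + 1 : Fin (n + 1)) : ℕ) + 1 ∧ σ i = c + (n + 1) - i) := by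
    intro i
    have hi := i.isLt
    have hval := Fin.val_add_one i
    have hlast : (i = Fin.last n) ↔ (i : ℕ) = n := by
      rw [Fin.ext_iff]; rfl
    simp only [hlast] at hval
    simp only [σ, hval]
    split_ifs <;> omega
  -- The upper end of edge `i ≠ c` has path position `c - i` or `c + n - i`. Since `c` and `n` are
  -- even, an odd `i` means an odd position, that is, an inner upper end and a matched edge.
  have hex : ∀ i : Fin (n + 1), ∃ a : V × V, ((i : ℕ) = c → a = (u, v)) ∧
      ((i : ℕ) ≠ c → a ∈ S.arcs ∨ a.swap ∈ S.arcs) ∧ S.bl a.1 = f (σ i) ∧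
      S.bl a.2 = f (σ ((i + 1 : Fin (n + 1)) : ℕ)) ∧ (Odd (i : ℕ) → M.Adj a.1 a.2) := by
    intro i
    have hi := i.isLt
    rcases hstep i with ⟨h1, h2, h3⟩ | ⟨h1, h2, h3⟩ | ⟨h1, h2, h3⟩
    · refine ⟨(u, v), fun _ => rfl, fun h => absurd h1 h, ?_, ?_, fun h => ?_⟩
      · rw [h2, hf.start]
      · rw [h3, hf.finish]
      · rw [h1] at h
        exact absurd hc (Nat.not_even_iff_odd.2 h)
    · have hP := hf.up (σ ((i + 1 : Fin (n + 1)) : ℕ)) (by omega)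
      rw [← h2] at hP
      obtain ⟨a, ha, ha1, ha2, ha3⟩ := L.exists_arc hP
      refine ⟨a, fun h => by omega, fun _ => .inl ha, ha1, ha2, fun h => ha3 ?_⟩
      refine (hf.inner_iff L huI (by omega)).2 ?_
      rw [h3]
      exact Nat.Even.sub_odd h1.le hc h
    · have hP := hf.down (σ ((i + 1 : Fin (n + 1)) : ℕ)) (by omega) (by omega)
      rw [← h2] at hP
      obtain ⟨a, ha, ha1, ha2, ha3⟩ := L.exists_arc hP
      refine ⟨a.swap, fun h => by omega, fun _ => .inr (by simpa using ha), ha2, ha1,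
        fun h => (ha3 ?_).symm⟩
      refine (hf.inner_iff L huI (by omega)).2 ?_
      have : σ ((i + 1 : Fin (n + 1)) : ℕ) = c + n - i := by omega
      rw [this]
      exact Nat.Even.sub_odd (by omega) (hc.add hn) h
  choose e he1 he2 he3 he4 he5 using hex
  refine ⟨n, fun i => f (σ i), e, ?_, fun i => (hroot _ (hσn i (by omega))).1⟩
  refine
    { even := hn
      two_le := by
        obtain ⟨m, hm⟩ := hn
        omega
      disjoint := ?_
      adj := ?_
      fst_mem := fun i => he3 i ▸ mem_rootAt _ _
      snd_mem := fun i => he4 i ▸ mem_rootAt _ _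
      matched := fun i hi => he5 i hi
      verts_eq := ?_
      edges_eq := ?_ }
  · intro i j hij
    rw [Set.disjoint_left]
    intro x hx hx'
    have h1 := F.family.root_unique (hroot _ (hσn i (by omega))) (hroot _ (hσn j (by omega))) hx hx'
    have h2 := hf.inj _ (hσn i (by omega)) _ (hσn j (by omega)) h1
    apply hij
    have hi := i.isLt
    have hj := j.isLt
    simp only [σ] at h2
    ext
    split_ifs at h2 <;> omega
  · intro i
    refine (SimpleGraph.fromRel_adj _ _ _).2 ⟨?_, ?_⟩
    · intro h
      have h1 : f (σ i) = f (σ ((i + 1 : Fin (n + 1)) : ℕ)) := by rw [← he3, ← he4, h]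
      have h2 := hf.inj _ (hσn i (by omega)) _ (hσn' _) h1
      rcases hstep i with h | h | h <;> omega
    · by_cases h : (i : ℕ) = c
      · rw [he1 i h]
        exact .inl (.inl rfl)
      · exact (he2 i h).imp .inr .inr
  · rw [hBv]
    ext x
    simp only [Set.mem_ofPred_eq, Set.mem_iUnion]
    constructor
    · rintro ⟨_, ⟨j, hj, rfl⟩, hx⟩
      obtain ⟨i, hi, rfl⟩ := hσs j hj
      exact ⟨⟨i, by omega⟩, hx⟩
    · rintro ⟨i, hx⟩
      exact ⟨_, ⟨σ i, hσn i (by omega), rfl⟩, hx⟩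
  · rw [hBe, Set.union_assoc]
    congr 1
    · ext g
      simp only [Set.mem_ofPred_eq, Set.mem_iUnion]
      constructor
      · rintro ⟨_, ⟨j, hj, rfl⟩, hx⟩
        obtain ⟨i, hi, rfl⟩ := hσs j hj
        exact ⟨⟨i, by omega⟩, hx⟩
      · rintro ⟨i, hx⟩
        exact ⟨_, ⟨σ i, hσn i (by omega), rfl⟩, hx⟩
    · ext g
      simp only [Set.mem_union, Set.mem_ofPred_eq, Set.mem_singleton_iff, Set.mem_range]
      constructor
      · rintro (⟨x, y, hxy, hbne, hx, ⟨j, hj, hy⟩, rfl⟩ | rfl)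
        · have hP := L.parent_iff.1 (L.tree_representation x y hxy hbne)
          -- The head of an arc inside the cycle is not the top, whose parent lies outside. So the
          -- arc enters a non-top vertex from its parent, and by uniqueness of arcs it is the chosen
          -- edge there.
          have hjc : j ≠ c := by
            rintro rfl
            exact hlobe.top _ (by rw [hzc, hy]; exact hP) hx
          have key : ∀ i : Fin (n + 1), (i : ℕ) ≠ c →
              (S.bl (e i).1 = S.bl x ∧ S.bl (e i).2 = S.bl y ∨
                S.bl (e i).1 = S.bl y ∧ S.bl (e i).2 = S.bl x) →
              s((e i).1, (e i).2) = s(x, y) := by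
            intro i hi h
            rcases he2 i hi with ha | ha <;> rcases h with ⟨h1, h2⟩ | ⟨h1, h2⟩
            · have := L.arc_unique ha hxy (by rw [h1, h2]; exact hbne) hbne h2
              rw [this]
            · have h3 := L.parent_iff.1 (L.tree_representation (e i).1 (e i).2 ha
                (by rw [h1, h2]; exact hbne.symm))
              rw [h1, h2] at h3
              exact absurd h3 (R.not_symm hP)
            · have h3 := L.parent_iff.1 (L.tree_representation (e i).2 (e i).1 ha
                (by rw [h1, h2]; exact hbne.symm))
              rw [h1, h2] at h3
              exact absurd h3 (R.not_symm hP)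
            · have := L.arc_unique ha hxy (by
                simp only [Prod.fst_swap, Prod.snd_swap]; rw [h1, h2]; exact hbne) hbne h1
              rw [Sym2.eq_swap]
              have h4 := congrArg Prod.fst this
              have h5 := congrArg Prod.snd this
              simp only [Prod.fst_swap, Prod.snd_swap] at h4 h5
              rw [h4, h5]
          rcases Nat.lt_or_ge j c with h | h
          · have hx' := R.uniq _ _ _ (hf.up j h) (hy ▸ hP)
            let i : Fin (n + 1) := ⟨c - j - 1, by omega⟩
            have hi : (i : ℕ) = c - j - 1 := rfl
            have hi1 : σ i = j + 1 ∧ σ ((i + 1 : Fin (n + 1)) : ℕ) = j := by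
              rcases hstep i with h | h | h <;> omega
            refine ⟨i, key i (by omega) (.inl ⟨?_, ?_⟩)⟩
            · rw [he3, hi1.1, hx']
            · rw [he4, hi1.2, hy]
          · have hP' := hf.down (j - 1) (by omega) (by omega)
            rw [Nat.sub_add_cancel (by omega)] at hP'
            have hx' := R.uniq _ _ _ hP' (hy ▸ hP)
            let i : Fin (n + 1) := ⟨c + (n + 1) - j, by omega⟩
            have hi : (i : ℕ) = c + (n + 1) - j := rfl
            have hi1 : σ i = j ∧ σ ((i + 1 : Fin (n + 1)) : ℕ) = j - 1 := by
              rcases hstep i with h | h | h <;> omega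
            refine ⟨i, key i (by omega) (.inr ⟨?_, ?_⟩)⟩
            · rw [he3, hi1.1, hy]
            · rw [he4, hi1.2, hx']
        · refine ⟨⟨c, by omega⟩, ?_⟩
          rw [he1 ⟨c, by omega⟩ rfl]
      · rintro ⟨i, rfl⟩
        by_cases hi : (i : ℕ) = c
        · rw [he1 i hi]
          exact .inr rfl
        · left
          have h1 : ∃ j ≤ n, f j = S.bl (e i).1 := ⟨_, hσn i (by omega), (he3 i).symm⟩
          have h2 : ∃ j ≤ n, f j = S.bl (e i).2 := ⟨_, hσn' _, (he4 i).symm⟩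
          have h3 : S.bl (e i).1 ≠ S.bl (e i).2 := by
            rw [he3, he4]
            intro h
            have := hf.inj _ (hσn i (by omega)) _ (hσn' _) h
            rcases hstep i with h | h | h <;> omega
          rcases he2 i hi with ha | ha
          · exact ⟨_, _, ha, h3, h1, h2, rfl⟩
          · exact ⟨_, _, ha, h3.symm, h2, h1, Sym2.eq_swap⟩

end IsValley

end Contractions

end AlgPhase

namespace AlgPhase

/-! ### Contracting a part of the tree into one blossom -/

section LobeContraction

variable {V : Type*} {G : SimpleGraph V}

namespace IsLobe

variable {M : G.Subgraph} {ℓ : V × V → ℕ} {α : V} {S : FreeStruct V} {I : Set V} {p : V → V}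
  {C : Set (Blossom V)} {z : V} {B : Blossom V} {u v : V}

theorem mem_iff [Finite V] (hC : IsLobe M S I p C z) (L : Layout M ℓ α S I p)
    (hB : B.verts = {x | ∃ b ∈ C, x ∈ b.verts}) {x : V} :
    x ∈ B.verts ↔ x ∈ S.verts ∧ S.bl x ∈ C := by
  have fam := L.forest.family
  rw [hB]
  constructor
  · rintro ⟨b, hb, hx⟩
    obtain ⟨y, hy, rfl⟩ := hC.sub hb
    refine ⟨fam.rootAt_subset hy hx, ?_⟩
    have : S.bl x = S.bl y := fam.rootAt_eq_of_mem hy hx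
    rwa [this]
  · rintro ⟨hx, hxC⟩
    exact ⟨_, hxC, mem_rootAt _ _⟩

/-- The new blossom meets two different root blossoms, whereas each old blossom lies inside a single
one. -/
theorem not_subset [Finite V] (hC : IsLobe M S I p C z) (L : Layout M ℓ α S I p)
    (hB : B.verts = {x | ∃ b ∈ C, x ∈ b.verts}) (hnt : C.Nontrivial) {c : Blossom V}
    (hc : c ∈ S.blossoms) : ¬ B.verts ⊆ c.verts := by
  intro h
  obtain ⟨b, hb, b', hb', hne⟩ := hnt
  obtain ⟨x, hx, rfl⟩ := hC.sub hb
  obtain ⟨y, hy, rfl⟩ := hC.sub hb'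
  exact hne (L.forest.family.rootAt_const hc (h ((hC.mem_iff L hB).2 ⟨hx, hb⟩))
    (h ((hC.mem_iff L hB).2 ⟨hy, hb'⟩)))

theorem subset_or_disjoint [Finite V] (hC : IsLobe M S I p C z) (L : Layout M ℓ α S I p)
    (hB : B.verts = {x | ∃ b ∈ C, x ∈ b.verts}) {c : Blossom V} (hc : c ∈ S.blossoms) :
    c.verts ⊆ B.verts ∨ Disjoint c.verts B.verts := by
  have fam := L.forest.family
  obtain ⟨x, hx⟩ := (fam.isBlossom c hc).nonempty
  have hsub := (fam.isBlossom c hc).verts_subset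
  by_cases h : S.bl x ∈ C
  · left
    intro y hy
    rw [hC.mem_iff L hB]
    refine ⟨hsub hy, ?_⟩
    have : S.bl y = S.bl x := fam.rootAt_const hc hy hx
    rwa [this]
  · right
    rw [Set.disjoint_left]
    intro y hy hyB
    apply h
    have : S.bl x = S.bl y := fam.rootAt_const hc hx hy
    rw [this]
    exact ((hC.mem_iff L hB).1 hyB).2

theorem family_insert [Finite V] (hC : IsLobe M S I p C z) (L : Layout M ℓ α S I p)
    (hB : B.verts = {x | ∃ b ∈ C, x ∈ b.verts}) (hnt : C.Nontrivial)
    (hcyc : ∃ (k : ℕ) (A : Fin (k + 1) → Blossom V) (e : Fin (k + 1) → V × V),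
      IsBlossomCycle (arcGraph (insert (u, v) S.arcs)) M.edgeSet k A e B ∧
        ∀ i, A i ∈ S.blossoms) :
    IsFamily S.verts (arcGraph (insert (u, v) S.arcs)) M.edgeSet (insert B S.blossoms) := by
  have fam : IsFamily S.verts (arcGraph (insert (u, v) S.arcs)) M.edgeSet S.blossoms :=
    L.forest.family.mono_graph fun b hb x hx y hy => arcGraph_mono .inr .inr
  have key : ∀ c ∈ S.blossoms, c.verts ⊂ B.verts ∨ Disjoint c.verts B.verts := fun c hc =>
    (hC.subset_or_disjoint L hB hc).imp (fun h => ⟨h, hC.not_subset L hB hnt hc⟩) id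
  refine ⟨?_, ?_, fun w hw => .inr (fam.triv_mem w hw), ?_⟩
  · rintro b (rfl | hb)
    · obtain ⟨k, A, e, hc, hA⟩ := hcyc
      exact .cycle k A e b (fun i => fam.isBlossom _ (hA i)) hc
    · exact fam.isBlossom b hb
  · rintro b (rfl | hb) c (rfl | hc) hne
    · exact absurd rfl hne
    · rcases key c hc with h | h
      · exact .inr (.inl h)
      · exact .inr (.inr h.symm)
    · rcases key b hb with h | h
      · exact .inl h
      · exact .inr (.inr h)
    · exact fam.laminar b hb c hc hne
  · rintro b (rfl | hb)
    · obtain ⟨k, A, e, hc, hA⟩ := hcyc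
      exact .inr ⟨k, A, e, hc, fun i => .inr (hA i)⟩
    · exact (fam.closed b hb).imp id fun ⟨k, A, e, hc, hA⟩ =>
        ⟨k, A, e, hc, fun i => .inr (hA i)⟩

/-- Contracting a lobe into the blossom `B` preserves the local description. -/
theorem contract_layout [Finite V] (hM : M.IsMatching) (hC : IsLobe M S I p C z)
    (L : Layout M ℓ α S I p) (hB : B.verts = {x | ∃ b ∈ C, x ∈ b.verts}) (hnt : C.Nontrivial)
    (hcyc : ∃ (k : ℕ) (A : Fin (k + 1) → Blossom V) (e : Fin (k + 1) → V × V),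
      IsBlossomCycle (arcGraph (insert (u, v) S.arcs)) M.edgeSet k A e B ∧
        ∀ i, A i ∈ S.blossoms)
    (hu : u ∈ S.verts) (hv : v ∈ S.verts) (huv : G.Adj u v) (huC : S.bl u ∈ C)
    (hvC : S.bl v ∈ C) (huI : u ∉ I) {ℓ' : V × V → ℕ}
    (hℓ : ∀ w ∈ I, w ∉ B.verts → ℓ' (w, mate M w) = ℓ (w, mate M w)) :
    Layout M ℓ' α ⟨S.verts, insert (u, v) S.arcs, insert B S.blossoms, some B⟩
      {w | w ∈ I ∧ w ∉ B.verts} p := by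
  have F := L.forest
  have R := L.isRooted
  have fam' := hC.family_insert L hB hnt hcyc
  have hBroot : IsRootBlossom (insert B S.blossoms) B := by
    refine ⟨.inl rfl, ?_⟩
    rintro c (rfl | hc) h
    · rfl
    · exact absurd h (hC.not_subset L hB hnt hc)
  have r1 : ∀ x ∈ S.verts, S.bl x ∈ C → rootAt (insert B S.blossoms) x = B := fun x hx hxC =>
    fam'.rootAt_eq hBroot ((hC.mem_iff L hB).2 ⟨hx, hxC⟩)
  have r2 : ∀ x ∈ S.verts, S.bl x ∉ C → rootAt (insert B S.blossoms) x = S.bl x := by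
    intro x hx hxC
    refine rootAt_congr fun b hb => ⟨fun h => ?_, .inr⟩
    rcases h with rfl | h
    · exact absurd ((hC.mem_iff L hB).1 hb).2 hxC
    · exact h
  -- The contraction identifies the root blossoms in `C` with one another and makes no other
  -- identification.
  have r3 : ∀ x ∈ S.verts, ∀ y ∈ S.verts,
      rootAt (insert B S.blossoms) x = rootAt (insert B S.blossoms) y →
        (S.bl x ∈ C ∧ S.bl y ∈ C) ∨ S.bl x = S.bl y := by
    intro x hx y hy h
    have hBne : ∀ x ∈ S.verts, S.bl x ∉ C → S.bl x ≠ B := by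
      intro x hx hxC h
      exact hxC ((hC.mem_iff L hB).1 (h ▸ mem_rootAt S.blossoms x)).2
    by_cases h1 : S.bl x ∈ C <;> by_cases h2 : S.bl y ∈ C
    · exact .inl ⟨h1, h2⟩
    · rw [r1 x hx h1, r2 y hy h2] at h
      exact absurd h.symm (hBne y hy h2)
    · rw [r2 x hx h1, r1 y hy h2] at h
      exact absurd h (hBne x hx h1)
    · rw [r2 x hx h1, r2 y hy h2] at h
      exact .inr h
  have r4 : ∀ x ∈ S.verts, ∀ y ∈ S.verts, S.bl x = S.bl y →
      rootAt (insert B S.blossoms) x = rootAt (insert B S.blossoms) y := by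
    intro x hx y hy h
    by_cases h1 : S.bl x ∈ C
    · rw [r1 x hx h1, r1 y hy (h ▸ h1)]
    · rw [r2 x hx h1, r2 y hy (h ▸ h1), h]
  have hI' : ∀ w ∈ I, (w ∉ B.verts ↔ S.bl w ∉ C) := by
    intro w hw
    rw [hC.mem_iff L hB]
    exact not_congr (and_iff_right (F.inner_mem hw))
  have hinner : ∀ w ∈ I, S.bl w ≠ S.bl z := fun w hw => (F.outer_ne hw hC.top_outer).symm
  have hpar' : ∀ y ∈ C, y ≠ S.bl z → ∀ x, ParentRel M S.blossoms I p x y → x ∈ C := by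
    intro y hy hne x hx
    obtain ⟨x', hx', h⟩ := hC.parent y hy hne
    rwa [R.uniq _ _ _ hx h]
  have hpar : ∀ w ∈ I, S.bl w ∈ C → S.bl (p w) ∈ C := fun w hw h =>
    hpar' _ h (hinner w hw) _ (.inl ⟨w, hw, rfl, rfl⟩)
  -- A tree arc enters `C` from outside only at its top, because every other member of `C` has its
  -- parent in `C`.
  have hmate : ∀ w ∈ I, S.bl w ∉ C → S.bl (mate M w) ∈ C → S.bl (mate M w) = S.bl z := by
    intro w hw h1 h2
    by_contra hne
    exact h1 (hpar' _ h2 hne _ (.inr ⟨w, hw, rfl, rfl⟩))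
  have hroot : S.bl α ∈ C → S.bl α = S.bl z := by
    intro h
    by_contra hne
    obtain ⟨x, -, hx⟩ := hC.parent _ h hne
    exact R.root _ hx
  -- Here `w` enters `C` at the top and `q` hangs from some member of `C`. Climbing inside `C` from
  -- `q` to the top chains the old label inequalities.
  have hlt : ∀ w ∈ I, S.bl w ∉ C → S.bl (mate M w) ∈ C → ∀ q ∈ I, S.bl (p q) ∈ C →
      ℓ (w, mate M w) < ℓ (q, mate M q) := by
    intro w hw h1 h2
    refine L.inner_induction fun q hq ih hqC => ?_
    by_cases hz : S.bl (p q) = S.bl z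
    · exact F.label w hw q hq ((hmate w hw h1 h2).trans hz.symm)
    · rcases L.par_cases hq with h | ⟨r, hr, h⟩
      · exact absurd (h.trans (hroot (h ▸ hqC))) hz
      · have hrC : S.bl r ∈ C := hpar' _ hqC hz _ (.inr ⟨r, hr, rfl, h.symm⟩)
        exact (ih r hr h (hpar r hr hrC)).trans (F.label r hr q hq h)
  refine ⟨?_, L.root_mem, L.root_free, ?_⟩
  swap
  · rintro w hw
    obtain rfl : B = w := Option.some.inj hw
    exact ⟨u, hu, fun h => huI h.1, r1 u hu huC⟩
  refine Forest.congr (ℓ := ℓ) (p := p) ?_ (fun w hw => hℓ w hw.1 hw.2) fun _ _ => rfl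
  refine
    { arcs_sub := ?_
      family := fam'
      inner_triv := ?_
      inner_adj := fun w hw => F.inner_adj w hw.1
      mate_arc := fun w hw => .inr (F.mate_arc w hw.1)
      mate_outer := fun w hw h => F.mate_outer w hw.1 h.1
      sub := subset_rfl
      par_arc := fun w hw => .inr (F.par_arc w hw.1)
      par_outer := fun w hw h => F.par_outer w hw.1 h.1
      cross := ?_
      mate_not_root := ?_
      roots := fun x hx => hx.1
      mate_inj := ?_
      cover := ?_
      label := ?_
      mate_mem := ?_ }
  · rintro x y (h | h)
    · simp only [Prod.mk.injEq] at h
      rw [h.1, h.2]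
      exact ⟨huv, hu, hv⟩
    · exact F.arcs_sub x y h
  · intro w hw
    exact (r2 w (F.inner_mem hw.1) ((hI' w hw.1).1 hw.2)).trans (F.inner_triv w hw.1)
  · rintro x y (h | h) hxy
    · simp only [Prod.mk.injEq] at h
      rw [h.1, h.2] at hxy
      exact absurd ((r1 u hu huC).trans (r1 v hv hvC).symm) hxy
    · have hs := (F.arcs_sub x y h).2
      have hne : S.bl x ≠ S.bl y := fun h' => hxy (r4 x hs.1 y hs.2 h')
      rcases F.cross x y h hne with ⟨h1, h2⟩ | ⟨h1, h2⟩
      · refine .inl ⟨⟨h1, (hI' y h1).2 fun hyC => hxy ?_⟩, h2⟩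
        exact (r1 x hs.1 (h2 ▸ hpar y h1 hyC)).trans (r1 y hs.2 hyC).symm
      · refine .inr ⟨⟨h1, (hI' x h1).2 fun hxC => hxy ?_⟩, h2⟩
        exact (r1 x hs.1 hxC).trans (r1 y hs.2 (h2 ▸ hC.child x h1 hxC)).symm
  · intro w hw x hx h
    have h' : rootAt (insert B S.blossoms) (mate M w) = rootAt (insert B S.blossoms) α :=
      h.trans hx.2
    rcases r3 _ (F.mate_mem' hw.1) _ L.root_mem h' with ⟨h1, h2⟩ | h1
    · exact L.mate_ne_root hw.1
        ((hmate w hw.1 ((hI' w hw.1).1 hw.2) h1).trans (hroot h2).symm)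
    · exact L.mate_ne_root hw.1 h1
  · intro w hw x hx h
    rcases r3 _ (F.mate_mem' hw.1) _ (F.mate_mem' hx.1) h with ⟨h1, h2⟩ | h1
    · exact F.mate_inj w hw.1 x hx.1 ((hmate w hw.1 ((hI' w hw.1).1 hw.2) h1).trans
        (hmate x hx.1 ((hI' x hx.1).1 hx.2) h2).symm)
    · exact F.mate_inj w hw.1 x hx.1 h1
  · intro x hx
    change x ∈ S.verts at hx
    by_cases hxC : S.bl x ∈ C
    · right
      -- The new blossom takes over the role of its outer top `z`: it is the root, or it holds the
      -- mate of the inner vertex that preceded `z`.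
      rcases (F.cover z hC.top_verts).resolve_left hC.top_outer with h | ⟨w, hw, h⟩
      · have hα : S.bl α ∈ C := h.2 ▸ hC.top_mem
        exact .inl ⟨hx, (r1 x hx hxC).trans (r1 α L.root_mem hα).symm⟩
      · have h' : S.bl (mate M w) = S.bl z := h
        refine .inr ⟨w, ⟨hw, (hI' w hw).2 (hC.top _ (.inr ⟨w, hw, rfl, h'.symm⟩))⟩, ?_⟩
        exact (r1 _ (F.mate_mem' hw) (h' ▸ hC.top_mem)).trans (r1 x hx hxC).symm
    · rcases F.cover x hx with h | h | ⟨w, hw, h⟩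
      · exact .inl ⟨h, (hI' x h).2 hxC⟩
      · exact .inr (.inl ⟨hx, r4 x hx α L.root_mem h.2⟩)
      · have h' : S.bl (mate M w) = S.bl x := h
        refine .inr (.inr ⟨w, ⟨hw, (hI' w hw).2 fun hwC => hxC ?_⟩,
          r4 _ (F.mate_mem' hw) x hx h'⟩)
        rw [← h']
        exact hC.child w hw hwC
  · intro w hw q hq h
    rcases r3 _ (F.mate_mem' hw.1) _ (F.par_mem hq.1) h with ⟨h1, h2⟩ | h1
    · exact hlt w hw.1 ((hI' w hw.1).1 hw.2) h1 q hq.1 h2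
    · exact F.label w hw.1 q hq.1 h1
  · intro x hx t ht
    change x ∈ S.verts at hx
    obtain ⟨h1, h2⟩ := F.mate_mem x hx t ht
    refine ⟨h1, ?_⟩
    change rootAt (insert B S.blossoms) x = rootAt (insert B S.blossoms) t ∨ _
    rcases h2 with h2 | h2 | h2
    · exact .inl (r4 x hx t h1 h2)
    · by_cases hxC : S.bl x ∈ C
      · refine .inl ((r1 x hx hxC).trans (r1 t h1 ?_).symm)
        rw [← mate_eq hM ht]
        exact hC.child x h2 hxC
      · exact .inr (.inl ⟨h2, (hI' x h2).2 hxC⟩)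
    · by_cases htC : S.bl t ∈ C
      · refine .inl ((r1 x hx ?_).trans (r1 t h1 htC).symm)
        rw [← mate_eq hM ht.symm]
        exact hC.child t h2 htC
      · exact .inr (.inr ⟨h2, (hI' t h2).2 htC⟩)

end IsLobe

end LobeContraction

end AlgPhase

namespace AlgPhase

/-! ### Attaching, moving and pruning subtrees -/

section Grafting

variable {V : Type*} {G : SimpleGraph V} {M : G.Subgraph} {ℓ ℓ' : V × V → ℕ}

/-- After a union or restriction the set `O` is still expressed by the old blossoms; this puts it
into the form that `Layout` prescribes for the new ones. -/
theorem Forest.rootSet {X : Set V} {A : Set (V × V)} {Ω : Set (Blossom V)} {I J O : Set V}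
    {p : V → V} (F : Forest M ℓ X A Ω I J O p) {α : V} (hα : α ∈ O)
    (hO : ∀ x ∈ O, rootAt Ω x = rootAt Ω α) :
    Forest M ℓ X A Ω I J {x | x ∈ X ∧ rootAt Ω x = rootAt Ω α} p :=
  { F with
    mate_not_root := fun v hv _ hx h => F.mate_not_root v hv α hα (h.trans hx.2)
    roots := fun _ hx => hx.1
    cover := fun x hx => (F.cover x hx).imp id (Or.imp (fun h => ⟨hx, hO x h⟩) id) }

theorem Layout.congr {α : V} {S : FreeStruct V} {I : Set V} {p : V → V}
    (L : Layout M ℓ α S I p) (h : ∀ v ∈ I, ℓ' (v, mate M v) = ℓ (v, mate M v)) :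
    Layout M ℓ' α S I p :=
  ⟨L.forest.congr h fun _ _ => rfl, L.root_mem, L.root_free, L.work⟩

theorem Layout.setWork {α : V} {S : FreeStruct V} {I : Set V} {p : V → V}
    (L : Layout M ℓ α S I p) (w : Option (Blossom V))
    (h : ∀ b, w = some b → ∃ u ∈ S.verts, u ∉ I ∧ S.bl u = b) :
    Layout M ℓ α { S with work := w } I p :=
  ⟨L.forest, L.root_mem, L.root_free, h⟩

/-- Attaching a tree `F` with top `v` to the outer vertex `u` of the structure `S`. -/
theorem Layout.graft [Finite V] {α : V} {S : FreeStruct V} {I : Set V} {p : V → V}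
    (L : Layout M ℓ α S I p) {X : Set V} {A : Set (V × V)} {Ω : Set (Blossom V)} {I₂ : Set V}
    {p₂ : V → V} {u v : V} (F : Forest M ℓ X A Ω I₂ (I₂ \ {v}) ∅ p₂)
    (hd : Disjoint S.verts X) (hv : v ∈ I₂) (hu : u ∈ S.verts) (huI : u ∉ I)
    (huv : G.Adj u v)
    (hℓ : ∀ w, w ≠ v → ℓ' (w, mate M w) = ℓ (w, mate M w))
    (hle : ℓ' (v, mate M v) ≤ ℓ (v, mate M v))
    (hlt : ∀ q ∈ I, S.bl (mate M q) = S.bl u → ℓ (q, mate M q) < ℓ' (v, mate M v))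
    {w : Option (Blossom V)}
    (hw : ∀ b, w = some b → ∃ x ∈ X, x ∉ I₂ ∧ rootAt Ω x = b) :
    ∃ p', Layout M ℓ' α ⟨S.verts ∪ X, S.arcs ∪ {(u, v)} ∪ A, S.blossoms ∪ Ω, w⟩ (I ∪ I₂) p' := by
  have F₁ := L.forest
  have hd' : ∀ x ∈ S.verts, x ∉ X := fun x hx => Set.disjoint_left.1 hd hx
  have hvX := F.inner_mem hv
  have r₁ : ∀ x ∈ S.verts, rootAt (S.blossoms ∪ Ω) x = S.bl x := fun x hx =>
    Forest.rootAt_union hd F.family hx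
  have r₂ : ∀ x ∈ X, rootAt (S.blossoms ∪ Ω) x = rootAt Ω x := fun x hx => by
    rw [Set.union_comm]
    exact Forest.rootAt_union hd.symm F₁.family hx
  -- `Forest.union` requires one parent map for both pieces. The two maps are glued along the
  -- disjoint vertex sets, with `v` redirected to `u`.
  let p' : V → V := fun x => if x = v then u else if x ∈ X then p₂ x else p x
  have F₁' := F₁.congr (ℓ' := ℓ) (p' := p') (fun _ _ => rfl) (by
    intro x hx
    have hxX := hd' x (F₁.inner_mem hx)
    simp only [p']
    rw [if_neg (by rintro rfl; exact hxX hvX), if_neg hxX])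
  have F' := F.congr (ℓ' := ℓ) (p' := p') (fun _ _ => rfl) (by
    intro x hx
    simp only [p']
    rw [if_neg (show x ≠ v from hx.2), if_pos (F.inner_mem hx.1)])
  have FU := (F₁'.union hd F').link (ℓ' := ℓ') (p' := p') (u := u) (v := v) (.inr hv)
    (by
      rintro (h | h)
      · exact hd' v (F₁.inner_mem h) hvX
      · exact h.2 rfl)
    (.inl hu)
    (by
      rintro (h | h)
      · exact huI h
      · exact hd' u hu (F.inner_mem h))
    huv (fun w _ hwv => hℓ w hwv) hle
    (by
      rintro q (hq | hq) h
      · rw [r₁ _ (F₁.mate_mem' hq), r₁ u hu] at h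
        exact hlt q hq h
      · exact absurd h.symm (Forest.rootAt_union_ne hd F₁.family F.family hu (F.mate_mem' hq)))
    (by simp [p']) fun _ _ => rfl
  have hα : α ∈ {x | x ∈ S.verts ∧ S.bl x = S.bl α} ∪ ∅ := .inl ⟨L.root_mem, rfl⟩
  have FR := FU.rootSet hα (by
    rintro x (hx | hx)
    · rw [r₁ x hx.1, r₁ α L.root_mem]
      exact hx.2
    · exact absurd hx (by simp))
  have hJ : insert v (I ∪ I₂ \ {v}) = I ∪ I₂ := by
    ext x
    by_cases hx : x = v
    · simp [hx, hv]
    · simp [hx]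
  have hA : insert (u, v) (S.arcs ∪ A) = S.arcs ∪ {(u, v)} ∪ A := by
    ext x
    simp only [Set.mem_insert_iff, Set.mem_union, Set.mem_singleton_iff]
    tauto
  rw [hJ, hA] at FR
  refine ⟨p', FR, .inl L.root_mem, L.root_free, fun b hb => ?_⟩
  obtain ⟨x, hx, hxI, h⟩ := hw b hb
  refine ⟨x, .inr hx, ?_, (r₂ x hx).trans h⟩
  rintro (h' | h')
  · exact hd' x (F₁.inner_mem h') hx
  · exact hxI h'

/-- Attaching the subtree of `v` to another outer vertex `u` of the same structure. -/
theorem Layout.relink [Finite V] {α : V} {S : FreeStruct V} {I : Set V} {p : V → V}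
    (L : Layout M ℓ α S I p) {u v : V} (hv : v ∈ I) (hu : u ∈ S.verts) (huI : u ∉ I)
    (huv : G.Adj u v)
    (hℓ : ∀ w, w ≠ v → ℓ' (w, mate M w) = ℓ (w, mate M w))
    (hle : ℓ' (v, mate M v) ≤ ℓ (v, mate M v))
    (hlt : ∀ q ∈ I, S.bl (mate M q) = S.bl u → ℓ (q, mate M q) < ℓ' (v, mate M v)) :
    ∃ p', Layout M ℓ' α ⟨S.verts, (S.arcs \ {(p v, v)}) ∪ {(u, v)}, S.blossoms,
      some (S.bl (mate M v))⟩ I p' := by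
  have F := (L.forest.unlink v hv).link (ℓ' := ℓ')
    (p' := fun x => if x = v then u else p x) hv (fun h => h.2 rfl) hu huI huv
    (fun w _ hw => hℓ w hw) hle hlt (by simp) (fun w hw => if_neg hw.2)
  have hJ : insert v (I \ {v}) = I := by simp [hv]
  rw [hJ, ← Set.union_singleton] at F
  refine ⟨_, F, L.root_mem, L.root_free, ?_⟩
  rintro b hb
  obtain rfl := Option.some.inj hb
  exact ⟨_, L.forest.mate_mem' hv, L.forest.mate_outer v hv, rfl⟩

/-- The vertices of the subtree of the inner vertex `v` are closed under the tree relations. -/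
theorem Layout.mem_subtree {α : V} {S : FreeStruct V} {I : Set V} {p : V → V}
    (L : Layout M ℓ α S I p) {v : V} (hv : v ∈ I) {D : Set V}
    (hD : D = {x | x ∈ S.verts ∧ S.InSubtree α (S.bl v) (S.bl x)}) :
    v ∈ D ∧ p v ∉ D ∧ (∀ x, S.bl x = S.bl α → x ∉ D) ∧
      (∀ x ∈ S.verts, ∀ y ∈ S.verts, S.bl x = S.bl y → x ∈ D → y ∈ D) ∧
      (∀ w ∈ I, w ≠ v → (w ∈ D ↔ p w ∈ D)) ∧ (∀ w ∈ I, (w ∈ D ↔ mate M w ∈ D)) := by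
  have F := L.forest
  have R := L.isRooted
  have hvt : S.bl v ∈ S.treeVerts := ⟨v, F.inner_mem hv, rfl⟩
  have hmem : ∀ x, x ∈ D ↔ x ∈ S.verts ∧
      Relation.ReflTransGen (ParentRel M S.blossoms I p) (S.bl v) (S.bl x) := by
    intro x
    rw [hD]
    exact and_congr_right fun _ => L.inSubtree_iff hvt
  have hP : ∀ w ∈ I, ParentRel M S.blossoms I p (S.bl (p w)) (S.bl w) := fun w hw =>
    .inl ⟨w, hw, rfl, rfl⟩
  have hQ : ∀ w ∈ I, ParentRel M S.blossoms I p (S.bl w) (S.bl (mate M w)) := fun w hw =>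
    .inr ⟨w, hw, rfl, rfl⟩
  refine ⟨(hmem v).2 ⟨F.inner_mem hv, .refl⟩, ?_, ?_, ?_, ?_, ?_⟩
  · intro h
    exact R.not_cycle hvt (Relation.TransGen.tail' ((hmem _).1 h).2 (hP v hv))
  · intro x hx h
    have h2 := ((hmem _).1 h).2
    rw [hx] at h2
    rcases Relation.ReflTransGen.cases_tail h2 with h3 | ⟨y, -, h3⟩
    · exact L.inner_ne_root hv h3.symm
    · exact R.root _ h3
  · intro x _ y hy hxy h
    rw [hmem] at h ⊢
    exact ⟨hy, hxy ▸ h.2⟩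
  · intro w hw hwv
    rw [hmem, hmem]
    constructor
    · rintro ⟨-, h⟩
      refine ⟨F.par_mem hw, ?_⟩
      rcases Relation.ReflTransGen.cases_tail h with h3 | ⟨y, hy, h3⟩
      · exact absurd (F.inner_eq hv h3) hwv
      · rwa [R.uniq _ _ _ (hP w hw) h3]
    · rintro ⟨-, h⟩
      exact ⟨F.inner_mem hw, h.tail (hP w hw)⟩
  · intro w hw
    rw [hmem, hmem]
    constructor
    · rintro ⟨-, h⟩
      exact ⟨F.mate_mem' hw, h.tail (hQ w hw)⟩
    · rintro ⟨-, h⟩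
      refine ⟨F.inner_mem hw, ?_⟩
      rcases Relation.ReflTransGen.cases_tail h with h3 | ⟨y, hy, h3⟩
      · exact absurd h3 (F.outer_ne hv (F.mate_outer w hw))
      · rwa [R.uniq _ _ _ (hQ w hw) h3]

/-- The subtree of the inner vertex `v`, as a forest of its own. -/
theorem Layout.subtree_forest [Finite V] (hM : M.IsMatching) {α : V} {S : FreeStruct V}
    {I : Set V} {p : V → V} (L : Layout M ℓ α S I p) {v : V} (hv : v ∈ I) {D : Set V}
    (hD : D = {x | x ∈ S.verts ∧ S.InSubtree α (S.bl v) (S.bl x)}) :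
    Forest M ℓ D {a | a ∈ S.arcs ∧ a.1 ∈ D ∧ a.2 ∈ D} {b | b ∈ S.blossoms ∧ b.verts ⊆ D}
      (I ∩ D) ((I ∩ D) \ {v}) ∅ p ∧
      ∀ x ∈ D, rootAt {b | b ∈ S.blossoms ∧ b.verts ⊆ D} x = S.bl x := by
  obtain ⟨h1, h2, h3, h4, h5, h6⟩ := L.mem_subtree hv hD
  have F' := L.forest.unlink v hv
  have F := F'.restrict hM h4 (fun w hw => h5 w hw.1 hw.2) h6
  have e1 : S.verts ∩ D = D := by
    rw [hD]
    exact Set.inter_eq_right.2 fun x hx => hx.1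
  have e2 : {a | a ∈ S.arcs \ {(p v, v)} ∧ a.1 ∈ D ∧ a.2 ∈ D} =
      {a | a ∈ S.arcs ∧ a.1 ∈ D ∧ a.2 ∈ D} := by
    ext a
    refine ⟨fun h => ⟨h.1.1, h.2⟩, fun h => ⟨⟨h.1, ?_⟩, h.2⟩⟩
    rintro rfl
    exact h2 h.2.1
  have e3 : I \ {v} ∩ D = (I ∩ D) \ {v} := by
    ext x
    simp only [Set.mem_inter_iff, Set.mem_sdiff]
    tauto
  have e4 : {x | x ∈ S.verts ∧ S.bl x = S.bl α} ∩ D = ∅ := by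
    ext x
    simp only [Set.mem_inter_iff, Set.mem_empty_iff_false, iff_false, not_and]
    exact fun hx => h3 x hx.2
  rw [e1, e2, e3, e4] at F
  exact ⟨F, fun x hx => L.forest.rootAt_restrict h4 hx⟩

/-- Removing the subtree of the inner vertex `v`. -/
theorem Layout.prune [Finite V] (hM : M.IsMatching) {α : V} {S : FreeStruct V}
    {I : Set V} {p : V → V} (L : Layout M ℓ α S I p) {v : V} (hv : v ∈ I) {D : Set V}
    (hD : D = {x | x ∈ S.verts ∧ S.InSubtree α (S.bl v) (S.bl x)}) {w : Option (Blossom V)}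
    (hw : ∀ b, w = some b → ∃ u ∈ S.verts, u ∉ D ∧ u ∉ I ∧ S.bl u = b) :
    Layout M ℓ α ⟨S.verts \ D, (S.arcs \ {(p v, v)}) \ {a | a ∈ S.arcs ∧ a.1 ∈ D ∧ a.2 ∈ D},
      S.blossoms \ {b | b ∈ S.blossoms ∧ b.verts ⊆ D}, w⟩ (I \ D) p := by
  obtain ⟨h1, h2, h3, h4, h5, h6⟩ := L.mem_subtree hv hD
  have F₀ := L.forest
  have F' := L.forest.unlink v hv
  have h4' : ∀ x ∈ S.verts, ∀ y ∈ S.verts, S.bl x = S.bl y → x ∈ Dᶜ → y ∈ Dᶜ :=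
    fun x hx y hy hxy hxD hyD => hxD (h4 y hy x hx hxy.symm hyD)
  have F := F'.restrict (E := Dᶜ) hM h4' (fun w hw => not_congr (h5 w hw.1 hw.2))
    (fun w hw => not_congr (h6 w hw))
  have hDs : ∀ x, x ∈ D → x ∈ S.verts := fun x hx => by
    rw [hD] at hx
    exact hx.1
  -- The arc `(p v, v)` is the only one across the boundary of the subtree, so the remaining unmoved
  -- arcs have both ends outside `D`.
  have e2 : {a | a ∈ S.arcs \ {(p v, v)} ∧ a.1 ∈ Dᶜ ∧ a.2 ∈ Dᶜ} =
      (S.arcs \ {(p v, v)}) \ {a | a ∈ S.arcs ∧ a.1 ∈ D ∧ a.2 ∈ D} := by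
    ext ⟨x, y⟩
    refine ⟨fun h => ⟨h.1, fun h' => h.2.1 h'.2.1⟩, fun h => ⟨h.1, ?_⟩⟩
    have hs := (F₀.arcs_sub x y h.1.1).2
    have hiff : x ∈ D ↔ y ∈ D := by
      by_cases hxy : S.bl x = S.bl y
      · exact ⟨h4 x hs.1 y hs.2 hxy, h4 y hs.2 x hs.1 hxy.symm⟩
      · rcases F'.cross x y h.1 hxy with ⟨hy, rfl⟩ | ⟨hx, rfl⟩
        · exact (h5 y hy.1 hy.2).symm
        · exact h6 x hx
    have hn : ¬ (x ∈ D ∧ y ∈ D) := fun h' => h.2 ⟨h.1.1, h'⟩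
    simp only [Set.mem_compl_iff]
    tauto
  -- A blossom lies in one root blossom, hence inside `D` or disjoint from it.
  have e3 : {b | b ∈ S.blossoms ∧ b.verts ⊆ Dᶜ} =
      S.blossoms \ {b | b ∈ S.blossoms ∧ b.verts ⊆ D} := by
    ext b
    constructor
    · rintro ⟨hb, hbD⟩
      refine ⟨hb, fun h => ?_⟩
      obtain ⟨x, hx⟩ := (F₀.family.isBlossom b hb).nonempty
      exact hbD hx (h.2 hx)
    · rintro ⟨hb, hbD⟩
      refine ⟨hb, fun x hx hxD => hbD ⟨hb, fun y hy => ?_⟩⟩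
      have hs := (F₀.family.isBlossom b hb).verts_subset
      exact h4 x (hs hx) y (hs hy) (F₀.family.rootAt_const hb hx hy) hxD
  have e4 : I \ {v} ∩ Dᶜ = I ∩ Dᶜ := by
    ext x
    simp only [Set.mem_inter_iff, Set.mem_sdiff, Set.mem_compl_iff, Set.mem_singleton_iff]
    refine ⟨fun h => ⟨h.1.1, h.2⟩, fun h => ⟨⟨h.1, ?_⟩, h.2⟩⟩
    rintro rfl
    exact h.2 h1
  have hr : ∀ x, x ∉ D → rootAt {b | b ∈ S.blossoms ∧ b.verts ⊆ Dᶜ} x = S.bl x := fun x hx =>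
    F₀.rootAt_restrict h4' hx
  have hαD : α ∉ D := h3 α rfl
  have FR := F.rootSet (α := α) ⟨⟨L.root_mem, rfl⟩, hαD⟩ (by
    rintro x ⟨hx, hxD⟩
    rw [hr x hxD, hr α hαD]
    exact hx.2)
  rw [e4, e2] at FR
  refine ⟨?_, ⟨L.root_mem, hαD⟩, L.root_free, ?_⟩
  · change Forest _ _ _ _ _ _ _ {x | x ∈ S.verts \ D ∧ rootAt (S.blossoms \ _) x =
      rootAt (S.blossoms \ _) α} _
    rw [← e3]
    exact FR
  · intro b hb
    obtain ⟨u, hu, huD, huI, rfl⟩ := hw b hb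
    refine ⟨u, ⟨hu, huD⟩, fun h => huI h.1, ?_⟩
    change rootAt (S.blossoms \ _) u = _
    rw [← e3]
    exact hr u huD

/-- Overtake moves the subtree of Ω(v) but tests the working vertex against that of Ω(t). The two
subtrees differ only by the inner vertex `v`, and working vertices are outer. -/
theorem Layout.mem_subtree_of_outer {α : V} {S : FreeStruct V} {I : Set V} {p : V → V}
    (L : Layout M ℓ α S I p) {v x : V} (hv : v ∈ I) (hxI : x ∉ I) :
    S.InSubtree α (S.bl v) (S.bl x) ↔ S.InSubtree α (S.bl (mate M v)) (S.bl x) := by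
  rw [L.inSubtree_iff ⟨v, L.forest.inner_mem hv, rfl⟩,
    L.inSubtree_iff ⟨_, L.forest.mate_mem' hv, rfl⟩]
  constructor
  · intro h
    rcases Relation.ReflTransGen.cases_head h with h | ⟨y, hy, h⟩
    · exact absurd h.symm (L.forest.outer_ne hv hxI)
    · rwa [L.child_eq hv hy] at h
  · exact .head (.inr ⟨v, hv, rfl, rfl⟩)

end Grafting

end AlgPhase

namespace AlgPhase

/-! ### The invariant of a phase and its preservation -/

section Invariant

variable {V : Type*} {G : SimpleGraph V} {M : G.Subgraph}

/-- The invariant of a phase. -/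
structure Inv (M : G.Subgraph) (st : State V) : Prop where
  layout : ∀ α, st.Live M α → ∃ I p, Layout M st.label α (st.S α) I p
  disjoint : ∀ α β, st.Live M α → st.Live M β → β ≠ α →
    Disjoint (st.S α).verts (st.S β).verts
  not_removed : ∀ α, st.Live M α → Disjoint (st.S α).verts st.removed
  removed_mate : ∀ x ∈ st.removed, ∀ t, M.Adj x t → t ∈ st.removed

namespace Inv

variable {st : State V} {α : V} {I : Set V} {p : V → V}

theorem isStructure (hM : M.IsMatching) (h : Inv M st) (hα : st.Live M α) :
    IsStructure M st α ∧ LabelsIncrease M st.label α (st.S α) := by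
  obtain ⟨I, p, L⟩ := h.layout α hα
  refine ⟨?_, L.labelsIncrease hM⟩
  exact
    { verts_not_removed := h.not_removed α hα
      arcs_sub := L.forest.arcs_sub
      regular := L.isRegular hM
      work_outer := fun w hw => L.outer_iff.2 (L.work w hw)
      disjointness := fun β hβ hne => h.disjoint α β hα hβ hne
      tree_representation := L.tree_representation
      unique_arc := L.unique_arc }

theorem eq_of_mem (h : Inv M st) {β x : V} (hα : st.Live M α) (hβ : st.Live M β)
    (hx : x ∈ (st.S α).verts) (hx' : x ∈ (st.S β).verts) : β = α := by
  by_contra hne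
  exact Set.disjoint_left.1 (h.disjoint α β hα hβ hne) hx hx'

/-- By disjointness, blossoms of other structures do not contain `x`, so the global root blossom is
computed inside the structure of `α`. -/
theorem bl_eq (h : Inv M st) (hα : st.Live M α) {x : V} (hx : x ∈ (st.S α).verts) :
    st.bl M x = (st.S α).bl x := by
  obtain ⟨I, p, L⟩ := h.layout α hα
  refine rootAt_congr fun b hb => ⟨?_, fun h => .inl ⟨α, hα, h⟩⟩
  rintro (⟨β, hβ, hbβ⟩ | ⟨v, -, rfl⟩)
  · obtain ⟨I', p', L'⟩ := h.layout β hβ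
    obtain rfl := h.eq_of_mem hα hβ hx ((L'.forest.family.isBlossom b hbβ).verts_subset hb)
    exact hbβ
  · obtain rfl : x = v := hb
    exact L.forest.family.triv_mem x hx

theorem mem_of_bl [Finite V] (h : Inv M st) (hα : st.Live M α) {x y : V}
    (hy : y ∈ (st.S α).verts) (hxy : (st.S α).bl y = st.bl M x) : x ∈ (st.S α).verts := by
  obtain ⟨I, p, L⟩ := h.layout α hα
  have : x ∈ (st.bl M x).verts := mem_rootAt _ _
  rw [← hxy] at this
  exact L.forest.family.rootAt_subset hy this

theorem outer_of_bl [Finite V] (h : Inv M st) (hα : st.Live M α)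
    (L : Layout M st.label α (st.S α) I p) {x : V}
    (hx : ∃ u ∈ (st.S α).verts, u ∉ I ∧ (st.S α).bl u = st.bl M x) :
    x ∈ (st.S α).verts ∧ x ∉ I := by
  obtain ⟨u, hu, huI, hux⟩ := hx
  have hxv := h.mem_of_bl hα hu hux
  refine ⟨hxv, fun hxI => ?_⟩
  rw [h.bl_eq hα hxv] at hux
  exact L.forest.outer_ne hxI huI hux

theorem outerIn_iff [Finite V] (h : Inv M st) (hα : st.Live M α)
    (L : Layout M st.label α (st.S α) I p) {x : V} :
    OuterIn M st α x ↔ x ∈ (st.S α).verts ∧ x ∉ I := by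
  constructor
  · rintro ⟨-, -, hx⟩
    exact h.outer_of_bl hα L (L.outer_iff.1 hx)
  · rintro ⟨hx, hxI⟩
    refine ⟨fun hr => Set.disjoint_left.1 (h.not_removed α hα) hx hr, hα, ?_⟩
    rw [L.outer_iff, h.bl_eq hα hx]
    exact ⟨x, hx, hxI, rfl⟩

/-- `distance` chooses some matched arc entering Ω(u). Its tail must be inner, and `mate_inj` leaves
only `q`. -/
theorem distance_eq [Finite V] (hM : M.IsMatching) (h : Inv M st) (hα : st.Live M α)
    (L : Layout M st.label α (st.S α) I p) {u q : V} (hu : u ∈ (st.S α).verts) (huI : u ∉ I)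
    (hq : q ∈ I) (hqu : (st.S α).bl (mate M q) = (st.S α).bl u) :
    st.distance M u = st.label (q, mate M q) := by
  have F := L.forest
  have hbu := h.bl_eq hα hu
  have hbl := fun {x} hx => h.bl_eq (x := x) hα hx
  have hex : ∃ a : V × V, M.Adj a.1 a.2 ∧ st.bl M a.1 ≠ st.bl M u ∧
      st.bl M a.2 = st.bl M u := by
    refine ⟨(q, mate M q), F.inner_adj q hq, ?_, ?_⟩
    · rw [hbl (F.inner_mem hq), hbu]
      exact (F.outer_ne hq huI).symm
    · rw [hbl (F.mate_mem' hq), hbu]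
      exact hqu
  unfold State.distance
  rw [dif_pos hex]
  obtain ⟨h1, h2, h3⟩ := hex.choose_spec
  generalize hex.choose = a at h1 h2 h3 ⊢
  obtain ⟨x, y⟩ := a
  have hy : y ∈ (st.S α).verts := h.mem_of_bl hα hu (hbu.symm.trans h3.symm)
  obtain ⟨hx, h4⟩ := F.mate_mem y hy x h1.symm
  rw [hbu] at h2 h3
  rw [hbl hx] at h2
  rw [hbl hy] at h3
  have hyI : y ∉ I := fun hyI => F.outer_ne hyI huI h3.symm
  have hxI : x ∈ I := by
    rcases h4 with h4 | h4 | h4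
    · exact absurd (h4.symm.trans h3) h2
    · exact absurd h4 hyI
    · exact h4
  have hxy : mate M x = y := mate_eq hM h1
  have : q = x := F.mate_inj q hq x hxI (by rw [hxy]; exact hqu.trans h3.symm)
  rw [this, hxy]

theorem contract [Finite V] (hM : M.IsMatching) (h : Inv M st) (hα : st.Live M α)
    (L : Layout M st.label α (st.S α) I p) {u v : V} (hu : u ∈ (st.S α).verts)
    (hv : v ∈ (st.S α).verts) (huI : u ∉ I) (hvI : v ∉ I)
    (hne : (st.S α).bl u ≠ (st.S α).bl v) (huv : G.Adj u v) :
    Inv M (st.contract M α u v) := by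
  obtain ⟨f, n, c, hf, hpath⟩ := exists_isValley L hu hv
  obtain ⟨z, -, hC⟩ := hf.isLobe L hu huI hvI
  have hcv : st.cycleVerts α u v = {b | ∃ j ≤ n, f j = b} := by
    ext b
    exact hpath b
  have hBv : (st.newBlossom α u v).verts = {x | ∃ b ∈ {b | ∃ j ≤ n, f j = b}, x ∈ b.verts} := by
    rw [← hcv]
    rfl
  have huC : (st.S α).bl u ∈ {b | ∃ j ≤ n, f j = b} := ⟨0, Nat.zero_le _, hf.start⟩
  have hvC : (st.S α).bl v ∈ {b | ∃ j ≤ n, f j = b} := ⟨n, le_rfl, hf.finish⟩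
  have hcyc := hf.isBlossomCycle L hu huI hvI hne (B := st.newBlossom α u v) hBv (by
    unfold State.newBlossom
    rw [hcv]
    rfl)
  have hBsub : (st.newBlossom α u v).verts ⊆ (st.S α).verts := fun x hx =>
    ((hC.mem_iff L hBv).1 hx).1
  have hlabel : ∀ w, w ∉ (st.newBlossom α u v).verts →
      (st.contract M α u v).label (w, mate M w) = st.label (w, mate M w) := by
    intro w hw
    simp only [State.contract]
    rw [if_neg fun h' => hw h'.2.1]
  have hS : ∀ γ, ((st.contract M α u v).S γ).verts = (st.S γ).verts := by
    intro γ
    simp only [State.contract]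
    split_ifs with h1
    · rw [h1]
    · rfl
  refine ⟨fun γ hγ => ?_, fun γ δ hγ hδ hne => ?_, fun γ hγ => ?_, h.removed_mate⟩
  · by_cases hγα : γ = α
    · subst hγα
      refine ⟨{w | w ∈ I ∧ w ∉ (st.newBlossom γ u v).verts}, p, ?_⟩
      have := hC.contract_layout hM L hBv ⟨_, huC, _, hvC, hne⟩ hcyc hu hv huv huC hvC huI
        (ℓ' := (st.contract M γ u v).label) (fun w _ hw => hlabel w hw)
      simpa only [State.contract, if_true] using this
    · obtain ⟨I', p', L'⟩ := h.layout γ hγ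
      refine ⟨I', p', ?_⟩
      have hSγ : (st.contract M α u v).S γ = st.S γ := if_neg hγα
      rw [hSγ]
      -- Labels are reset only inside the new blossom, which lies in the structure of `α`; the
      -- matched tree arcs of other structures keep theirs.
      refine L'.congr fun w hw => hlabel w fun hwB => hγα ?_
      exact h.eq_of_mem hα hγ (hBsub hwB) (L'.forest.inner_mem hw)
  · rw [hS, hS]
    exact h.disjoint γ δ hγ hδ hne
  · rw [hS]
    exact h.not_removed γ hγ

theorem augment (h : Inv M st) {β : V} (hα : st.Live M α) (hβ : st.Live M β) (u v : V) :
    Inv M (st.augment M α β u v) := by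
  have hlive : ∀ γ, (st.augment M α β u v).Live M γ → st.Live M γ ∧ γ ≠ α ∧ γ ≠ β := by
    intro γ hγ
    refine ⟨⟨hγ.1, fun h' => hγ.2 (.inl (.inl h'))⟩, ?_, ?_⟩
    · rintro rfl
      obtain ⟨I, p, L⟩ := h.layout γ hα
      exact hγ.2 (.inl (.inr L.root_mem))
    · rintro rfl
      obtain ⟨I, p, L⟩ := h.layout γ hβ
      exact hγ.2 (.inr L.root_mem)
  refine ⟨fun γ hγ => h.layout γ (hlive γ hγ).1, fun γ δ hγ hδ hne =>
    h.disjoint γ δ (hlive γ hγ).1 (hlive δ hδ).1 hne, fun γ hγ => ?_, ?_⟩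
  · obtain ⟨h1, h2, h3⟩ := hlive γ hγ
    exact Set.disjoint_union_right.2 ⟨Set.disjoint_union_right.2
      ⟨h.not_removed γ h1, h.disjoint γ α h1 hα h2.symm⟩, h.disjoint γ β h1 hβ h3.symm⟩
  -- Each structure contains the mates of its vertices, so deleting whole structures keeps the
  -- removed set closed under the matching.
  · rintro x ((hx | hx) | hx) t ht
    · exact .inl (.inl (h.removed_mate x hx t ht))
    · obtain ⟨I, p, L⟩ := h.layout α hα
      exact .inl (.inr (L.forest.mate_mem x hx t ht).1)
    · obtain ⟨I, p, L⟩ := h.layout β hβ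
      exact .inr (L.forest.mate_mem x hx t ht).1

theorem mark (h : Inv M st) (η : ℝ) : Inv M (st.mark η) :=
  ⟨h.layout, h.disjoint, h.not_removed, h.removed_mate⟩

/-- The parent of an outer non-root vertex is an inner `v`, whose parent Ω(p v) is outer again. -/
theorem backtrack (h : Inv M st) (α : V) : Inv M (st.backtrack M α) := by
  unfold State.backtrack
  split_ifs with hα
  swap
  · exact h
  obtain ⟨I, p, L⟩ := h.layout α hα.1
  have hparent : ∀ x y, ParentRel M (st.S α).blossoms I p x y →
      (st.S α).parentOf α y = x := by
    intro x y hxy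
    have := Classical.epsilon_spec (p := fun x => (st.S α).Parent α x y) ⟨x, L.parent_iff.2 hxy⟩
    exact L.isRooted.uniq _ _ _ (L.parent_iff.1 this) hxy
  have hL := L.setWork (match (st.S α).work with
        | none => none
        | some w => if w = (st.S α).bl α then none
            else some ((st.S α).parentOf α ((st.S α).parentOf α w))) (by
    intro b hb
    cases hw : (st.S α).work with
    | none => simp [hw] at hb
    | some w =>
      simp only [hw] at hb
      obtain ⟨u, hu, huI, rfl⟩ := L.work w hw
      split_ifs at hb with hroot
      rcases (L.forest.cover u hu).resolve_left huI with h1 | ⟨v, hv, h1⟩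
      · exact absurd h1.2 hroot
      · have e1 : (st.S α).parentOf α ((st.S α).bl u) = (st.S α).bl v :=
          hparent _ _ (.inr ⟨v, hv, rfl, h1.symm⟩)
        have e2 : (st.S α).parentOf α ((st.S α).bl v) = (st.S α).bl (p v) :=
          hparent _ _ (.inl ⟨v, hv, rfl, rfl⟩)
        rw [e1, e2] at hb
        exact ⟨p v, L.forest.par_mem hv, L.forest.par_outer v hv, Option.some.inj hb⟩)
  refine ⟨fun γ hγ => ?_, fun γ δ hγ hδ hne => ?_, fun γ hγ => ?_, h.removed_mate⟩
  · by_cases hγα : γ = α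
    · subst hγα
      refine ⟨I, p, ?_⟩
      simp only [State.setStruct, if_true]
      exact hL
    · simp only [State.setStruct, if_neg hγα]
      exact h.layout γ hγ
  · have := h.disjoint γ δ hγ hδ hne
    simp only [State.setStruct]
    split_ifs with h1 h2 h2
    · exact absurd (h2.trans h1.symm) hne
    · subst h1; exact this
    · subst h2; exact this
    · exact this
  · have := h.not_removed γ hγ
    simp only [State.setStruct]
    split_ifs with h1
    · subst h1; exact this
    · exact this

theorem overtakeNew [Finite V] (hM : M.IsMatching) (h : Inv M st) (hα : st.Live M α)
    (L : Layout M st.label α (st.S α) I p) {u v : V} {k : ℕ} (hu : u ∈ (st.S α).verts)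
    (huI : u ∉ I) (huv : G.Adj u v) (hvm : M.Adj v (mate M v)) (hvr : v ∉ st.removed)
    (hout : ∀ β, st.Live M β → v ∉ (st.S β).verts) (hk : k < st.label (v, mate M v))
    (hlt : ∀ q ∈ I, (st.S α).bl (mate M q) = (st.S α).bl u → st.label (q, mate M q) < k) :
    Inv M (st.overtakeNew α u v (mate M v) k) := by
  -- A structure containing the mate would contain `v` as well.
  have hout' : ∀ β, st.Live M β → mate M v ∉ (st.S β).verts := by
    intro β hβ hm
    obtain ⟨I', p', L'⟩ := h.layout β hβ
    exact hout β hβ (L'.forest.mate_mem _ hm v hvm.symm).1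
  have hmr : mate M v ∉ st.removed := fun hm => hvr (h.removed_mate _ hm v hvm.symm)
  have hdis : ∀ β, st.Live M β → Disjoint (st.S β).verts {v, mate M v} := by
    intro β hβ
    rw [Set.disjoint_left]
    rintro x hx (rfl | rfl)
    · exact hout β hβ hx
    · exact hout' β hβ hx
  have hℓ : ∀ w, w ≠ v → (st.overtakeNew α u v (mate M v) k).label (w, mate M w) =
      st.label (w, mate M w) := fun w hw => if_neg fun h' => hw (congrArg Prod.fst h')
  have hℓv : (st.overtakeNew α u v (mate M v) k).label (v, mate M v) = k := if_pos rfl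
  have F₂ : Forest M st.label {v, mate M v} {(v, mate M v)}
      {Blossom.triv v, Blossom.triv (mate M v)} {v} ({v} \ {v}) ∅ p := by
    rw [Set.sdiff_self]
    exact Forest.single hM hvm
  obtain ⟨p', L'⟩ := L.graft (ℓ' := (st.overtakeNew α u v (mate M v) k).label)
    (w := some (Blossom.triv (mate M v))) F₂ (hdis α hα) rfl hu huI huv hℓ
    (by rw [hℓv]; exact hk.le) (by rw [hℓv]; exact hlt) (by
      rintro b hb
      obtain rfl := Option.some.inj hb
      refine ⟨mate M v, .inr rfl, hvm.ne.symm, rootAt_eq_triv ?_⟩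
      rintro b (rfl | rfl) hb
      · obtain hb : mate M v = v := hb
        rw [hb]
      · rfl)
  have hSα : (st.overtakeNew α u v (mate M v) k).S α = ⟨(st.S α).verts ∪ {v, mate M v},
      (st.S α).arcs ∪ {(u, v)} ∪ {(v, mate M v)},
      (st.S α).blossoms ∪ {Blossom.triv v, Blossom.triv (mate M v)},
      some (Blossom.triv (mate M v))⟩ := by
    refine (if_pos rfl).trans ?_
    rw [Set.union_assoc]
    rfl
  have hSγ : ∀ γ, γ ≠ α → (st.overtakeNew α u v (mate M v) k).S γ = st.S γ := fun γ hγ =>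
    if_neg hγ
  rw [← hSα] at L'
  refine ⟨fun γ hγ => ?_, fun γ δ hγ hδ hne => ?_, fun γ hγ => ?_, h.removed_mate⟩
  · by_cases hγα : γ = α
    · subst hγα
      exact ⟨_, p', L'⟩
    · obtain ⟨I', q, L₁⟩ := h.layout γ hγ
      rw [hSγ γ hγα]
      refine ⟨I', q, L₁.congr fun w hw => hℓ w ?_⟩
      rintro rfl
      exact hout γ hγ (L₁.forest.inner_mem hw)
  · have hd := h.disjoint γ δ hγ hδ hne
    by_cases h1 : γ = α
    · subst h1
      rw [hSα, hSγ δ hne]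
      exact Set.disjoint_union_left.2 ⟨hd, (hdis δ hδ).symm⟩
    · by_cases h2 : δ = α
      · subst h2
        rw [hSα, hSγ γ h1]
        exact Set.disjoint_union_right.2 ⟨hd, hdis γ hγ⟩
      · rwa [hSγ γ h1, hSγ δ h2]
  · have hd := h.not_removed γ hγ
    by_cases h1 : γ = α
    · subst h1
      rw [hSα]
      refine Set.disjoint_union_left.2 ⟨hd, ?_⟩
      rw [Set.disjoint_left]
      rintro x (rfl | rfl)
      · exact hvr
      · exact hmr
    · rwa [hSγ γ h1]

/-- That `u` is not in the subtree of `v` needs no argument of its own: `hlt` and `hk` provide the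
label condition, from which the tree property is rederived. -/
theorem overtakeSelf [Finite V] (hM : M.IsMatching) (h : Inv M st) (hα : st.Live M α)
    (L : Layout M st.label α (st.S α) I p) {u v : V} {k : ℕ} (hu : u ∈ (st.S α).verts)
    (huI : u ∉ I) (huv : G.Adj u v) (hv : v ∈ I) (hk : k < st.label (v, mate M v))
    (hlt : ∀ q ∈ I, (st.S α).bl (mate M q) = (st.S α).bl u → st.label (q, mate M q) < k) :
    Inv M (st.overtakeSelf M α u v (mate M v) k) := by
  have hℓ : ∀ w, w ≠ v → (st.overtakeSelf M α u v (mate M v) k).label (w, mate M w) =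
      st.label (w, mate M w) := fun w hw => if_neg fun h' => hw (congrArg Prod.fst h')
  have hℓv : (st.overtakeSelf M α u v (mate M v) k).label (v, mate M v) = k := if_pos rfl
  obtain ⟨p', L'⟩ := L.relink (ℓ' := (st.overtakeSelf M α u v (mate M v) k).label) hv hu huI huv
    hℓ (by rw [hℓv]; exact hk.le) (by rw [hℓv]; exact hlt)
  have hSα : (st.overtakeSelf M α u v (mate M v) k).S α = ⟨(st.S α).verts,
      ((st.S α).arcs \ {(p v, v)}) ∪ {(u, v)}, (st.S α).blossoms,
      some ((st.S α).bl (mate M v))⟩ := by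
    refine (if_pos rfl).trans ?_
    rw [L.parentTail_eq hM hv]
  have hSγ : ∀ γ, γ ≠ α → (st.overtakeSelf M α u v (mate M v) k).S γ = st.S γ := fun γ hγ =>
    if_neg hγ
  have hS : ∀ γ, ((st.overtakeSelf M α u v (mate M v) k).S γ).verts = (st.S γ).verts := by
    intro γ
    by_cases h1 : γ = α
    · rw [h1, hSα]
    · rw [hSγ γ h1]
  rw [← hSα] at L'
  refine ⟨fun γ hγ => ?_, fun γ δ hγ hδ hne => ?_, fun γ hγ => ?_, h.removed_mate⟩
  · by_cases hγα : γ = α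
    · subst hγα
      exact ⟨_, p', L'⟩
    · obtain ⟨I', q, L₁⟩ := h.layout γ hγ
      rw [hSγ γ hγα]
      refine ⟨I', q, L₁.congr fun w hw => hℓ w ?_⟩
      rintro rfl
      exact hγα (h.eq_of_mem hα hγ (L.forest.inner_mem hv) (L₁.forest.inner_mem hw))
  · rw [hS, hS]
    exact h.disjoint γ δ hγ hδ hne
  · rw [hS]
    exact h.not_removed γ hγ

theorem overtakeOther [Finite V] (hM : M.IsMatching) (h : Inv M st) (hα : st.Live M α)
    (L : Layout M st.label α (st.S α) I p) {β : V} (hβ : st.Live M β) (hβα : β ≠ α)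
    {I₂ : Set V} {p₂ : V → V} (L₂ : Layout M st.label β (st.S β) I₂ p₂) {u v : V} {k : ℕ}
    (hu : u ∈ (st.S α).verts) (huI : u ∉ I) (huv : G.Adj u v) (hv : v ∈ I₂)
    (hk : k < st.label (v, mate M v))
    (hlt : ∀ q ∈ I, (st.S α).bl (mate M q) = (st.S α).bl u → st.label (q, mate M q) < k) :
    Inv M (st.overtakeOther M α β u v (mate M v) k) := by
  set st' := st.overtakeOther M α β u v (mate M v) k with hst'
  have hℓ : ∀ w, w ≠ v → st'.label (w, mate M w) = st.label (w, mate M w) :=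
    fun w hw => if_neg fun h' => hw (congrArg Prod.fst h')
  have hℓv : st'.label (v, mate M v) = k := if_pos rfl
  obtain ⟨D, hD⟩ : ∃ D, D = st.movedVerts β v := ⟨_, rfl⟩
  have hD' : D = {x | x ∈ (st.S β).verts ∧
      (st.S β).InSubtree β ((st.S β).bl v) ((st.S β).bl x)} := hD
  obtain ⟨F₂, hr⟩ := L₂.subtree_forest hM hv hD'
  obtain ⟨hvD, hpvD, -, -, -, hmD⟩ := L₂.mem_subtree hv hD'
  have hDs : D ⊆ (st.S β).verts := fun x hx => by
    rw [hD'] at hx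
    exact hx.1
  have hmem : ∀ x ∈ (st.S β).verts, x ∉ I₂ →
      (x ∈ D ↔ (st.S β).InSubtree β ((st.S β).bl (mate M v)) ((st.S β).bl x)) := by
    intro x hx hxI
    rw [← L₂.mem_subtree_of_outer hv hxI, hD']
    exact and_iff_right hx
  have hSα : st'.S α = ⟨(st.S α).verts ∪ D, (st.S α).arcs ∪ {(u, v)} ∪
      {a | a ∈ (st.S β).arcs ∧ a.1 ∈ D ∧ a.2 ∈ D},
      (st.S α).blossoms ∪ {b | b ∈ (st.S β).blossoms ∧ b.verts ⊆ D},
      if st.WorkBelow β (mate M v) then (st.S β).work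
        else some ((st.S β).bl (mate M v))⟩ := by
    rw [hD]
    exact if_pos rfl
  have hSβ : st'.S β = ⟨(st.S β).verts \ D, ((st.S β).arcs \ {(p₂ v, v)}) \
      {a | a ∈ (st.S β).arcs ∧ a.1 ∈ D ∧ a.2 ∈ D},
      (st.S β).blossoms \ {b | b ∈ (st.S β).blossoms ∧ b.verts ⊆ D},
      if st.WorkBelow β (mate M v) then some ((st.S β).bl (p₂ v)) else (st.S β).work⟩ := by
    rw [hD, ← L₂.parentTail_eq hM hv]
    exact (if_neg hβα).trans (if_pos rfl)
  have hSγ : ∀ γ, γ ≠ α → γ ≠ β → st'.S γ = st.S γ := fun γ h1 h2 =>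
    (if_neg h1).trans (if_neg h2)
  have hαβ := h.disjoint α β hα hβ hβα
  obtain ⟨p', L'⟩ := L.graft (ℓ' := st'.label)
    (w := if st.WorkBelow β (mate M v) then (st.S β).work else some ((st.S β).bl (mate M v)))
    F₂ (hαβ.mono_right hDs) ⟨hv, hvD⟩ hu huI huv hℓ
    (by rw [hℓv]; exact hk.le) (by rw [hℓv]; exact hlt) (by
      intro b hb
      split_ifs at hb with hw
      · obtain ⟨w, hw1, hw2⟩ := hw
        obtain rfl : w = b := Option.some.inj (hw1.symm.trans hb)
        obtain ⟨x, hx, hxI, rfl⟩ := L₂.work w hw1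
        have hxD := (hmem x hx hxI).2 hw2
        exact ⟨x, hxD, fun h' => hxI h'.1, hr x hxD⟩
      · obtain rfl := Option.some.inj hb
        have hxD := (hmD v hv).1 hvD
        exact ⟨_, hxD, fun h' => L₂.forest.mate_outer v hv h'.1, hr _ hxD⟩)
  have L₂' := (L₂.prune hM hv hD' (w := if st.WorkBelow β (mate M v) then
    some ((st.S β).bl (p₂ v)) else (st.S β).work) (by
      intro b hb
      split_ifs at hb with hw
      · obtain rfl := Option.some.inj hb
        exact ⟨_, L₂.forest.par_mem hv, hpvD, L₂.forest.par_outer v hv, rfl⟩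
      · obtain ⟨x, hx, hxI, rfl⟩ := L₂.work b hb
        exact ⟨x, hx, fun hxD => hw ⟨_, hb, (hmem x hx hxI).1 hxD⟩, hxI, rfl⟩)).congr
    (ℓ' := st'.label) (fun w hw => hℓ w (by rintro rfl; exact hw.2 hvD))
  rw [← hSα] at L'
  rw [← hSβ] at L₂'
  -- Apart from `α`, a live structure either loses the moved set `D` or was already disjoint from
  -- it, so the gain of `α` meets no other structure.
  have hsub : ∀ γ, γ ≠ α → (st'.S γ).verts ⊆ (st.S γ).verts \ D ∨ ¬ st.Live M γ := by
    intro γ h1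
    by_cases hγ : st.Live M γ
    · left
      by_cases h2 : γ = β
      · subst h2
        rw [hSβ]
      · rw [hSγ γ h1 h2]
        intro x hx
        exact ⟨hx, fun hxD => h2 (h.eq_of_mem hβ hγ (hDs hxD) hx)⟩
    · exact .inr hγ
  refine ⟨fun γ hγ => ?_, fun γ δ hγ hδ hne => ?_, fun γ hγ => ?_, h.removed_mate⟩
  · by_cases hγα : γ = α
    · subst hγα
      exact ⟨_, p', L'⟩
    by_cases hγβ : γ = β
    · subst hγβ
      exact ⟨_, p₂, L₂'⟩
    · obtain ⟨I', q, L₁⟩ := h.layout γ hγ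
      rw [hSγ γ hγα hγβ]
      refine ⟨I', q, L₁.congr fun w hw => hℓ w ?_⟩
      rintro rfl
      exact hγβ (h.eq_of_mem hβ hγ (L₂.forest.inner_mem hv) (L₁.forest.inner_mem hw))
  · have key : ∀ γ, st.Live M γ → γ ≠ α → Disjoint (st'.S α).verts (st'.S γ).verts := by
      intro γ hγ h1
      have h2 := (hsub γ h1).resolve_right (not_not_intro hγ)
      rw [hSα]
      refine Set.disjoint_union_left.2 ⟨(h.disjoint α γ hα hγ h1).mono_right
        (h2.trans Set.sdiff_subset), ?_⟩
      rw [Set.disjoint_left]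
      exact fun x hx hx' => (h2 hx').2 hx
    by_cases h1 : γ = α
    · subst h1
      exact key δ hδ hne
    · by_cases h2 : δ = α
      · subst h2
        exact (key γ hγ h1).symm
      · exact (h.disjoint γ δ hγ hδ hne).mono
          (((hsub γ h1).resolve_right (not_not_intro hγ)).trans Set.sdiff_subset)
          (((hsub δ h2).resolve_right (not_not_intro hδ)).trans Set.sdiff_subset)
  · by_cases h1 : γ = α
    · subst h1
      rw [hSα]
      exact Set.disjoint_union_left.2 ⟨h.not_removed γ hγ, (h.not_removed β hβ).mono_left hDs⟩
    · exact (h.not_removed γ hγ).mono_left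
        (((hsub γ h1).resolve_right (not_not_intro hγ)).trans Set.sdiff_subset)

theorem overtake [Finite V] (hM : M.IsMatching) (h : Inv M st) {u v t : V} {st' : State V}
    (hE : Eligible M st α u v) (huv : G.Adj u v) (hout : ∀ β, ¬ OuterIn M st β v)
    (hvt : M.Adj v t) (hk : st.distance M u + 1 < st.label (v, t))
    (ho : st.Overtake M α u v t (st.distance M u + 1) st') : Inv M st' := by
  obtain rfl := mate_eq hM hvt
  have hα := hE.live
  obtain ⟨I, p, L⟩ := h.layout α hα
  obtain ⟨hu, huI⟩ := h.outer_of_bl hα L (L.work _ hE.work)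
  -- If Ω(u) is the root there is no such `q`, and the condition is empty.
  have hlt : ∀ q ∈ I, (st.S α).bl (mate M q) = (st.S α).bl u →
      st.label (q, mate M q) < st.distance M u + 1 := by
    intro q hq hqu
    rw [h.distance_eq hM hα L hu huI hq hqu]
    exact Nat.lt_succ_self _
  -- Contract and Augment take precedence when Ω(v) is outer, so at an Overtake a `v` inside some
  -- structure is an inner vertex.
  have hinner : ∀ β I' p', st.Live M β → Layout M st.label β (st.S β) I' p' →
      v ∈ (st.S β).verts → v ∈ I' := by
    intro β I' p' hβ L' hv
    by_contra hvI
    exact hout β ((h.outerIn_iff hβ L').2 ⟨hv, hvI⟩)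
  cases ho with
  | new hnew =>
    -- If the arc `(v, t)` is in no structure, neither is `v`: it would be inner there, and an inner
    -- vertex comes with its matched arc.
    refine h.overtakeNew hM hα L hu huI huv hvt hE.snd_not_removed (fun β hβ hv => ?_) hk hlt
    obtain ⟨I', p', L'⟩ := h.layout β hβ
    exact hnew β hβ (L'.forest.mate_arc v (hinner β I' p' hβ L' hv))
  | self harc =>
    exact h.overtakeSelf hM hα L hu huI huv
      (hinner α I p hα L (L.forest.arcs_sub _ _ harc).2.1) hk hlt
  | other β hβ hne harc =>
    obtain ⟨I', p', L'⟩ := h.layout β hβ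
    exact h.overtakeOther hM hα L hβ hne L' hu huI huv
      (hinner β I' p' hβ L' (L'.forest.arcs_sub _ _ harc).2.1) hk hlt

theorem extendArc [Finite V] (hM : M.IsMatching) (h : Inv M st) {u v : V} {st' : State V}
    (huv : G.Adj u v) (he : ExtendArc M st u v st') : Inv M st' := by
  cases he with
  | skip _ => exact h
  | contract α hE hout =>
    obtain ⟨I, p, L⟩ := h.layout α hE.live
    obtain ⟨hu, huI⟩ := h.outer_of_bl hE.live L (L.work _ hE.work)
    obtain ⟨hv, hvI⟩ := (h.outerIn_iff hE.live L).1 hout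
    refine h.contract hM hE.live L hu hv huI hvI ?_ huv
    rw [← h.bl_eq hE.live hu, ← h.bl_eq hE.live hv]
    exact hE.non_blossom
  | augment α β hE _ hout => exact h.augment hE.live hout.2.1 u v
  | overtake α t _ hE hout hvt hk ho => exact h.overtake hM hE huv hout hvt hk ho
  | noOvertake α _ _ _ => exact h

theorem contractible [Finite V] (hM : M.IsMatching) (h : Inv M st) {u v : V}
    (hc : Contractible M st α u v) : Inv M (st.contract M α u v) := by
  obtain ⟨I, p, L⟩ := h.layout α hc.live
  obtain ⟨hu, huI⟩ := h.outer_of_bl hc.live L (L.work _ hc.work)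
  obtain ⟨hv, hvI⟩ := h.outer_of_bl hc.live L (L.outer_iff.1 hc.outer)
  refine h.contract hM hc.live L hu hv huI hvI ?_ hc.adj
  rw [← h.bl_eq hc.live hu, ← h.bl_eq hc.live hv]
  exact hc.non_blossom.symm

theorem augmentArc (h : Inv M st) {u v : V} {st' : State V} (ha : AugmentArc M st u v st') :
    Inv M st' := by
  cases ha with
  | skip _ => exact h
  | augment α β _ h1 h2 => exact h.augment h1.2.1 h2.2.1 u v

theorem initial (M : G.Subgraph) (ε : ℝ) : Inv M (State.initial V ε) := by
  refine ⟨fun α hα => ⟨∅, id, ?_⟩, fun α β _ _ hne => ?_, fun α _ => ?_, ?_⟩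
  · have hr : ∀ x, rootAt {Blossom.triv α} x = Blossom.triv x := fun x =>
      rootAt_eq_triv fun b hb hx => by
        obtain rfl : b = Blossom.triv α := hb
        obtain rfl : x = α := hx
        rfl
    refine ⟨?_, rfl, hα.1, ?_⟩
    · refine
        { arcs_sub := fun u v h => absurd h (Set.notMem_empty _)
          family := ⟨?_, ?_, ?_, ?_⟩
          inner_triv := by simp
          inner_adj := by simp
          mate_arc := by simp
          mate_outer := by simp
          sub := subset_rfl
          par_arc := by simp
          par_outer := by simp
          cross := fun u v h => absurd h (Set.notMem_empty _)
          mate_not_root := by simp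
          roots := fun x hx => hx.1
          mate_inj := by simp
          cover := fun x hx => .inr (.inl ⟨hx, ?_⟩)
          label := by simp
          mate_mem := ?_ }
      · rintro b rfl
        exact .triv α rfl
      · rintro b rfl c rfl hne
        exact absurd rfl hne
      · rintro v rfl
        rfl
      · rintro b rfl
        exact .inl ⟨α, rfl⟩
      · obtain rfl : x = α := hx
        rfl
      · rintro x rfl t ht
        exact absurd (M.edge_vert ht) hα.1
    · rintro w hw
      obtain rfl := Option.some.inj hw
      exact ⟨α, rfl, Set.notMem_empty _, hr α⟩
  · exact Set.disjoint_singleton.2 hne.symm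
  · exact Set.disjoint_empty _
  · exact fun x hx => absurd hx (Set.notMem_empty _)

end Inv

/-- The arcs that remain to be processed in the current loop are arcs of `G`. -/
def Position.RestIn (G : SimpleGraph V) : Position V → Prop
  | .extend _ rest => ∀ a ∈ rest, G.Adj a.1 a.2
  | _ => True

/-- Adjacency of the streamed arcs is carried along only for the extend loop: `Contractible`
includes it, and Augment adds no arc to a structure. -/
theorem Step.inv [Finite V] (hM : M.IsMatching) {ε η : ℝ} {x y : Position V × State V}
    (hs : Step M ε η x y) (hx : x.1.RestIn G ∧ Inv M x.2) : y.1.RestIn G ∧ Inv M y.2 := by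
  cases hs with
  | mark τ st s _ hstream => exact ⟨fun a ha => (hstream.2 a).1 ha, hx.2.mark η⟩
  | extend τ st st' u v s he =>
    exact ⟨fun a ha => hx.1 a (List.mem_cons_of_mem _ ha),
      hx.2.extendArc hM (hx.1 (u, v) List.mem_cons_self) he⟩
  | extendEnd τ st => exact ⟨trivial, hx.2⟩
  | contract τ st α u v hc => exact ⟨trivial, hx.2.contractible hM hc⟩
  | contractEnd τ st s _ _ => exact ⟨trivial, hx.2⟩
  | augment τ st st' u v s ha => exact ⟨trivial, hx.2.augmentArc ha⟩
  | augmentEnd τ st l _ _ => exact ⟨trivial, hx.2⟩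
  | backtrack τ st α l => exact ⟨trivial, hx.2.backtrack α⟩
  | backtrackEnd τ st => exact ⟨trivial, hx.2⟩

theorem Occurs.inv [Finite V] (hM : M.IsMatching) {ε η : ℝ} {pos : Position V} {st : State V}
    (h : Occurs M ε η pos st) : Inv M st := by
  have key : ∀ x, Relation.ReflTransGen (Step M ε η) (.bundle 0, State.initial V ε) x →
      x.1.RestIn G ∧ Inv M x.2 := by
    intro x hx
    induction hx with
    | refl => exact ⟨trivial, Inv.initial M ε⟩
    | tail _ hs ih => exact hs.inv hM ih
  exact (key _ h).2

end Invariant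

end AlgPhase

theorem mainTheorem10 {V : Type*} [Finite V] (G : SimpleGraph V) (M : G.Subgraph)
    (hM : M.IsMatching) (ε h : ℝ) (hε : ∃ j : ℕ, ε = (1 / 2) ^ j)
    (hh : ∃ i : ℕ, 1 ≤ i ∧ h = (1 / 2) ^ i) (hεh : ε ^ 2 / 64 ≤ h)
    (pos : AlgPhase.Position V) (st : AlgPhase.State V) (hst : AlgPhase.Occurs M ε h pos st) :
    ∀ α : V, st.Live M α →
      AlgPhase.IsStructure M st α ∧ AlgPhase.LabelsIncrease M st.label α (st.S α) := by
  exact fun α hα => (hst.inv hM).isStructure hM hα
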